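/- **Model.** The system runs in initial access cycles of period $T>0$; every cycle consists of cell search and then random access. Path losses, powers and gains are on the linear scale. All numerical parameters below are positive (the noise power $\sigma^2\ge 0$), the numbers of beams $M_{cs},N_{cs},M_{ra},N_{ra}$ and of preambles $N_{PA}$ are positive integers, and $h:\mathbb R\to[0,1]$ is measurable. Put $K=\max(M_{cs},N_{cs})$, $N=\max(N_{cs},N_{ra})$, $l_L(r)=\beta r^{\alpha_L}$, $l_N(r)=\beta r^{\alpha_N}$, $l_L^{-1}(z)=(z/\beta)^{1/\alpha_L}$, $l_N^{-1}(z)=(z/\beta)^{1/\alpha_N}$. The users transmit either in a fixed direction ($N_{ra}=1$), or by sweeping $N_{ra}$ beams while the base stations (BSs) receive omni-directionally and cell search is done with an omni-directional user antenna ($M_{ra}=N_{cs}=1$). A user beam of width $\theta<2\pi$ has main lobe gain $G(\theta)=\frac{2\pi}{\theta}\frac{\gamma}{\gamma+1}$ and side lobe gain $g(\theta)=\frac{2\pi}{2\pi-\theta}\frac1{\gamma+1}$ with $\gamma=\frac{2\pi}{C_0(2\pi-\theta)}$, and $G(2\pi)=1$, with no side lobe; a BS with $M$ beams has main lobe gain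 $M$ and side lobe gain $0$. *Cell search.* The BSs form a homogeneous Poisson process of intensity $\lambda$ in the plane; the typical user is at the origin. A link of length $r$ is LOS with probability $h(r)$, with path loss $l_L(r)$, and otherwise NLOS with path loss $l_N(r)$; the links have i.i.d. exponential fading powers of mean $1$, and the LOS states are independent of each other and of the fading. The plane is divided into the $K$ sectors $\{\angle x\in[2\pi(j-1)/K,2\pi j/K)\}$. A sector is detected if its BS of smallest path loss, $z$ say, with fading $F_0$, satisfies $\frac{F_0/z}{I+\sigma^2/(P_bM_{cs}G(2\pi/N_{cs}))}\ge\Gamma_{cs}$, where $I$ is the sum of fading over path loss of the BSs of the sector with larger path loss. Cell search succeeds ($e_0=1$) if some sector is detected; the tagged BS is then the one of smallest path loss among the BSs of smallest path loss of the detected sectors. *Random access.* The typical user and all other users choose one of $N_{PA}$ preambles uniformly and independently. Random access succeeds ($\delta_0=1$) if there is a tagged BS, no preamble collision occurs, and the preamble SINR at the tagged BS, under its receive beam (one of $M_{ra}$ equal ones) that covers the typical user, is at least $\Gamma_{ra}$. Here the following approximations are part of the model. The other users in random access form a homogeneous Poisson process of intensity $\lambda_u\mathbb P(e_0=1)$,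 independent of the BS process. The interferers are the users of this process with the preamble of the typical user in the sector covered by that receive beam; their links to the tagged BS have independent LOS states (with probability $h(r)$ at length $r$) and exponential fading of mean $1$; the interferer transmits with gain $G(2\pi/N)$ if its beam covers the tagged BS and $g(2\pi/N)$ otherwise, where, if $N_{ra}=1$, the former holds independently with probability $1/N$, and if $N_{ra}>1$, the beams are swept synchronously with the typical user. With $Z_0$ the path loss to the tagged BS and $F$ exponential of mean $1$, the preamble SINR is $\frac{FM_{ra}G(2\pi/N)/Z_0}{I'+\sigma^2/P_u}$, where $I'$ is the sum over the interferers of fading times $M_{ra}$ times transmit gain over path loss. The users that can collide form a Poisson process of the same intensity $\lambda_u\mathbb P(e_0=1)$ in a cell of area $1.28/\lambda$, independent of everything else, with uniform preambles and uniform receive beams; a collision occurs if one of them has the preamble and the receive beam of the typical user. The uplink fading $F$, the preamble of the typical user and these processes are independent of each other and of the marked BS process. Different cycles are independent and follow the same model. **Functions.** For $z,t>0$ and $\ell\ge0$, $$V(z,t,\ell)=\exp\Bigl\{-2\pi\ell\Bigl(\int_{l_L^{-1}(z)}^\infty\frac{tz\,h(r)r\,dr}{tz+l_L(r)}+\int_{l_N^{-1}(z)}^\infty\frac{tz(1-h(r))r\,dr}{tz+l_N(r)}\Bigr)\Bigr\},$$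 and $U(z,t,\ell)$ is the same with both integrals over $(0,\infty)$ (with $e^{-\infty}=0$, $0\cdot\infty=0$). Let $$f_{Z_1}(z)=\frac{2\pi\lambda}{K}\Bigl[\frac{z^{2/\alpha_L-1}h(l_L^{-1}(z))}{\alpha_L\beta^{2/\alpha_L}}+\frac{z^{2/\alpha_N-1}(1-h(l_N^{-1}(z)))}{\alpha_N\beta^{2/\alpha_N}}\Bigr]\exp\Bigl(-\frac{2\pi\lambda}{K}\Bigl[\int_0^{l_L^{-1}(z)}h(r)r\,dr+\int_0^{l_N^{-1}(z)}(1-h(r))r\,dr\Bigr]\Bigr),$$ $$\tilde P(z)=\exp\Bigl(-\frac{\Gamma_{cs}z\sigma^2}{P_bM_{cs}G(2\pi/N_{cs})}\Bigr)V\bigl(z,\Gamma_{cs},\tfrac{\lambda}{K}\bigr),\quad P(z_0)=\int_{z_0}^\infty\tilde P(z)f_{Z_1}(z)\,dz,\quad \hat P=1-(1-P(0))^{K},$$ $$P_{co}=\exp\Bigl(-\frac{1.28\,\lambda_u\hat P}{\lambda N_{PA}M_{ra}}\Bigr),$$ $$P_{ra}(z)=\exp\Bigl(-\frac{\Gamma_{ra}z\sigma^2}{P_uM_{ra}G(2\pi/N)}\Bigr)U\Bigl(z,\Gamma_{ra},\frac{\lambda_u\hat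 P}{NM_{ra}N_{PA}}\Bigr)U\Bigl(z,\frac{g(2\pi/N)}{G(2\pi/N)}\Gamma_{ra},\bigl(1-\tfrac1N\bigr)\frac{\lambda_u\hat P}{M_{ra}N_{PA}}\Bigr)$$ (for $N=1$ the last factor is $1$). **Theorem.** In every cycle the initial access success probability $\eta_{IA}=\mathbb E[e_0\delta_0]$ of the typical user is given by the (convergent) integral $$\eta_{IA}=\int_0^\infty K\bigl(P(z_0)+1-P(0)\bigr)^{K-1}\tilde P(z_0)\,f_{Z_1}(z_0)\,P_{co}\,P_{ra}(z_0)\,dz_0 .$$ Let $L_0$ be the index of the first cycle in which initial access succeeds, and $D_0=(L_0-1)T+(M_{cs}N_{cs}\tau_{cs}+M_{ra}N_{ra}\tau_{ra})$. Then $$\mathbb E[D_0]=\Bigl(\frac1{\eta_{IA}}-1\Bigr)T+(M_{cs}N_{cs}\tau_{cs}+M_{ra}N_{ra}\tau_{ra})$$ (both sides being $+\infty$ if $\eta_{IA}=0$). -/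

import Mathlib

open MeasureTheory ProbabilityTheory Set
open scoped ENNReal NNReal

noncomputable section

namespace MmWave

/-! ### Poisson point processes -/

/-- A Poisson point process on `E` with (diffuse, σ-finite) intensity measure `μ`, given as a random
countable subset `Φ ω` of `E`: the number of points in a measurable set `A` of finite intensity is a
Poisson variable of mean `μ A`, and the numbers of points in disjoint such sets are independent. -/
structure IsPoissonProcess {Ω E : Type*} [MeasurableSpace Ω] [MeasurableSpace E]
    (P : Measure Ω) (Φ : Ω → Set E) (μ : Measure E) : Prop where
  countable : ∀ ω, (Φ ω).Countable
  measurable_count : ∀ A, MeasurableSet A → Measurable fun ω => (Φ ω ∩ A).encard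
  law_count : ∀ A, MeasurableSet A → μ A ≠ ∞ →
    P.map (fun ω => (Φ ω ∩ A).encard) =
      (poissonMeasure (μ A).toNNReal).map (fun n : ℕ => (n : ℕ∞))
  indep_count : ∀ (n : ℕ) (A : Fin n → Set E), (∀ i, MeasurableSet (A i)) → (∀ i, μ (A i) ≠ ∞) →
    Pairwise (fun i j => Disjoint (A i) (A j)) →
    iIndepFun (fun (i : Fin n) (ω : Ω) => (Φ ω ∩ A i).encard) P

/-- The σ-algebra generated by a random set of points: it is generated by its counts. -/
@[reducible] def pointSigma {Ω E : Type*} [MeasurableSpace E] (Φ : Ω → Set E) : MeasurableSpace Ω :=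
  ⨆ A : {A : Set E // MeasurableSet A},
    MeasurableSpace.comap (fun ω => (Φ ω ∩ A.1).encard) inferInstance

/-! ### The parameters of the network -/

/-- The parameters of the network. Powers, gains and path losses are on the linear scale. -/
structure Network where
  /-- intensity of the base stations (BSs) -/
  lamB : ℝ
  /-- intensity of the users -/
  lamU : ℝ
  /-- transmit power of a BS -/
  Pb : ℝ
  /-- transmit power of a user -/
  Pu : ℝ
  /-- thermal noise power -/
  noise : ℝ
  /-- constant of the user's antenna pattern -/
  C0 : ℝ
  /-- path loss at the reference distance -/
  beta : ℝ
  /-- LOS path loss exponent -/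
  alphaL : ℝ
  /-- NLOS path loss exponent -/
  alphaN : ℝ
  /-- SINR threshold of the synchronization signal -/
  Gcs : ℝ
  /-- SINR threshold of the random access preamble -/
  Gra : ℝ
  /-- initial access cycle period -/
  T : ℝ
  /-- duration of a synchronization signal -/
  tauCs : ℝ
  /-- duration of a random access preamble -/
  tauRa : ℝ
  /-- probability that a link of length `r` is LOS -/
  h : ℝ → ℝ
  /-- number of BS beam directions in cell search -/
  Mcs : ℕ
  /-- number of user beam directions in cell search -/
  Ncs : ℕ
  /-- number of BS beam directions in random access -/
  Mra : ℕ
  /-- number of user beam directions in random access -/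
  Nra : ℕ
  /-- number of preamble sequences -/
  Npa : ℕ
  /-- the association cell of the tagged BS, relative to that BS -/
  cell : Set ℂ
  lamB_pos : 0 < lamB
  lamU_pos : 0 < lamU
  Pb_pos : 0 < Pb
  Pu_pos : 0 < Pu
  noise_nonneg : 0 ≤ noise
  C0_pos : 0 < C0
  beta_pos : 0 < beta
  alphaL_pos : 0 < alphaL
  alphaN_pos : 0 < alphaN
  Gcs_pos : 0 < Gcs
  Gra_pos : 0 < Gra
  T_pos : 0 < T
  tauCs_pos : 0 < tauCs
  tauRa_pos : 0 < tauRa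
  h_meas : Measurable h
  h_nonneg : ∀ r, 0 ≤ h r
  h_le_one : ∀ r, h r ≤ 1
  Mcs_pos : 0 < Mcs
  Ncs_pos : 0 < Ncs
  Mra_pos : 0 < Mra
  Nra_pos : 0 < Nra
  Npa_pos : 0 < Npa
  cell_meas : MeasurableSet cell
  /-- the area of the cell is the mean area of the association cell of the tagged BS -/
  cell_area : volume cell = ENNReal.ofReal (1.28 / lamB)

namespace Network

variable (s : Network)

/-- The number `K_cs` of BS sectors. -/
def Kcs : ℕ := max s.Mcs s.Ncs

/-- The number of beams of a user. -/
def N : ℕ := max s.Ncs s.Nra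

/-- LOS path loss function. -/
def lossL (r : ℝ) : ℝ := s.beta * r ^ s.alphaL

/-- NLOS path loss function. -/
def lossN (r : ℝ) : ℝ := s.beta * r ^ s.alphaN

/-- Path loss of a link of length `r` with blockage mark `u`; the mark is uniform on `[0, 1]` and the
link is LOS iff `u ≤ h r`, hence with probability `h r`. -/
def loss (r u : ℝ) : ℝ := open Classical in if u ≤ s.h r then s.lossL r else s.lossN r

/-- Main lobe gain of the user's antenna with beamwidth `θ`; the front-back power ratio
is `γ = 2π / (C₀ (2π - θ))`. For `θ = 2π` (omni-directional, `γ = ∞`) the gain is `1`. -/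
def mainGain (θ : ℝ) : ℝ :=
  open Classical in
  if θ = 2 * Real.pi then 1 else
    let γ := 2 * Real.pi / (s.C0 * (2 * Real.pi - θ))
    2 * Real.pi / θ * (γ / (γ + 1))

/-- Side lobe gain of the user's antenna with beamwidth `θ`. For `θ = 2π` there is no side lobe, and
the value is irrelevant. -/
def sideGain (θ : ℝ) : ℝ :=
  open Classical in
  if θ = 2 * Real.pi then 0 else
    let γ := 2 * Real.pi / (s.C0 * (2 * Real.pi - θ))
    2 * Real.pi / (2 * Real.pi - θ) * (1 / (γ + 1))

end Network

/-! ### Geometry -/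

/-- The infinite sector `S(x, θ₁, θ₂)`: the points seen from `x` under an angle in `[θ₁, θ₂)`. The
plane is `ℂ`, with its Euclidean norm and Lebesgue measure. -/
def sector (x : ℂ) (θ₁ θ₂ : ℝ) : Set ℂ :=
  {y | ∃ r : ℝ, 0 < r ∧ ∃ θ ∈ Ico θ₁ θ₂, y - x = r * Complex.exp (θ * Complex.I)}

/-- The main lobe of the `j`-th (counted from `0`) of `k` equal beams of a station located at `x`. -/
def beam (x : ℂ) (k j : ℕ) : Set ℂ :=
  sector x (2 * Real.pi * j / k) (2 * Real.pi * (j + 1) / k)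

/-! ### One initial access cycle -/

/-- A BS: its location, the blockage mark of its link to the typical user, and the fading power of
this link. -/
abbrev BS : Type := ℂ × ℝ × ℝ

/-- A user in random access: its location, its preamble, the blockage mark of its link to the tagged
BS, whether its own beam (if it is a fixed one) covers the tagged BS, and the fading power of its link
to the tagged BS. -/
abbrev RAUser (s : Network) : Type := ℂ × Fin s.Npa × ℝ × Bool × ℝ

/-- Another user of the tagged cell: its location relative to the tagged BS, its preamble and the
receive beam of the tagged BS under which it is received. -/
abbrev CellUser (s : Network) : Type := ℂ × Fin s.Npa × Fin s.Mra

/-- The random objects of an initial access cycle. -/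
structure Cycle (Ω : Type*) (s : Network) where
  /-- the marked BS process -/
  bs : Ω → Set BS
  /-- the other users in random access, as potential interferers at the tagged BS -/
  users : Ω → Set (RAUser s)
  /-- the other users in random access associated with the tagged BS -/
  cellUsers : Ω → Set (CellUser s)
  /-- uplink fading power of the link from the typical user to the tagged BS -/
  fade : Ω → ℝ
  /-- preamble of the typical user -/
  preamble : Ω → Fin s.Npa

/-- The uniform distribution on `[0, 1]`. -/
def unitUniform : Measure ℝ := volume.restrict (Icc 0 1)

/-- The uniform distribution on `Fin n`. -/
def finUniform (n : ℕ) : Measure (Fin n) := (n : ℝ≥0∞)⁻¹ • Measure.count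

/-- The Bernoulli distribution giving `true` the probability `1 / n`. -/
def bernoulliInv (n : ℕ) : Measure Bool :=
  ENNReal.ofReal (1 / n) • Measure.dirac true + ENNReal.ofReal (1 - 1 / n) • Measure.dirac false

namespace Cycle

variable {Ω : Type*} {s : Network} (C : Cycle Ω s)

/-- Path loss from the typical user, who is at the origin, to a BS. -/
def bsLoss (s : Network) (p : BS) : ℝ := s.loss ‖p.1‖ p.2.1

/-- The BSs in the `j`-th BS sector. -/
def bsIn (ω : Ω) (j : Fin s.Kcs) : Set BS := {p ∈ C.bs ω | p.1 ∈ beam 0 s.Kcs j}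

/-- The SINR of the synchronization signal of the BS `p` of sector `j` at the typical user; the
interferers are the BSs of the sector with larger path loss. -/
def sinrSS (ω : Ω) (j : Fin s.Kcs) (p : BS) : ℝ≥0∞ :=
  ENNReal.ofReal (p.2.2 / bsLoss s p) /
    ((∑' q : {q // q ∈ C.bsIn ω j ∧ bsLoss s p < bsLoss s q},
        ENNReal.ofReal (q.1.2.2 / bsLoss s q.1)) +
      ENNReal.ofReal (s.noise / (s.Pb * s.Mcs * s.mainGain (2 * Real.pi / s.Ncs))))

/-- Sector `j` is detected in cell search, and `p` is its BS of smallest path loss. -/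
def Detects (ω : Ω) (j : Fin s.Kcs) (p : BS) : Prop :=
  p ∈ C.bsIn ω j ∧ (∀ q ∈ C.bsIn ω j, bsLoss s p ≤ bsLoss s q) ∧
    ENNReal.ofReal s.Gcs ≤ C.sinrSS ω j p

/-- Cell search succeeds: at least one BS sector is detected. -/
def CellSearch (ω : Ω) : Prop := ∃ j p, C.Detects ω j p

/-- `p` is the tagged BS: it has the smallest path loss across all detected sectors. -/
def IsTagged (ω : Ω) (p : BS) : Prop :=
  (∃ j, C.Detects ω j p) ∧ ∀ j q, C.Detects ω j q → bsLoss s p ≤ bsLoss s q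

/-- The location of the tagged BS `x` is in the main lobe of the transmit beam of the user `u`. If the
users transmit in the fixed direction found in cell search, this is the mark of the user. If they
sweep synchronously through `Nra` beams, it has to hold for the beam index with which the typical
user covers the tagged BS. -/
def InMainLobe (x : ℂ) (u : RAUser s) : Prop :=
  (s.Nra = 1 ∧ u.2.2.2.1 = true) ∨
    (s.Nra ≠ 1 ∧ ∃ n : Fin s.Nra, x ∈ beam 0 s.Nra n ∧ x ∈ beam u.1 s.Nra n)

/-- Transmit gain towards `x` of the user `u`. -/
def userGain (x : ℂ) (u : RAUser s) : ℝ :=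
  open Classical in
  if InMainLobe x u then s.mainGain (2 * Real.pi / s.N) else s.sideGain (2 * Real.pi / s.N)

/-- The SINR of the preamble of the typical user at the tagged BS `p` under its receive beam `m`
(of gain `Mra`, without side lobe); the interferers are the users with the same preamble that are
received under this beam. -/
def sinrPA (ω : Ω) (p : BS) (m : Fin s.Mra) : ℝ≥0∞ :=
  ENNReal.ofReal (C.fade ω * s.Mra * s.mainGain (2 * Real.pi / s.N) / bsLoss s p) /
    ((∑' u : {u // u ∈ C.users ω ∧ u.2.1 = C.preamble ω ∧ u.1 ∈ beam p.1 s.Mra m},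
        ENNReal.ofReal (u.1.2.2.2.2 * s.Mra * userGain p.1 u.1 /
          s.loss ‖u.1.1 - p.1‖ u.1.2.2.1)) +
      ENNReal.ofReal (s.noise / s.Pu))

/-- No other user of the tagged cell uses the preamble of the typical user and is received under the
beam `m`. -/
def NoCollision (ω : Ω) (m : Fin s.Mra) : Prop :=
  ∀ v ∈ C.cellUsers ω, ¬ (v.2.1 = C.preamble ω ∧ v.2.2 = m)

/-- Random access succeeds at the tagged BS: no preamble collision, and the SINR of the preamble
reaches the threshold, under the receive beam that covers the typical user. -/
def RandomAccess (ω : Ω) : Prop :=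
  ∃ p, C.IsTagged ω p ∧ ∃ m : Fin s.Mra, (0 : ℂ) ∈ beam p.1 s.Mra m ∧
    C.NoCollision ω m ∧ ENNReal.ofReal s.Gra ≤ C.sinrPA ω p m

/-- Initial access succeeds in this cycle. -/
def Success (ω : Ω) : Prop := C.CellSearch ω ∧ C.RandomAccess ω

/-- The σ-algebras of the five random objects of the cycle. -/
@[reducible] def parts : Fin 5 → MeasurableSpace Ω :=
  ![pointSigma C.bs, pointSigma C.users, pointSigma C.cellUsers,
    MeasurableSpace.comap C.fade inferInstance, MeasurableSpace.comap C.preamble inferInstance]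

/-- The σ-algebra of the cycle. -/
@[reducible] def sigma : MeasurableSpace Ω := ⨆ i, C.parts i

/-- Intensity of the users that take part in random access: the user intensity times the
probability that cell search succeeds. -/
def raIntensity [MeasurableSpace Ω] (P : Measure Ω) : ℝ≥0∞ :=
  ENNReal.ofReal s.lamU * P {ω | C.CellSearch ω}

/-- The probabilistic model of a cycle. The BSs form a homogeneous Poisson process with independent
blockage marks and Rayleigh fading. The users in random access form a homogeneous Poisson process that
is independent of the BSs, with independent uniform preambles, blockage marks, beam marks and Rayleigh
fading. The users that can collide are an independent Poisson process of the same intensity in the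
tagged cell, with uniform preambles and uniform BS receive beams. -/
structure IsModel [MeasurableSpace Ω] (P : Measure Ω) : Prop where
  bs_law : IsPoissonProcess P C.bs
    (ENNReal.ofReal s.lamB • (volume : Measure ℂ).prod (unitUniform.prod (expMeasure 1)))
  users_law : IsPoissonProcess P C.users
    (C.raIntensity P • (volume : Measure ℂ).prod ((finUniform s.Npa).prod
      (unitUniform.prod ((bernoulliInv s.N).prod (expMeasure 1)))))
  cellUsers_law : IsPoissonProcess P C.cellUsers
    (C.raIntensity P • ((volume : Measure ℂ).restrict s.cell).prod
      ((finUniform s.Npa).prod (finUniform s.Mra)))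
  fade_meas : Measurable C.fade
  fade_law : P.map C.fade = expMeasure 1
  preamble_meas : Measurable C.preamble
  preamble_law : P.map C.preamble = finUniform s.Npa
  indep : iIndep C.parts P

end Cycle

/-! ### The delay -/

/-- The number `L₀` of cycles until initial access succeeds, `⊤` if it never does. -/
def numCycles {Ω : Type*} {s : Network} (C : ℕ → Cycle Ω s) (ω : Ω) : ℕ∞ :=
  ⨅ (c : ℕ) (_ : (C c).Success ω), ((c + 1 : ℕ) : ℕ∞)

/-- Duration of cell search and random access in a cycle. -/
def accessTime (s : Network) : ℝ := s.Mcs * s.Ncs * s.tauCs + s.Mra * s.Nra * s.tauRa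

/-- The initial access delay `D₀ = (L₀ - 1) T + (Mcs Ncs τcs + Mra Nra τra)`. -/
def delay {Ω : Type*} {s : Network} (C : ℕ → Cycle Ω s) (ω : Ω) : ℝ≥0∞ :=
  ((numCycles C ω : ℝ≥0∞) - 1) * ENNReal.ofReal s.T + ENNReal.ofReal (accessTime s)

/-! ### The functions in the formula -/

/-- `exp (-x)`, with value `0` at `x = ∞`. -/
def expNeg (x : ℝ≥0∞) : ℝ := open Classical in if x = ∞ then 0 else Real.exp (-x.toReal)

namespace Network

variable (s : Network)

/-- Inverse of the LOS path loss function. -/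
def invL (z : ℝ) : ℝ := (z / s.beta) ^ (1 / s.alphaL)

/-- Inverse of the NLOS path loss function. -/
def invN (z : ℝ) : ℝ := (z / s.beta) ^ (1 / s.alphaN)

/-- The function `V(z, t, l)`; it is `0` if one of its integrals diverges. -/
def V (z t l : ℝ) : ℝ :=
  expNeg (ENNReal.ofReal (2 * Real.pi * l) *
    ((∫⁻ r in Ioi (s.invL z), ENNReal.ofReal (t * z * s.h r * r / (t * z + s.lossL r))) +
      ∫⁻ r in Ioi (s.invN z), ENNReal.ofReal (t * z * (1 - s.h r) * r / (t * z + s.lossN r))))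

/-- The function `U(z, t, l)`; for `l > 0` it is `0` if one of its integrals diverges. -/
def U (z t l : ℝ) : ℝ :=
  expNeg (ENNReal.ofReal (2 * Real.pi * l) *
    ((∫⁻ r in Ioi (0 : ℝ), ENNReal.ofReal (t * z * s.h r * r / (t * z + s.lossL r))) +
      ∫⁻ r in Ioi (0 : ℝ), ENNReal.ofReal (t * z * (1 - s.h r) * r / (t * z + s.lossN r))))

/-- `2πλ / K_cs`. -/
def sectorRate : ℝ := 2 * Real.pi * s.lamB / s.Kcs

/-- The density `f_{Z₁}` of the smallest path loss in a BS sector. -/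
def minLossDensity (z : ℝ) : ℝ :=
  (s.sectorRate * (1 / s.alphaL) * (1 / s.beta) ^ (2 / s.alphaL) * z ^ (2 / s.alphaL - 1) *
        s.h (s.invL z) +
      s.sectorRate * (1 / s.alphaN) * (1 / s.beta) ^ (2 / s.alphaN) * z ^ (2 / s.alphaN - 1) *
        (1 - s.h (s.invN z))) *
    Real.exp (-s.sectorRate * ∫ r in (0 : ℝ)..s.invL z, s.h r * r) *
    Real.exp (-s.sectorRate * ∫ r in (0 : ℝ)..s.invN z, (1 - s.h r) * r)

/-- The conditional detection probability of a BS sector with smallest path loss `z`. -/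
def condDetect (z : ℝ) : ℝ :=
  Real.exp (-(s.Gcs * z * s.noise / (s.Pb * s.Mcs * s.mainGain (2 * Real.pi / s.Ncs)))) *
    s.V z s.Gcs (s.lamB / s.Kcs)

/-- The probability that a BS sector is detected with smallest path loss at least `z₀`. -/
def detectAbove (z₀ : ℝ) : ℝ := ∫ z in Ioi z₀, s.condDetect z * s.minLossDensity z

/-- The detection probability of a BS sector. -/
def detect : ℝ := s.detectAbove 0

/-- The success probability of cell search. -/
def cellSearchProb : ℝ := 1 - (1 - s.detect) ^ s.Kcs

/-- The density of the path loss to the tagged BS (on `(0, ∞)`). -/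
def servingLossDensity (z₀ : ℝ) : ℝ :=
  s.Kcs * (s.detectAbove z₀ + 1 - s.detect) ^ (s.Kcs - 1) * s.condDetect z₀ * s.minLossDensity z₀

/-- The probability of no preamble collision. -/
def Pco : ℝ := Real.exp (-(1.28 * s.lamU * s.cellSearchProb / (s.lamB * s.Npa * s.Mra)))

/-- The probability that the SINR of the preamble reaches the threshold if the path loss to the
tagged BS is `z`. -/
def Pra (z : ℝ) : ℝ :=
  Real.exp (-(s.Gra * z * s.noise / (s.Pu * s.Mra * s.mainGain (2 * Real.pi / s.N)))) *
    s.U z s.Gra (s.lamU * s.cellSearchProb / (s.N * s.Mra * s.Npa)) *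
    s.U z (s.sideGain (2 * Real.pi / s.N) / s.mainGain (2 * Real.pi / s.N) * s.Gra)
      ((1 - 1 / s.N) * (s.lamU * s.cellSearchProb / (s.Mra * s.Npa)))

end Network

end MmWave

end

/-!
A point process enters only through its counting measure, so each Poisson process is replaced by its law
on the space of measures (`IsPoissonLaw`). Three facts about such laws carry the proof: Mecke's formula
(`IsPoissonLaw.mecke`), the Laplace functional (`IsPoissonLaw.lintegral_eNeg`) and the independence of
the restrictions to disjoint sets (`IsPoissonLaw.iIndepFun_restrict`). Mecke's formula is the
Chen–Stein identity of the Poisson distribution for one count; independence extends it to finitely many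
counts, and a π-system argument to all functionals.

*Cell search.* A base station of path loss `z` is the nearest of its sector, in path loss, and is
detected iff no other one has smaller path loss and its exponential fading exceeds a multiple of
interference plus noise. Integrating over the fading gives an exponential of a sum over the process,
where a base station of smaller path loss contributes `∞`; its mean is a Laplace functional, equal to
`condDetect z` times the void probability of path losses below `z` (`lintegral_detSet`). By Mecke's
formula, the mean number of detected base stations of a sector has the density
`condDetect * minLossDensity` in `z` (`lintegral_detection`, `lintegral_detCount`). Path losses have a
diffuse intensity, so there are no ties and this number is `0` or `1`; hence its mean is a probability
(`measure_detCount_eq_zero`). The sectors are independent and congruent, which gives the success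
probability of cell search (`IsModel.measure_cellSearch`). A detected base station is the tagged one if
the other `Kcs - 1` sectors detect nothing of smaller path loss, so `servingLossDensity` is the density
of the path loss to the tagged base station (`lintegral_tagSet`).

*Random access.* At a fixed base station, the absence of collisions is a void event
(`measure_noCollision`), and the SINR condition is again a Laplace functional (`lintegral_sinrSet`). A
fraction `1 / N` of the interferers has the base station in its main lobe, whether the user beams are
fixed or swept synchronously (`lintegral_mainLobe`); this produces the two factors `U` of `Pra`. The
resulting probability depends on the base station through its path loss only (`measure_raSet`). Since the
processes of random access are independent of the base stations, it may be integrated against the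
density of the path loss to the tagged base station (`IsModel.measure_success`).

*Delay.* The success events of the cycles are independent with a common probability, so the number of
failures before the first success is geometric (`lintegral_numCycles_sub_one`).
-/

noncomputable section


namespace MmWave

/-! ### Poisson laws on the space of measures -/

/-- The Chen–Stein identity of the Poisson distribution, the one-set case of Mecke's formula. -/
lemma lintegral_poissonMeasure_mul (r : ℝ≥0) (f : ℕ → ℝ≥0∞) :
    ∫⁻ n, (n : ℝ≥0∞) * f n ∂(poissonMeasure r) = r * ∫⁻ n, f (n + 1) ∂(poissonMeasure r) := by
  rw [lintegral_countable', lintegral_countable', tsum_eq_zero_add' ENNReal.summable,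
    ← ENNReal.tsum_mul_left]
  simp only [Nat.cast_zero, zero_mul, zero_add]
  refine tsum_congr fun n => ?_
  rw [poissonMeasure_singleton, poissonMeasure_singleton]
  have h1 : ((n + 1 : ℕ) : ℝ≥0∞) = ENNReal.ofReal (n + 1 : ℝ) := by
    rw [← ENNReal.ofReal_natCast]; push_cast; rfl
  have h2 : (r : ℝ≥0∞) = ENNReal.ofReal (r : ℝ) := by simp
  rw [mul_right_comm, h1, h2, ← ENNReal.ofReal_mul (by positivity), mul_comm (f (n + 1)),
    ← mul_assoc, ← ENNReal.ofReal_mul (by positivity)]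
  congr 2
  rw [Nat.factorial_succ, pow_succ]
  push_cast
  field_simp

lemma expNeg_zero : expNeg 0 = 1 := by simp [expNeg]

lemma expNeg_top : expNeg ∞ = 0 := by simp [expNeg]

lemma expNeg_of_ne_top {x : ℝ≥0∞} (hx : x ≠ ∞) : expNeg x = Real.exp (-x.toReal) := by
  simp [expNeg, hx]

lemma expNeg_ofReal {x : ℝ} (hx : 0 ≤ x) : expNeg (ENNReal.ofReal x) = Real.exp (-x) := by
  rw [expNeg_of_ne_top ENNReal.ofReal_ne_top, ENNReal.toReal_ofReal hx]

lemma expNeg_nonneg (x : ℝ≥0∞) : 0 ≤ expNeg x := by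
  unfold expNeg; split_ifs; exacts [le_rfl, (Real.exp_pos _).le]

lemma expNeg_le_one (x : ℝ≥0∞) : expNeg x ≤ 1 := by
  unfold expNeg; split_ifs; exacts [zero_le_one, Real.exp_le_one_iff.2 (by simp)]

lemma expNeg_add (x y : ℝ≥0∞) : expNeg (x + y) = expNeg x * expNeg y := by
  by_cases hx : x = ∞
  · simp [hx, expNeg_top]
  by_cases hy : y = ∞
  · simp [hy, expNeg_top]
  rw [expNeg_of_ne_top hx, expNeg_of_ne_top hy, expNeg_of_ne_top (by simp [hx, hy]),
    ENNReal.toReal_add hx hy, neg_add, Real.exp_add]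

lemma expNeg_sum {ι : Type*} (s : Finset ι) (f : ι → ℝ≥0∞) :
    expNeg (∑ i ∈ s, f i) = ∏ i ∈ s, expNeg (f i) := by
  classical
  induction s using Finset.induction with
  | empty => simp [expNeg_zero]
  | insert a s ha ih => rw [Finset.sum_insert ha, Finset.prod_insert ha, expNeg_add, ih]

lemma continuous_expNeg : Continuous expNeg := by
  rw [continuous_iff_continuousAt]
  intro x
  by_cases hx : x = ∞
  · subst hx
    rw [ContinuousAt, expNeg_top, Metric.tendsto_nhds]
    intro ε hε
    have := (Real.tendsto_exp_neg_atTop_nhds_zero.eventually (gt_mem_nhds hε)).exists_forall_of_atTop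
    obtain ⟨a, ha⟩ := this
    filter_upwards [lt_mem_nhds (ENNReal.ofReal_lt_top : ENNReal.ofReal (max a 0) < ∞)] with y hy
    rw [Real.dist_eq, sub_zero, abs_of_nonneg (expNeg_nonneg y)]
    by_cases hy' : y = ∞
    · simpa [hy', expNeg_top] using hε
    rw [expNeg_of_ne_top hy']
    apply ha
    exact (le_max_left a 0).trans ((ENNReal.ofReal_lt_iff_lt_toReal (le_max_right _ _) hy').1 hy).le
  · have : ContinuousAt (fun y : ℝ≥0∞ => Real.exp (-y.toReal)) x :=
      Real.continuous_exp.continuousAt.comp (ENNReal.continuousAt_toReal hx).neg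
    refine this.congr ?_
    filter_upwards [isOpen_ne.mem_nhds hx] with y hy
    exact (expNeg_of_ne_top hy).symm

lemma expNeg_antitone : Antitone expNeg := by
  intro x y hxy
  by_cases hy : y = ∞
  · rw [hy, expNeg_top]; exact expNeg_nonneg x
  have hx : x ≠ ∞ := ne_top_of_le_ne_top hy hxy
  rw [expNeg_of_ne_top hx, expNeg_of_ne_top hy]
  exact Real.exp_le_exp.2 (neg_le_neg (ENNReal.toReal_mono hy hxy))

/-- `expNeg` with values in `ℝ≥0∞`. -/
def eNeg (x : ℝ≥0∞) : ℝ≥0∞ := ENNReal.ofReal (expNeg x)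

lemma continuous_eNeg : Continuous eNeg := ENNReal.continuous_ofReal.comp continuous_expNeg

lemma measurable_eNeg : Measurable eNeg := continuous_eNeg.measurable

lemma eNeg_zero : eNeg 0 = 1 := by simp [eNeg, expNeg_zero]

lemma eNeg_top : eNeg ∞ = 0 := by simp [eNeg, expNeg_top]

lemma eNeg_add (x y : ℝ≥0∞) : eNeg (x + y) = eNeg x * eNeg y := by
  rw [eNeg, expNeg_add, ENNReal.ofReal_mul (expNeg_nonneg x)]; rfl

lemma eNeg_le_one (x : ℝ≥0∞) : eNeg x ≤ 1 := by
  simpa [eNeg] using expNeg_le_one x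

lemma eNeg_antitone : Antitone eNeg := fun _ _ h => ENNReal.ofReal_le_ofReal (expNeg_antitone h)

lemma eNeg_sum {ι : Type*} (s : Finset ι) (f : ι → ℝ≥0∞) :
    eNeg (∑ i ∈ s, f i) = ∏ i ∈ s, eNeg (f i) := by
  rw [eNeg, expNeg_sum, ENNReal.ofReal_prod_of_nonneg fun i _ => expNeg_nonneg _]; rfl

lemma eNeg_nsmul (n : ℕ) (x : ℝ≥0∞) : eNeg (n * x) = eNeg x ^ n := by
  induction n with
  | zero => simp [eNeg_zero]
  | succ n ih => push_cast; rw [add_mul, one_mul, eNeg_add, ih, pow_succ]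

/-- The generating function of the Poisson distribution, at `e⁻ˣ`. -/
lemma lintegral_poissonMeasure_eNeg (r : ℝ≥0) (x : ℝ≥0∞) :
    ∫⁻ n, eNeg (n * x) ∂(poissonMeasure r) = eNeg (r * (1 - eNeg x)) := by
  have hx0 := expNeg_nonneg x
  have hx1 := expNeg_le_one x
  set y := expNeg x with hy
  have h1 : (r : ℝ≥0∞) * (1 - eNeg x) = ENNReal.ofReal (r * (1 - y)) := by
    rw [ENNReal.ofReal_mul r.coe_nonneg, ENNReal.ofReal_sub _ hx0]; simp [eNeg, hy]
  rw [h1, eNeg, expNeg_ofReal (mul_nonneg r.coe_nonneg (by linarith)), lintegral_countable']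
  have h2 : ∀ n : ℕ, eNeg (n * x) * poissonMeasure r {n} =
      ENNReal.ofReal (Real.exp (-r) * ((r * y) ^ n / n.factorial)) := by
    intro n
    rw [eNeg_nsmul, poissonMeasure_singleton, eNeg, ← ENNReal.ofReal_pow hx0,
      ← ENNReal.ofReal_mul (by positivity)]
    congr 1
    rw [mul_pow]; ring
  simp_rw [h2]
  have hs := (NormedSpace.expSeries_div_hasSum_exp (r * y : ℝ)).mul_left (Real.exp (-r))
  rw [← ENNReal.ofReal_tsum_of_nonneg (fun n => by positivity) hs.summable, hs.tsum_eq,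
    ← Real.exp_eq_exp_ℝ, ← Real.exp_add]
  congr 2; ring

variable {E : Type*} [MeasurableSpace E]

/-- The law `Q`, on the space of measures on `E`, of a Poisson random measure with intensity `μ`: the
mass of a set of finite intensity is Poisson, the masses of disjoint such sets are independent. -/
structure IsPoissonLaw (Q : Measure (Measure E)) (μ : Measure E) : Prop where
  law : ∀ A, MeasurableSet A → μ A ≠ ∞ →
    Q.map (fun N => N A) = (poissonMeasure (μ A).toNNReal).map (fun n : ℕ => (n : ℝ≥0∞))
  indep : ∀ (n : ℕ) (A : Fin n → Set E), (∀ i, MeasurableSet (A i)) → (∀ i, μ (A i) ≠ ∞) →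
    Pairwise (fun i j => Disjoint (A i) (A j)) →
    iIndepFun (fun (i : Fin n) (N : Measure E) => N (A i)) Q

/-- The counting measure of the point set `Φ`. It turns a random point set into a random element of
`Measure E`, whose σ-algebra is generated by the evaluations. -/
def pointMeasure (Φ : Set E) : Measure E := Measure.count.restrict Φ

lemma pointMeasure_apply (Φ : Set E) {A : Set E} (hA : MeasurableSet A) [MeasurableSingletonClass E]
    (hΦ : Φ.Countable) :
    pointMeasure Φ A = (Φ ∩ A).encard := by
  rw [pointMeasure, Measure.restrict_apply hA, Measure.count_apply (hA.inter hΦ.measurableSet),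
    inter_comm]

lemma measurable_pointMeasure [MeasurableSingletonClass E] {Ω : Type*} {Φ : Ω → Set E}
    (hΦ : ∀ ω, (Φ ω).Countable) :
    Measurable[pointSigma Φ] fun ω => pointMeasure (Φ ω) := by
  refine Measure.measurable_of_measurable_coe _ fun A hA => ?_
  simp_rw [pointMeasure_apply _ hA (hΦ _)]
  refine (measurable_of_countable (fun n : ℕ∞ => (n : ℝ≥0∞))).comp ?_
  have : Measurable[MeasurableSpace.comap (fun ω => (Φ ω ∩ A).encard) inferInstance]
    fun ω => (Φ ω ∩ A).encard := comap_measurable _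
  exact this.mono (le_iSup (fun A : {A : Set E // MeasurableSet A} =>
    MeasurableSpace.comap (fun ω => (Φ ω ∩ A.1).encard) inferInstance) ⟨A, hA⟩) le_rfl

lemma pointSigma_le {Ω : Type*} [mΩ : MeasurableSpace Ω] {P : Measure Ω} {Φ : Ω → Set E}
    {μ : Measure E} (h : IsPoissonProcess P Φ μ) : pointSigma Φ ≤ mΩ :=
  iSup_le fun A => (h.measurable_count A.1 A.2).comap_le

lemma IsPoissonProcess.measurable_pointMeasure [MeasurableSingletonClass E] {Ω : Type*}
    [MeasurableSpace Ω] {P : Measure Ω} {Φ : Ω → Set E} {μ : Measure E} (h : IsPoissonProcess P Φ μ) :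
    Measurable fun ω => pointMeasure (Φ ω) :=
  (MmWave.measurable_pointMeasure h.countable).mono (pointSigma_le h) le_rfl

lemma IsPoissonProcess.isPoissonLaw [MeasurableSingletonClass E] {Ω : Type*}
    [MeasurableSpace Ω] {P : Measure Ω} {Φ : Ω → Set E} {μ : Measure E} (h : IsPoissonProcess P Φ μ) :
    IsPoissonLaw (P.map fun ω => pointMeasure (Φ ω)) μ := by
  have hm := h.measurable_pointMeasure
  have hc : Measurable (fun n : ℕ∞ => (n : ℝ≥0∞)) := measurable_of_countable _
  refine ⟨fun A hA hμ => ?_, fun n A hA hμ hd => ?_⟩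
  · rw [Measure.map_map (Measure.measurable_coe hA) hm]
    have : ((fun N : Measure E => N A) ∘ fun ω => pointMeasure (Φ ω)) =
        (fun n : ℕ∞ => (n : ℝ≥0∞)) ∘ fun ω => (Φ ω ∩ A).encard := by
      ext ω; exact pointMeasure_apply _ hA (h.countable ω)
    rw [this, ← Measure.map_map hc (h.measurable_count A hA), h.law_count A hA hμ,
      Measure.map_map hc (measurable_of_countable _)]
    congr 1
  · have h1 := (h.indep_count n A hA hμ hd).comp (fun _ (n : ℕ∞) => (n : ℝ≥0∞)) fun _ => hc
    rw [iIndepFun_iff_measure_inter_preimage_eq_mul] at h1 ⊢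
    intro S s hs
    have h2 := h1 S hs
    have h3 : ∀ i, (fun ω => pointMeasure (Φ ω)) ⁻¹' ((fun N : Measure E => N (A i)) ⁻¹' s i) =
        ((fun n : ℕ∞ => (n : ℝ≥0∞)) ∘ fun ω => (Φ ω ∩ A i).encard) ⁻¹' s i := by
      intro i; ext ω
      simp [pointMeasure_apply _ (hA i) (h.countable ω)]
    have h4 : ∀ i ∈ S, MeasurableSet ((fun N : Measure E => N (A i)) ⁻¹' s i) :=
      fun i hi => Measure.measurable_coe (hA i) (hs i hi)
    rw [Measure.map_apply hm (Finset.measurableSet_biInter _ h4), preimage_iInter₂]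
    simp_rw [h3]
    rw [h2]
    refine Finset.prod_congr rfl fun i hi => ?_
    rw [Measure.map_apply hm (h4 i hi), h3]

namespace IsPoissonLaw

variable {Q : Measure (Measure E)} {μ : Measure E}

/-- The independence axiom for the empty family of sets forces `Q` to be a probability measure. -/
lemma isProbabilityMeasure (h : IsPoissonLaw Q μ) : IsProbabilityMeasure Q :=
  (h.indep 0 (fun _ => ∅) (fun i => i.elim0) (fun i => i.elim0) (fun i => i.elim0)).isProbabilityMeasure

lemma lintegral_comp (h : IsPoissonLaw Q μ) {A : Set E} (hA : MeasurableSet A) (hμ : μ A ≠ ∞)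
    {f : ℝ≥0∞ → ℝ≥0∞} (hf : Measurable f) :
    ∫⁻ N, f (N A) ∂Q = ∫⁻ n : ℕ, f n ∂(poissonMeasure (μ A).toNNReal) := by
  rw [← lintegral_map hf (Measure.measurable_coe hA), h.law A hA hμ,
    lintegral_map hf (measurable_of_countable _)]

lemma ae_lt_top (h : IsPoissonLaw Q μ) {A : Set E} (hA : MeasurableSet A) (hμ : μ A ≠ ∞) :
    ∀ᵐ N ∂Q, N A < ∞ := by
  have hs : MeasurableSet {x : ℝ≥0∞ | ¬ x < ∞} :=
    (measurableSet_lt measurable_id measurable_const).compl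
  have h1 : Q.map (fun N => N A) {x | ¬ x < ∞} = 0 := by
    rw [h.law A hA hμ, Measure.map_apply (measurable_of_countable _) hs]
    convert measure_empty (μ := poissonMeasure (μ A).toNNReal)
    ext n
    simp
  rw [Measure.map_apply (Measure.measurable_coe hA) hs] at h1
  exact h1

lemma indep_fintype (h : IsPoissonLaw Q μ) {ι : Type*} [Fintype ι] {A : ι → Set E}
    (hA : ∀ i, MeasurableSet (A i)) (hμ : ∀ i, μ (A i) ≠ ∞)
    (hd : Pairwise (fun i j => Disjoint (A i) (A j))) :
    iIndepFun (fun i (N : Measure E) => N (A i)) Q := by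
  have e := Fintype.equivFin ι
  have h1 := h.indep _ (fun k => A (e.symm k)) (fun _ => hA _) (fun _ => hμ _)
    fun i j hij => hd (e.symm.injective.ne hij)
  have h2 := h1.precomp (g := e) e.injective
  simpa using h2

end IsPoissonLaw

/-- One coordinate of a product measure is integrated out first, the others being kept in the
point `x` that is updated. -/
lemma lintegral_pi_update {ι : Type*} [Fintype ι] [DecidableEq ι] {X : ι → Type*}
    [∀ i, MeasurableSpace (X i)] (ν : ∀ i, Measure (X i)) [∀ i, IsProbabilityMeasure (ν i)]
    {f : (∀ i, X i) → ℝ≥0∞} (hf : Measurable f) (k : ι) :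
    ∫⁻ x, f x ∂Measure.pi ν = ∫⁻ x, ∫⁻ y, f (Function.update x k y) ∂(ν k) ∂Measure.pi ν := by
  have hG : Measurable fun x => ∫⁻ y, f (Function.update x k y) ∂(ν k) := by
    have := hf.lmarginal ν (s := {k})
    rwa [lmarginal_singleton] at this
  obtain hne | ⟨⟨x0⟩⟩ := isEmpty_or_nonempty (∀ i, X i)
  · simp [Measure.eq_zero_of_isEmpty]
  have e1 := congrFun (lmarginal_erase' (μ := ν) _ hf (Finset.mem_univ k)) x0
  have e2 := congrFun (lmarginal_erase' (μ := ν) _ hG (Finset.mem_univ k)) x0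
  simp only [Function.update_idem, lintegral_const, measure_univ, mul_one] at e2
  rw [lintegral_eq_lmarginal_univ x0, lintegral_eq_lmarginal_univ x0, e1, e2]

namespace IsPoissonLaw

variable {Q : Measure (Measure E)} {μ : Measure E}

/-- Mecke's formula for a function of finitely many independent counts. -/
lemma lintegral_mul_counts (h : IsPoissonLaw Q μ) {ι : Type*} [Fintype ι] [DecidableEq ι]
    {A : ι → Set E} (hA : ∀ i, MeasurableSet (A i)) (hμ : ∀ i, μ (A i) ≠ ∞)
    (hd : Pairwise (fun i j => Disjoint (A i) (A j)))
    {F : (ι → ℝ≥0∞) → ℝ≥0∞} (hF : Measurable F) (k : ι) :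
    ∫⁻ N, N (A k) * F (fun i => N (A i)) ∂Q =
      μ (A k) * ∫⁻ N, F (fun i => N (A i) + if i = k then 1 else 0) ∂Q := by
  have := h.isProbabilityMeasure
  have hm : ∀ i, Measurable fun N : Measure E => N (A i) := fun i => Measure.measurable_coe (hA i)
  have hpi := (h.indep_fintype hA hμ hd).map_fun_eq_pi_map (fun i => (hm i).aemeasurable)
  have hprob : ∀ i, IsProbabilityMeasure (Q.map fun N => N (A i)) :=
    fun i => Measure.isProbabilityMeasure_map (hm i).aemeasurable
  have hmm : Measurable fun (N : Measure E) i => N (A i) := measurable_pi_lambda _ hm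
  have hF' : Measurable fun x : ι → ℝ≥0∞ => F (fun i => x i + if i = k then 1 else 0) := by
    refine hF.comp (measurable_pi_lambda _ fun i => ?_)
    exact (measurable_pi_apply i).add_const _
  have hkF : Measurable fun x : ι → ℝ≥0∞ => x k * F x := (measurable_pi_apply k).mul hF
  have e1 : ∫⁻ N, N (A k) * F (fun i => N (A i)) ∂Q =
      ∫⁻ x, x k * F x ∂Measure.pi fun i => Q.map fun N => N (A i) := by
    rw [← hpi, lintegral_map hkF hmm]
  have e2 : ∫⁻ N, F (fun i => N (A i) + if i = k then 1 else 0) ∂Q =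
      ∫⁻ x, F (fun i => x i + if i = k then 1 else 0) ∂Measure.pi fun i => Q.map fun N => N (A i) := by
    rw [← hpi, lintegral_map hF' hmm]
  have hup : ∀ x : ι → ℝ≥0∞, Measurable fun y : ℝ≥0∞ => F (Function.update x k y) :=
    fun x => hF.comp (measurable_update x)
  have hup' : ∀ x : ι → ℝ≥0∞, Measurable fun y : ℝ≥0∞ =>
      F (fun i => Function.update x k y i + if i = k then 1 else 0) :=
    fun x => hF'.comp (measurable_update x)
  -- with the other counts frozen, the claim is the Chen–Stein identity for the count of `A k`
  rw [e1, e2, lintegral_pi_update _ hkF k, lintegral_pi_update _ hF' k]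
  have key : ∀ x : ι → ℝ≥0∞,
      ∫⁻ y, Function.update x k y k * F (Function.update x k y) ∂(Q.map fun N => N (A k)) =
      μ (A k) * ∫⁻ y, F (fun i => Function.update x k y i + if i = k then 1 else 0)
        ∂(Q.map fun N => N (A k)) := by
    intro x
    simp only [Function.update_self]
    rw [h.law _ (hA k) (hμ k), lintegral_map (f := fun y => y * F (Function.update x k y))
      (measurable_id.mul (hup x)) (measurable_of_countable _),
      lintegral_map (hup' x) (measurable_of_countable _)]
    have := lintegral_poissonMeasure_mul (μ (A k)).toNNReal fun n => F (Function.update x k n)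
    rw [this, ENNReal.coe_toNNReal (hμ k)]
    congr 2
    ext n
    congr 1
    ext i
    by_cases hi : i = k
    · subst hi; simp
    · simp [hi]
  simp_rw [key]
  rw [lintegral_const_mul]
  have h3 := hF'.lmarginal (fun i => Q.map fun N => N (A i)) (s := {k})
  rwa [lmarginal_singleton] at h3

end IsPoissonLaw
end MmWave

namespace MmWave

/-! ### Mecke's formula -/

/-- The atoms of the algebra generated by a finite family of sets `A`, except for the complement of
all of them (which may have infinite measure). -/
def atom {E ι : Type*} (A : ι → Set E) (b : ι → Bool) : Set E :=
  {x | (∃ i, x ∈ A i) ∧ ∀ i, x ∈ A i ↔ b i = true}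

section atom

variable {E ι : Type*} {A : ι → Set E}

lemma atom_subset {b : ι → Bool} {i : ι} (hb : b i = true) : atom A b ⊆ A i :=
  fun _ hx => (hx.2 i).2 hb

lemma disjoint_atom {b c : ι → Bool} (h : b ≠ c) : Disjoint (atom A b) (atom A c) := by
  rw [Set.disjoint_left]
  intro x hb hc
  refine h (funext fun i => ?_)
  rw [Bool.eq_iff_iff, ← hb.2 i, ← hc.2 i]

variable [MeasurableSpace E] [Fintype ι]

lemma measurableSet_atom (hA : ∀ i, MeasurableSet (A i)) (b : ι → Bool) :
    MeasurableSet (atom A b) := by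
  have : atom A b = (⋃ i, A i) ∩ ⋂ i, {x | x ∈ A i ↔ b i = true} := by
    ext x; simp [atom]
  rw [this]
  refine (MeasurableSet.iUnion hA).inter (MeasurableSet.iInter fun i => ?_)
  by_cases hb : b i = true
  · simpa [hb] using hA i
  · convert (hA i).compl using 1
    ext x
    simp [hb]

lemma measure_atom_ne_top {μ : Measure E} (hμ : ∀ i, μ (A i) ≠ ∞) (b : ι → Bool) :
    μ (atom A b) ≠ ∞ := by
  by_cases hb : ∃ i, b i = true
  · obtain ⟨i, hi⟩ := hb
    exact ne_top_of_le_ne_top (hμ i) (measure_mono (atom_subset hi))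
  · have : atom A b = ∅ := by
      ext x
      simp only [atom, mem_ofPred_eq, mem_empty_iff_false, iff_false, not_and]
      rintro ⟨i, hi⟩ h
      exact hb ⟨i, (h i).1 hi⟩
    simp [this]

lemma measure_eq_sum_atom [DecidableEq ι] (N : Measure E) (hA : ∀ i, MeasurableSet (A i)) (i : ι) :
    N (A i) = ∑ b : ι → Bool, if b i = true then N (atom A b) else 0 := by
  classical
  rw [← Finset.sum_filter, ← measure_biUnion_finset]
  · congr 1
    ext x
    simp only [Finset.mem_filter, Finset.mem_univ, true_and, mem_iUnion, exists_prop]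
    constructor
    · intro hx
      exact ⟨fun j => decide (x ∈ A j), by simpa using hx, ⟨i, hx⟩, fun j => by simp⟩
    · rintro ⟨b, hb, hx⟩
      exact atom_subset hb hx
  · intro b _ c _ hbc
    exact disjoint_atom hbc
  · exact fun b _ => measurableSet_atom hA b

end atom

variable {E : Type*} [MeasurableSpace E]

lemma measurable_restrict {S : Set E} (hS : MeasurableSet S) :
    Measurable fun N : Measure E => N.restrict S := by
  refine Measure.measurable_of_measurable_coe _ fun A hA => ?_
  simp_rw [Measure.restrict_apply hA]
  exact Measure.measurable_coe (hA.inter hS)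

/-- Measurability of a measure-valued map may be tested on sets of finite `μ`-measure, the only sets
whose counts a Poisson law controls. -/
lemma measurable_measure_of_finite {X : Type*} [MeasurableSpace X] (μ : Measure E) [SigmaFinite μ]
    {f : X → Measure E} (hf : ∀ A, MeasurableSet A → μ A ≠ ∞ → Measurable fun x => f x A) :
    Measurable f := by
  refine Measure.measurable_of_measurable_coe _ fun A hA => ?_
  have h1 : ∀ x, f x A = ⨆ n, f x (A ∩ spanningSets μ n) := by
    intro x
    rw [← Monotone.measure_iUnion, ← inter_iUnion, iUnion_spanningSets, inter_univ]
    exact fun m n hmn => inter_subset_inter_right _ (monotone_spanningSets μ hmn)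
  simp_rw [h1]
  refine Measurable.iSup fun n => hf _ (hA.inter (measurableSet_spanningSets μ n)) ?_
  exact ne_top_of_le_ne_top (measure_spanningSets_lt_top μ n).ne (measure_mono inter_subset_right)

lemma measurable_add_dirac :
    Measurable fun x : E × Measure E => x.2 + Measure.dirac x.1 := by
  refine Measure.measurable_of_measurable_coe _ fun A hA => ?_
  simp only [Measure.coe_add, Pi.add_apply]
  refine ((Measure.measurable_coe hA).comp measurable_snd).add ?_
  simp_rw [Measure.dirac_apply' _ hA]
  exact (measurable_one.indicator hA).comp measurable_fst

/-- The measures that are finite on the sets of a fixed exhaustion of `E` by sets of finite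
measure `μ`. -/
def locFinite (μ : Measure E) [SigmaFinite μ] : Set (Measure E) :=
  {N | ∀ n, N (spanningSets μ n) < ∞}

lemma measurableSet_locFinite (μ : Measure E) [SigmaFinite μ] : MeasurableSet (locFinite μ) := by
  have : locFinite μ = ⋂ n, {N | N (spanningSets μ n) < ∞} := by ext; simp [locFinite]
  rw [this]
  exact MeasurableSet.iInter fun n =>
    measurableSet_lt (Measure.measurable_coe (measurableSet_spanningSets μ n)) measurable_const

open Classical in
/-- The measure `N` itself, as a kernel in `N`, cut off to `0` at the measures that are not locally
finite. The cut-off makes the kernel s-finite, so that integrals against `N` are measurable in `N` and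
Fubini's theorem applies; a Poisson law does not see it. -/
def locKernel (μ : Measure E) [SigmaFinite μ] : Kernel (Measure E) E where
  toFun N := if N ∈ locFinite μ then N else 0
  measurable' := Measurable.ite (measurableSet_locFinite μ) measurable_id measurable_const

lemma locKernel_of_mem {μ : Measure E} [SigmaFinite μ] {N : Measure E} (hN : N ∈ locFinite μ) :
    locKernel μ N = N := if_pos hN

lemma locKernel_of_notMem {μ : Measure E} [SigmaFinite μ] {N : Measure E} (hN : N ∉ locFinite μ) :
    locKernel μ N = 0 := if_neg hN

lemma locKernel_le {μ : Measure E} [SigmaFinite μ] (N : Measure E) : locKernel μ N ≤ N := by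
  by_cases hN : N ∈ locFinite μ
  · rw [locKernel_of_mem hN]
  · rw [locKernel_of_notMem hN]; exact Measure.zero_le _

lemma mem_locFinite_mono {μ : Measure E} [SigmaFinite μ] {N N' : Measure E} (h : N' ≤ N)
    (hN : N ∈ locFinite μ) : N' ∈ locFinite μ := fun n => (h _).trans_lt (hN n)

lemma add_dirac_mem_locFinite {μ : Measure E} [SigmaFinite μ] {N : Measure E}
    (hN : N ∈ locFinite μ) (p : E) : N + Measure.dirac p ∈ locFinite μ := fun n => by
  rw [Measure.coe_add, Pi.add_apply]
  exact ENNReal.add_lt_top.2 ⟨hN n, measure_lt_top _ _⟩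

lemma locKernel_restrict {μ : Measure E} [SigmaFinite μ] {N : Measure E} (hN : N ∈ locFinite μ)
    (S : Set E) : locKernel μ (N.restrict S) = N.restrict S :=
  locKernel_of_mem (mem_locFinite_mono Measure.restrict_le_self hN)

instance (μ : Measure E) [SigmaFinite μ] : IsSFiniteKernel (locKernel μ) := by
  classical
  -- cut `E` into pieces and, on each piece, the measures by the integer part of their mass there
  let D : ℕ → Set E := disjointed (spanningSets μ)
  have hD : ∀ n, MeasurableSet (D n) :=
    MeasurableSet.disjointed fun n => measurableSet_spanningSets μ n
  have hDs : ∀ n, D n ⊆ spanningSets μ n := fun n => disjointed_subset _ n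
  have hm : ∀ n, Measurable fun N : Measure E => ⌊(N (D n)).toNNReal⌋₊ := fun n =>
    (Measure.measurable_coe (hD n)).ennreal_toNNReal.nat_floor
  have hms : ∀ n k, MeasurableSet {N : Measure E | N ∈ locFinite μ ∧ ⌊(N (D n)).toNNReal⌋₊ = k} :=
    fun n k => (measurableSet_locFinite μ).inter (hm n (measurableSet_singleton k))
  let κ : ℕ → ℕ → Kernel (Measure E) E := fun n k =>
    { toFun := fun N => if N ∈ locFinite μ ∧ ⌊(N (D n)).toNNReal⌋₊ = k then N.restrict (D n) else 0
      measurable' := Measurable.ite (hms n k) (measurable_restrict (hD n)) measurable_const }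
  have hκ : ∀ n k N, κ n k N =
    if N ∈ locFinite μ ∧ ⌊(N (D n)).toNNReal⌋₊ = k then N.restrict (D n) else 0 := fun _ _ _ => rfl
  have hfin : ∀ n k, IsFiniteKernel (κ n k) := by
    intro n k
    refine ⟨⟨k + 1, by finiteness, fun N => ?_⟩⟩
    rw [hκ]
    split_ifs with hN
    · rw [Measure.restrict_apply MeasurableSet.univ, univ_inter]
      have h1 : N (D n) ≠ ∞ := ((measure_mono (hDs n)).trans_lt (hN.1 n)).ne
      rw [← ENNReal.coe_toNNReal h1]
      have := (Nat.lt_floor_add_one (N (D n)).toNNReal).le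
      rw [hN.2] at this
      exact_mod_cast this
    · simp
  have hsum : locKernel μ = Kernel.sum fun n => Kernel.sum fun k => κ n k := by
    ext N s hs
    rw [Kernel.sum_apply' _ _ hs]
    simp_rw [Kernel.sum_apply' _ _ hs, hκ]
    by_cases hN : N ∈ locFinite μ
    · rw [locKernel_of_mem hN]
      have : ∀ n, ∑' k, (if N ∈ locFinite μ ∧ ⌊(N (D n)).toNNReal⌋₊ = k then N.restrict (D n) else 0) s
          = N (s ∩ D n) := by
        intro n
        rw [tsum_eq_single ⌊(N (D n)).toNNReal⌋₊]
        · simp [hN, Measure.restrict_apply hs]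
        · intro k hk
          simp [hk.symm]
      simp_rw [this]
      rw [← measure_iUnion, ← inter_iUnion, iUnion_disjointed, iUnion_spanningSets, inter_univ]
      · intro i j hij
        exact (disjoint_disjointed _ hij).mono inter_subset_right inter_subset_right
      · exact fun n => hs.inter (hD n)
    · rw [locKernel_of_notMem hN]
      simp [hN]
  rw [hsum]
  infer_instance

namespace IsPoissonLaw

variable {Q : Measure (Measure E)} {μ : Measure E}

lemma ae_mem_locFinite [SigmaFinite μ] (h : IsPoissonLaw Q μ) : ∀ᵐ N ∂Q, N ∈ locFinite μ :=
  ae_all_iff.2 fun n => h.ae_lt_top (measurableSet_spanningSets μ n)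
    (measure_spanningSets_lt_top μ n).ne

/-- Mecke's formula for a function of finitely many counts, without independence of the counts: the
sets are cut into atoms. -/
lemma lintegral_mul_counts' (h : IsPoissonLaw Q μ) {ι : Type*} [Fintype ι] {A : ι → Set E}
    (hA : ∀ i, MeasurableSet (A i)) (hμ : ∀ i, μ (A i) ≠ ∞) {F : (ι → ℝ≥0∞) → ℝ≥0∞}
    (hF : Measurable F) (k : ι) :
    ∫⁻ N, N (A k) * F (fun i => N (A i)) ∂Q =
      ∫⁻ p in A k, ∫⁻ N, F (fun i => N (A i) + (A i).indicator 1 p) ∂Q ∂μ := by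
  classical
  have hat := measurableSet_atom hA
  -- `F` as a function of the independent counts of the atoms
  let F' : ((ι → Bool) → ℝ≥0∞) → ℝ≥0∞ := fun v => F fun i => ∑ b, if b i = true then v b else 0
  have hF' : Measurable F' := by
    refine hF.comp (measurable_pi_lambda _ fun i => Finset.measurable_sum _ fun b _ => ?_)
    by_cases hb : b i = true
    · simpa [hb] using measurable_pi_apply b
    · simp [hb]
  have e0 : ∀ N : Measure E, F (fun i => N (A i)) = F' fun b => N (atom A b) := fun N =>
    congrArg F (funext fun i => measure_eq_sum_atom N hA i)
  have e1 : ∀ b, b k = true → ∫⁻ p in atom A b, ∫⁻ N, F (fun i => N (A i) + (A i).indicator 1 p) ∂Q ∂μ =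
      ∫⁻ N, N (atom A b) * F (fun i => N (A i)) ∂Q := by
    intro b hb
    simp_rw [e0]
    rw [h.lintegral_mul_counts hat (measure_atom_ne_top hμ) (fun b c hbc => disjoint_atom hbc) hF' b]
    have : ∀ p ∈ atom A b, ∫⁻ N, F (fun i => N (A i) + (A i).indicator 1 p) ∂Q =
        ∫⁻ N, F' (fun c => N (atom A c) + if c = b then 1 else 0) ∂Q := by
      intro p hp
      refine lintegral_congr fun N => congrArg F (funext fun i => ?_)
      rw [measure_eq_sum_atom N hA i]
      have h2 : (A i).indicator (1 : E → ℝ≥0∞) p = if b i = true then 1 else 0 := by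
        by_cases hi : b i = true
        · simp [hi, (hp.2 i).2 hi]
        · have : p ∉ A i := fun h' => hi ((hp.2 i).1 h')
          simp [hi, this]
      have h3 : ∀ c : ι → Bool, (if c i = true then N (atom A c) + (if c = b then (1 : ℝ≥0∞) else 0) else 0) =
          (if c i = true then N (atom A c) else 0) + if c = b then (if b i = true then 1 else 0) else 0 := by
        intro c
        by_cases hcb : c = b
        · subst hcb; split_ifs <;> simp
        · simp [hcb]
      simp_rw [h3, Finset.sum_add_distrib, h2]
      congr 1
      rw [Finset.sum_ite_eq' Finset.univ b]
      simp
    rw [setLIntegral_congr_fun (hat b) this, setLIntegral_const, mul_comm]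
  have e2 : ∀ G : E → ℝ≥0∞, ∫⁻ p in A k, G p ∂μ =
      ∑ b : ι → Bool, if b k = true then ∫⁻ p in atom A b, G p ∂μ else 0 := by
    intro G
    rw [← withDensity_apply _ (hA k), measure_eq_sum_atom _ hA k]
    refine Finset.sum_congr rfl fun b _ => ?_
    rw [withDensity_apply _ (hat b)]
  rw [e2]
  have e3 : ∀ N : Measure E, N (A k) * F (fun i => N (A i)) =
      ∑ b : ι → Bool, if b k = true then N (atom A b) * F (fun i => N (A i)) else 0 := by
    intro N
    conv_lhs => rw [measure_eq_sum_atom N hA k, Finset.sum_mul]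
    exact Finset.sum_congr rfl fun b _ => by split_ifs <;> simp
  have hm : Measurable fun N : Measure E => F fun i => N (A i) :=
    hF.comp (measurable_pi_lambda _ fun i => Measure.measurable_coe (hA i))
  simp_rw [e3]
  rw [lintegral_finsetSum]
  · refine Finset.sum_congr rfl fun b _ => ?_
    by_cases hb : b k = true
    · simp only [hb, if_true]; rw [e1 b hb]
    · simp [hb]
  · intro b _
    by_cases hb : b k = true
    · simp only [hb, if_true]
      exact (Measure.measurable_coe (hat b)).mul hm
    · simp [hb]

/-- The sets of finite measure. -/
abbrev FiniteSet (μ : Measure E) : Type _ := {A : Set E // MeasurableSet A ∧ μ A ≠ ∞}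

lemma _root_.MmWave.generateFrom_finiteSet (μ : Measure E) [SigmaFinite μ] :
    MeasurableSpace.generateFrom {A : Set E | MeasurableSet A ∧ μ A ≠ ∞} = ‹MeasurableSpace E› := by
  refine le_antisymm (MeasurableSpace.generateFrom_le fun A hA => hA.1) fun A hA => ?_
  have : A = ⋃ n, A ∩ spanningSets μ n := by rw [← inter_iUnion, iUnion_spanningSets, inter_univ]
  rw [this]
  refine MeasurableSet.iUnion fun n => MeasurableSpace.measurableSet_generateFrom ⟨?_, ?_⟩
  · exact hA.inter (measurableSet_spanningSets μ n)
  · exact ne_top_of_le_ne_top (measure_spanningSets_lt_top μ n).ne (measure_mono inter_subset_right)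

/-- The σ-algebra of `Measure E` is generated by the masses of the sets of finite `μ`-measure. -/
lemma _root_.MmWave.iSup_comap_eval (μ : Measure E) [SigmaFinite μ] :
    ⨆ A : FiniteSet μ, MeasurableSpace.comap (fun N : Measure E => N A.1) inferInstance =
      (inferInstance : MeasurableSpace (Measure E)) := by
  refine le_antisymm (iSup_le fun A => (Measure.measurable_coe A.2.1).comap_le) ?_
  have h1 : @Measurable _ _
      (⨆ A : FiniteSet μ, MeasurableSpace.comap (fun N : Measure E => N A.1) inferInstance)
      inferInstance (id : Measure E → Measure E) := by
    refine @measurable_measure_of_finite E _ (Measure E) (_) μ _ _ fun A hA hμ => ?_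
    have h2 : Measurable[MeasurableSpace.comap (fun N : Measure E => N A) inferInstance]
      fun N : Measure E => N A := comap_measurable _
    exact h2.mono (le_iSup (fun A : FiniteSet μ =>
      MeasurableSpace.comap (fun N : Measure E => N A.1) inferInstance) ⟨A, hA, hμ⟩) le_rfl
  have := h1.comap_le
  rwa [MeasurableSpace.comap_id] at this

/-- **Mecke's formula**: the mean of a sum over the points of a Poisson process of a function of the
point and of the process is computed by adding a point to the process. -/
theorem mecke [SigmaFinite μ] (h : IsPoissonLaw Q μ) {Ψ : E × Measure E → ℝ≥0∞} (hΨ : Measurable Ψ) :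
    ∫⁻ N, ∫⁻ p, Ψ (p, N) ∂(locKernel μ N) ∂Q = ∫⁻ p, ∫⁻ N, Ψ (p, N + Measure.dirac p) ∂Q ∂μ := by
  have := h.isProbabilityMeasure
  -- Both sides are integrals of `Ψ` for measures on `E × Measure E`: the Campbell measure of the
  -- process, and the image of `μ ⊗ Q` under the addition of a point.
  have hT : Measurable fun x : E × Measure E => (x.1, x.2 + Measure.dirac x.1) :=
    measurable_fst.prodMk measurable_add_dirac
  suffices hM : (Q ⊗ₘ locKernel μ).map Prod.swap =
      (μ.prod Q).map fun x => (x.1, x.2 + Measure.dirac x.1) by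
    have h1 : ∫⁻ x, Ψ x ∂(Q ⊗ₘ locKernel μ).map Prod.swap =
        ∫⁻ N, ∫⁻ p, Ψ (p, N) ∂(locKernel μ N) ∂Q := by
      rw [lintegral_map hΨ measurable_swap,
        Measure.lintegral_compProd (f := fun x => Ψ x.swap) (hΨ.comp measurable_swap)]
      rfl
    rw [← h1, hM, lintegral_map hΨ hT,
      lintegral_prod (fun x => Ψ (x.1, x.2 + Measure.dirac x.1)) (hΨ.comp hT).aemeasurable]
  -- They are compared on the π-system of rectangles `A ×ˢ B` with `μ A < ∞` and `B` an event that
  -- depends on finitely many counts.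
  let π : FiniteSet μ → Set (Set (Measure E)) := fun A =>
    {s | MeasurableSet[MeasurableSpace.comap (fun N : Measure E => N A.1) inferInstance] s}
  let D : Set (Set (Measure E)) := piiUnionInter π univ
  let C : Set (Set E) := {A | MeasurableSet A ∧ μ A ≠ ∞}
  have hDgen : MeasurableSpace.generateFrom D = (inferInstance : MeasurableSpace (Measure E)) := by
    have := generateFrom_piiUnionInter_measurableSet (fun A : FiniteSet μ =>
      MeasurableSpace.comap (fun N : Measure E => N A.1) inferInstance) univ
    simp only [mem_univ, iSup_pos] at this
    exact this.trans (iSup_comap_eval μ)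
  have hDpi : IsPiSystem D := isPiSystem_piiUnionInter _
    (fun A => @MeasurableSpace.isPiSystem_measurableSet _ (_)) _
  have hCpi : IsPiSystem C := fun A hA B hB _ =>
    ⟨hA.1.inter hB.1, ne_top_of_le_ne_top hA.2 (measure_mono inter_subset_left)⟩
  have hunivD : (univ : Set (Measure E)) ∈ D := ⟨∅, by simp, fun _ => univ, by simp, by simp⟩
  have hspC : IsCountablySpanning C := ⟨spanningSets μ, fun n => ⟨measurableSet_spanningSets μ n,
    (measure_spanningSets_lt_top μ n).ne⟩, iUnion_spanningSets μ⟩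
  have hspD : IsCountablySpanning D := ⟨fun _ => univ, fun _ => hunivD, iUnion_const _⟩
  have hae := h.ae_mem_locFinite
  have hκ : ∀ᵐ N ∂Q, locKernel μ N = N := hae.mono fun N hN => locKernel_of_mem hN
  have key : ∀ s ∈ image2 (· ×ˢ ·) C D, (Q ⊗ₘ locKernel μ).map Prod.swap s =
      (μ.prod Q).map (fun x => (x.1, x.2 + Measure.dirac x.1)) s ∧
      (Q ⊗ₘ locKernel μ).map Prod.swap s ≤ ∫⁻ p in (Prod.fst '' s), 1 ∂μ := by
    rintro _ ⟨A₀, hA₀, B, ⟨t, -, f, hf, rfl⟩, rfl⟩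
    choose! V hV hVf using fun A hA => hf A hA
    have hB : MeasurableSet (⋂ x ∈ t, f x) := Finset.measurableSet_biInter _ fun A hA =>
      ((Measure.measurable_coe A.2.1).comap_le) _ (hf A hA)
    -- the sets counted: `A₀` at the index `none`, and the sets that determine the event at `some`
    let A : Option t → Set E := fun o => o.elim A₀ fun a => a.1.1
    have hA : ∀ o, MeasurableSet (A o) := by rintro (_ | a); exacts [hA₀.1, a.1.2.1]
    have hAμ : ∀ o, μ (A o) ≠ ∞ := by rintro (_ | a); exacts [hA₀.2, a.1.2.2]
    let W : Set (Option t → ℝ≥0∞) := ⋂ a : t, {v | v (some a) ∈ V a.1}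
    have hW : MeasurableSet W := MeasurableSet.iInter fun a =>
      (measurable_pi_apply (some a)) (hV a.1 a.2)
    have hWB : ∀ N : Measure E, N ∈ (⋂ x ∈ t, f x) ↔ (fun o => N (A o)) ∈ W := by
      intro N
      have : (fun o => N (A o)) ∈ W ↔ ∀ a, ∀ ha : a ∈ t, N a.1 ∈ V a := by
        simp only [W, mem_iInter]
        exact ⟨fun h a ha => h ⟨a, ha⟩, fun h a => h a.1 a.2⟩
      rw [this, mem_iInter₂]
      refine forall_congr' fun a => ?_
      constructor
      · intro hN hat
        have h2 := hN hat
        rw [← hVf a hat] at h2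
        exact h2
      · intro hN hat
        have h2 := hN hat
        rw [← hVf a hat]
        exact h2
    have e := h.lintegral_mul_counts' hA hAμ (F := W.indicator 1) (measurable_one.indicator hW) none
    have hL : (Q ⊗ₘ locKernel μ).map Prod.swap (A₀ ×ˢ ⋂ x ∈ t, f x) =
        ∫⁻ N, N (A none) * W.indicator 1 (fun o => N (A o)) ∂Q := by
      rw [Measure.map_apply measurable_swap (hA₀.1.prod hB), preimage_swap_prod,
        Measure.compProd_apply_prod hB hA₀.1, ← lintegral_indicator hB]
      refine lintegral_congr_ae (hκ.mono fun N hN => ?_)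
      simp only
      by_cases hNB : N ∈ ⋂ x ∈ t, f x
      · rw [indicator_of_mem hNB, indicator_of_mem ((hWB N).1 hNB), hN]; simp [A]
      · rw [indicator_of_notMem hNB, indicator_of_notMem (fun h' => hNB ((hWB N).2 h'))]; simp
    have hR : (μ.prod Q).map (fun x => (x.1, x.2 + Measure.dirac x.1)) (A₀ ×ˢ ⋂ x ∈ t, f x) =
        ∫⁻ p in A none, ∫⁻ N, W.indicator 1 (fun o => N (A o) + (A o).indicator 1 p) ∂Q ∂μ := by
      rw [Measure.map_apply hT (hA₀.1.prod hB), Measure.prod_apply (hT (hA₀.1.prod hB)),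
        ← lintegral_indicator (hA none)]
      refine lintegral_congr fun p => ?_
      change _ = A₀.indicator _ p
      by_cases hp : p ∈ A₀
      · rw [indicator_of_mem hp, ← lintegral_indicator_one (measurable_prodMk_left (hT (hA₀.1.prod hB)))]
        refine lintegral_congr fun N => ?_
        have h3 : (fun o => N (A o) + (A o).indicator 1 p) = fun o => (N + Measure.dirac p) (A o) := by
          ext o
          rw [Measure.coe_add, Pi.add_apply, Measure.dirac_apply' _ (hA o)]
        have h4 := hWB (N + Measure.dirac p)
        rw [h3]
        by_cases hN : N + Measure.dirac p ∈ ⋂ x ∈ t, f x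
        · rw [indicator_of_mem (h4.1 hN), indicator_of_mem]; rfl
          exact ⟨hp, hN⟩
        · rw [indicator_of_notMem (fun h' => hN (h4.2 h')), indicator_of_notMem]
          exact fun h' => hN h'.2
      · rw [indicator_of_notMem hp]
        convert measure_empty (μ := Q)
        ext N
        simp [hp]
    refine ⟨by rw [hL, hR, e], ?_⟩
    -- finiteness on the rectangles: the Campbell measure of `A₀ ×ˢ B` is at most `μ A₀`
    rw [hL, e]
    by_cases hBe : (⋂ x ∈ t, f x).Nonempty
    · have : Prod.fst '' (A₀ ×ˢ ⋂ x ∈ t, f x) = A none := fst_image_prod _ hBe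
      rw [this]
      refine lintegral_mono fun p => ?_
      have : ∀ N : Measure E, W.indicator 1 (fun o => N (A o) + (A o).indicator 1 p) ≤ (1 : ℝ≥0∞) :=
        fun N => by classical rw [indicator_apply]; split_ifs <;> simp
      exact (lintegral_mono this).trans (by simp)
    · have h0 : ∀ (p : E) (N : Measure E), W.indicator (1 : (Option t → ℝ≥0∞) → ℝ≥0∞)
          (fun o => N (A o) + (A o).indicator 1 p) = 0 := by
        intro p N
        refine indicator_of_notMem (fun h' => hBe ⟨N + Measure.dirac p, (hWB _).2 ?_⟩) _
        convert h' using 2 with o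
        rw [Measure.coe_add, Pi.add_apply, Measure.dirac_apply' _ (hA o)]
      simp [h0]
  refine Measure.ext_of_generateFrom_of_iUnion (image2 (· ×ˢ ·) C D)
    (fun n => spanningSets μ n ×ˢ univ)
    (generateFrom_eq_prod (generateFrom_finiteSet μ) hDgen hspC hspD).symm (hCpi.prod hDpi) ?_ ?_ ?_
    fun s hs => (key s hs).1
  · rw [← iUnion_prod_const, iUnion_spanningSets, univ_prod_univ]
  · exact fun n => ⟨_, ⟨measurableSet_spanningSets μ n,
      (measure_spanningSets_lt_top μ n).ne⟩, _, hunivD, rfl⟩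
  · intro n
    have h5 := (key (spanningSets μ n ×ˢ univ) ⟨_, ⟨measurableSet_spanningSets μ n,
      (measure_spanningSets_lt_top μ n).ne⟩, _, hunivD, rfl⟩).2
    rw [fst_image_prod _ univ_nonempty] at h5
    refine ne_top_of_le_ne_top ?_ h5
    simpa using (measure_spanningSets_lt_top μ n).ne

end IsPoissonLaw
end MmWave

namespace MmWave

/-! ### Laplace functional, independence and absence of ties -/

/-- Independence is kept when σ-algebras are grouped. -/
lemma iIndep_iSup_prod {Ω ι κ : Type*} {mΩ : MeasurableSpace Ω} {P : Measure Ω}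
    {m : ι × κ → MeasurableSpace Ω} (hle : ∀ p, m p ≤ mΩ) (h : iIndep m P) :
    iIndep (fun i => ⨆ b, m (i, b)) P := by
  classical
  have := h.isProbabilityMeasure
  rw [iIndep_iff]
  intro s
  induction s using Finset.induction with
  | empty => simp
  | insert a s ha ih =>
    intro f hf
    have hd : Disjoint {p : ι × κ | p.1 = a} {p | p.1 ∈ s} := by
      rw [Set.disjoint_left]
      rintro p (rfl : p.1 = a) hp
      exact ha hp
    have hi := indep_iSup_of_disjoint hle h hd
    have e1 : MeasurableSet[⨆ p ∈ {p : ι × κ | p.1 = a}, m p] (f a) := by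
      refine (iSup_le fun b => ?_ : ⨆ b, m (a, b) ≤ _) _ (hf a (Finset.mem_insert_self _ _))
      exact le_iSup₂ (f := fun p (_ : p ∈ {p : ι × κ | p.1 = a}) => m p) (a, b) rfl
    have e2 : MeasurableSet[⨆ p ∈ {p : ι × κ | p.1 ∈ s}, m p] (⋂ i ∈ s, f i) := by
      refine Finset.measurableSet_biInter _ fun i hi => ?_
      refine (iSup_le fun b => ?_ : ⨆ b, m (i, b) ≤ _) _ (hf i (Finset.mem_insert_of_mem hi))
      exact le_iSup₂ (f := fun p (_ : p ∈ {p : ι × κ | p.1 ∈ s}) => m p) (i, b) hi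
    rw [Finset.set_biInter_insert, Finset.prod_insert ha, (Indep_iff _ _ _).1 hi _ _ e1 e2,
      ih fun i hi => hf i (Finset.mem_insert_of_mem hi)]

lemma iIndep_mono {Ω ι : Type*} {mΩ : MeasurableSpace Ω} {P : Measure Ω}
    {m m' : ι → MeasurableSpace Ω} (hle : ∀ i, m' i ≤ m i) (h : iIndep m P) : iIndep m' P := by
  rw [iIndep_iff] at h ⊢
  exact fun s f hf => h s fun i hi => hle i _ (hf i hi)

variable {E : Type*} [MeasurableSpace E]

namespace IsPoissonLaw

variable {Q : Measure (Measure E)} {μ : Measure E}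

lemma lintegral_eNeg_sum (h : IsPoissonLaw Q μ) {ι : Type*} [Fintype ι] {A : ι → Set E}
    (hA : ∀ i, MeasurableSet (A i)) (hμ : ∀ i, μ (A i) ≠ ∞)
    (hd : Pairwise (fun i j => Disjoint (A i) (A j))) (c : ι → ℝ≥0∞) :
    ∫⁻ N, eNeg (∑ i, c i * N (A i)) ∂Q = eNeg (∑ i, (1 - eNeg (c i)) * μ (A i)) := by
  have hm : ∀ i, Measurable fun x : ℝ≥0∞ => eNeg (c i * x) := fun i =>
    measurable_eNeg.comp (measurable_id.const_mul _)
  have hi := (h.indep_fintype hA hμ hd).comp _ hm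
  simp_rw [eNeg_sum]
  have := lintegral_prod_eq_prod_lintegral_of_indepFun Finset.univ _ hi
    fun i => (hm i).comp (Measure.measurable_coe (hA i))
  simp only [Function.comp_def] at this
  rw [this]
  refine Finset.prod_congr rfl fun i _ => ?_
  rw [h.lintegral_comp (hA i) (hμ i) (hm i)]
  simp_rw [mul_comm (c i)]
  rw [lintegral_poissonMeasure_eNeg, ENNReal.coe_toNNReal (hμ i), mul_comm]

lemma lintegral_eNeg_simple (h : IsPoissonLaw Q μ) (s : SimpleFunc E ℝ≥0∞) {W : Set E}
    (hW : MeasurableSet W) (hμ : μ W ≠ ∞) :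
    ∫⁻ N, eNeg (∫⁻ p in W, s p ∂N) ∂Q = eNeg (∫⁻ p in W, (1 - eNeg (s p)) ∂μ) := by
  have h1 : ∀ N : Measure E, ∫⁻ p in W, s p ∂N = ∑ x : s.range, x.1 * N (s ⁻¹' {x.1} ∩ W) := by
    intro N
    rw [SimpleFunc.lintegral_eq_lintegral, SimpleFunc.lintegral, ← Finset.sum_coe_sort]
    refine Finset.sum_congr rfl fun x _ => ?_
    rw [Measure.restrict_apply (s.measurableSet_fiber _)]
  have h2 : ∫⁻ p in W, (1 - eNeg (s p)) ∂μ =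
      ∑ x : s.range, (1 - eNeg x.1) * μ (s ⁻¹' {x.1} ∩ W) := by
    have : ∀ p, 1 - eNeg (s p) = (s.map fun x => 1 - eNeg x) p := fun p => rfl
    simp_rw [this]
    rw [SimpleFunc.lintegral_eq_lintegral, SimpleFunc.map_lintegral, ← Finset.sum_coe_sort]
    refine Finset.sum_congr rfl fun x _ => ?_
    rw [Measure.restrict_apply (s.measurableSet_fiber _)]
  simp_rw [h1, h2]
  refine h.lintegral_eNeg_sum (A := fun x : s.range => s ⁻¹' {x.1} ∩ W)
    (fun x => (s.measurableSet_fiber _).inter hW)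
    (fun x => ne_top_of_le_ne_top hμ (measure_mono inter_subset_right)) (fun x y hxy => ?_)
    fun x => x.1
  refine Disjoint.mono inter_subset_left inter_subset_left (Disjoint.preimage _ ?_)
  simpa using fun h' => hxy (Subtype.ext h')

/-- The Laplace functional of a Poisson process; `f` may take the value `∞`, which gives void
probabilities. -/
theorem lintegral_eNeg [SigmaFinite μ] (h : IsPoissonLaw Q μ) {f : E → ℝ≥0∞} (hf : Measurable f) :
    ∫⁻ N, eNeg (∫⁻ p, f p ∂N) ∂Q = eNeg (∫⁻ p, (1 - eNeg (f p)) ∂μ) := by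
  have := h.isProbabilityMeasure
  -- approximation from below by simple functions that live on sets of finite intensity
  let g : ℕ → E → ℝ≥0∞ := fun n => (spanningSets μ n).indicator (SimpleFunc.eapprox f n)
  have hg : ∀ n, Measurable (g n) := fun n =>
    (SimpleFunc.measurable _).indicator (measurableSet_spanningSets μ n)
  have hmono : ∀ p, Monotone fun n => g n p := by
    intro p m n hmn
    by_cases hp : p ∈ spanningSets μ m
    · simp only [g]
      rw [indicator_of_mem hp, indicator_of_mem (monotone_spanningSets μ hmn hp)]
      exact SimpleFunc.monotone_eapprox f hmn p
    · simp [g, hp]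
  have htend : ∀ p, Filter.Tendsto (fun n => g n p) Filter.atTop (nhds (f p)) := by
    intro p
    have h1 := SimpleFunc.tendsto_eapprox hf p
    refine h1.congr' ?_
    filter_upwards [eventually_mem_spanningSets μ p] with n hn
    simp [g, hn]
  have hstep : ∀ n, ∫⁻ N, eNeg (∫⁻ p, g n p ∂N) ∂Q = eNeg (∫⁻ p, (1 - eNeg (g n p)) ∂μ) := by
    intro n
    have hW := measurableSet_spanningSets μ n
    have := h.lintegral_eNeg_simple (SimpleFunc.eapprox f n) hW (measure_spanningSets_lt_top μ n).ne
    simp_rw [← lintegral_indicator hW] at this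
    rw [this]
    congr 2 with p
    by_cases hp : p ∈ spanningSets μ n <;> simp [g, hp, eNeg_zero]
  have hL : Filter.Tendsto (fun n => ∫⁻ N, eNeg (∫⁻ p, g n p ∂N) ∂Q) Filter.atTop
      (nhds (∫⁻ N, eNeg (∫⁻ p, f p ∂N) ∂Q)) := by
    refine tendsto_lintegral_of_dominated_convergence (fun _ => 1)
      (fun n => measurable_eNeg.comp (Measure.measurable_lintegral (hg n)))
      (fun n => Filter.Eventually.of_forall fun N => eNeg_le_one _) (by simp)
      (Filter.Eventually.of_forall fun N => (continuous_eNeg.tendsto _).comp ?_)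
    exact lintegral_tendsto_of_tendsto_of_monotone (fun n => (hg n).aemeasurable)
      (Filter.Eventually.of_forall hmono) (Filter.Eventually.of_forall htend)
  have hR : Filter.Tendsto (fun n => eNeg (∫⁻ p, (1 - eNeg (g n p)) ∂μ)) Filter.atTop
      (nhds (eNeg (∫⁻ p, (1 - eNeg (f p)) ∂μ))) := by
    refine (continuous_eNeg.tendsto _).comp ?_
    refine lintegral_tendsto_of_tendsto_of_monotone
      (fun n => ((measurable_const.sub (measurable_eNeg.comp (hg n)))).aemeasurable)
      (Filter.Eventually.of_forall fun p m n hmn => ?_) (Filter.Eventually.of_forall fun p => ?_)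
    · exact tsub_le_tsub_left (eNeg_antitone (hmono p hmn)) _
    · exact ENNReal.Tendsto.sub tendsto_const_nhds ((continuous_eNeg.tendsto _).comp (htend p))
        (Or.inl ENNReal.one_ne_top)
  simp_rw [hstep] at hL
  exact tendsto_nhds_unique hL hR

/-- The intensity of a Poisson process is its mean measure. -/
lemma lintegral_apply (h : IsPoissonLaw Q μ) {A : Set E} (hA : MeasurableSet A) (hμ : μ A ≠ ∞) :
    ∫⁻ N, N A ∂Q = μ A := by
  rw [h.lintegral_comp (f := fun x => x) hA hμ measurable_id]
  have := lintegral_poissonMeasure_mul (μ A).toNNReal fun _ => 1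
  simp only [mul_one, lintegral_one, measure_univ] at this
  rw [this, ENNReal.coe_toNNReal hμ]

lemma ae_eq_zero (h : IsPoissonLaw Q μ) {A : Set E} (hA : MeasurableSet A) (hμ : μ A = 0) :
    ∀ᵐ N ∂Q, N A = 0 := by
  have := h.lintegral_apply hA (by simp [hμ])
  rw [hμ, lintegral_eq_zero_iff (Measure.measurable_coe hA)] at this
  exact this

/-- The restrictions of a Poisson process to disjoint sets are independent. Finitely many counts in
each of the sets are sums of counts of atoms, and these are jointly independent. -/
theorem iIndepFun_restrict [SigmaFinite μ] (h : IsPoissonLaw Q μ) {ι : Type*} {S : ι → Set E}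
    (hS : ∀ i, MeasurableSet (S i)) (hd : Pairwise (fun i j => Disjoint (S i) (S j))) :
    iIndepFun (fun i (N : Measure E) => N.restrict (S i)) Q := by
  classical
  have hmX : ∀ (i : ι) (A : FiniteSet μ), Measurable fun N : Measure E => N (A.1 ∩ S i) :=
    fun i A => Measure.measurable_coe (A.2.1.inter (hS i))
  have hproc : iIndepFun (fun (i : ι) (N : Measure E) (A : FiniteSet μ) => N (A.1 ∩ S i)) Q := by
    refine iIndepFun.iIndepFun_process hmX fun I J => ?_
    let T : Finset (FiniteSet μ) := Finset.univ.biUnion J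
    let A : T → Set E := fun a => a.1.1
    have hA : ∀ a, MeasurableSet (A a) := fun a => a.1.2.1
    have hAμ : ∀ a, μ (A a) ≠ ∞ := fun a => a.1.2.2
    have hat := measurableSet_atom hA
    have hi : iIndepFun (fun (p : I × (T → Bool)) (N : Measure E) => N (atom A p.2 ∩ S p.1)) Q := by
      refine h.indep_fintype (fun p => (hat _).inter (hS _))
        (fun p => ne_top_of_le_ne_top (measure_atom_ne_top hAμ p.2) (measure_mono inter_subset_left))
        fun p q hpq => ?_
      by_cases h1 : p.1 = q.1
      · have h2 : p.2 ≠ q.2 := fun h2 => hpq (Prod.ext h1 h2)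
        exact (disjoint_atom h2).mono inter_subset_left inter_subset_left
      · exact (hd fun h' => h1 (Subtype.ext h')).mono inter_subset_right inter_subset_right
    have hm : ∀ p : I × (T → Bool), Measurable fun N : Measure E => N (atom A p.2 ∩ S p.1) :=
      fun p => Measure.measurable_coe ((hat _).inter (hS _))
    have hg := iIndep_iSup_prod (fun p => (hm p).comap_le) hi.iIndep
    rw [iIndepFun_iff_iIndep]
    refine iIndep_mono (fun i => ?_) hg
    refine Measurable.comap_le (@measurable_pi_lambda _ _ _ (_) _ _ fun a => ?_)
    have haT : a.1 ∈ T := Finset.mem_biUnion.2 ⟨i, Finset.mem_univ _, a.2⟩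
    have h3 : ∀ N : Measure E, N (a.1.1 ∩ S i) =
        ∑ b : T → Bool, if b ⟨a.1, haT⟩ = true then N (atom A b ∩ S i) else 0 := by
      intro N
      have := measure_eq_sum_atom (N.restrict (S i)) hA ⟨a.1, haT⟩
      simp only [A] at this
      rw [Measure.restrict_apply a.1.2.1] at this
      rw [this]
      refine Finset.sum_congr rfl fun b _ => ?_
      rw [Measure.restrict_apply (hat b)]
    simp_rw [h3]
    refine @Finset.measurable_sum _ _ _ _ _ _ (_) _ _ fun b _ => ?_
    by_cases hb : b ⟨a.1, haT⟩ = true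
    · simp only [hb, if_true]
      have h4 : Measurable[MeasurableSpace.comap (fun N : Measure E => N (atom A b ∩ S i)) inferInstance]
        fun N : Measure E => N (atom A b ∩ S i) := comap_measurable _
      exact h4.mono (le_iSup (fun b => MeasurableSpace.comap
        (fun N : Measure E => N (atom A b ∩ S i)) inferInstance) b) le_rfl
    · simp only [hb]
      exact measurable_const
  rw [iIndepFun_iff_iIndep] at hproc ⊢
  refine iIndep_mono (fun i => ?_) hproc
  refine Measurable.comap_le ?_
  refine @measurable_measure_of_finite E _ (Measure E) (_) μ _ _ fun A hA hμ => ?_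
  simp_rw [Measure.restrict_apply hA]
  have h5 : Measurable[MeasurableSpace.comap (fun (N : Measure E) (A : FiniteSet μ) => N (A.1 ∩ S i))
    inferInstance] fun (N : Measure E) (A : FiniteSet μ) => N (A.1 ∩ S i) := comap_measurable _
  exact (measurable_pi_apply (⟨A, hA, hμ⟩ : FiniteSet μ)).comp h5

/-- If the intensity does not charge the level sets of `ℓ`, the process has at most one point in each
of those level sets that contain a point: by Mecke's formula, the mean number of points that share
their level set is the integral over `p` of the probability that the level set of `p` is hit. -/
lemma ae_locKernel_level_lt_two [SigmaFinite μ] (h : IsPoissonLaw Q μ) {ℓ : E → ℝ}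
    (hℓ : Measurable ℓ) (hμ : ∀ z, μ {q | ℓ q = z} = 0) :
    ∀ᵐ N ∂Q, ∀ᵐ p ∂(locKernel μ N), locKernel μ N {q | ℓ q = ℓ p} < 2 := by
  have hset : MeasurableSet {x : (E × Measure E) × E | ℓ x.2 = ℓ x.1.1} :=
    measurableSet_eq_fun (hℓ.comp measurable_snd) (hℓ.comp (measurable_fst.comp measurable_fst))
  have hm : Measurable fun x : E × Measure E => locKernel μ x.2 {q | ℓ q = ℓ x.1} :=
    Kernel.measurable_kernel_prodMk_left (κ := (locKernel μ).comap Prod.snd measurable_snd) hset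
  let T : Set (E × Measure E) := {x | 2 ≤ locKernel μ x.2 {q | ℓ q = ℓ x.1}}
  have hT : MeasurableSet T := measurableSet_le measurable_const hm
  have hΨ : Measurable (T.indicator (1 : E × Measure E → ℝ≥0∞)) := measurable_one.indicator hT
  have h1 := h.mecke hΨ
  have h2 : ∀ p, ∫⁻ N, T.indicator (1 : E × Measure E → ℝ≥0∞) (p, N + Measure.dirac p) ∂Q = 0 := by
    intro p
    have hs : MeasurableSet {q | ℓ q = ℓ p} := hℓ (measurableSet_singleton _)
    have h3 := h.ae_eq_zero hs (hμ _)
    rw [← lintegral_zero (μ := Q)]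
    refine lintegral_congr_ae (h3.mono fun N hN => indicator_of_notMem ?_ _)
    simp only [T, mem_ofPred_eq, not_le]
    refine (locKernel_le _ _).trans_lt ?_
    rw [Measure.coe_add, Pi.add_apply, hN, zero_add]
    exact (prob_le_one).trans_lt (by norm_num)
  simp_rw [h2, lintegral_zero] at h1
  have hker : Measurable fun N => ∫⁻ p, T.indicator (1 : E × Measure E → ℝ≥0∞) (p, N)
      ∂(locKernel μ N) :=
    Measurable.lintegral_kernel_prod_right' (hΨ.comp measurable_swap)
  rw [lintegral_eq_zero_iff hker] at h1
  refine h1.mono fun N hN => ?_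
  have hN' : ∫⁻ p, T.indicator (1 : E × Measure E → ℝ≥0∞) (p, N) ∂(locKernel μ N) = 0 := hN
  have hms : Measurable fun p => T.indicator (1 : E × Measure E → ℝ≥0∞) (p, N) :=
    hΨ.comp measurable_prodMk_right
  rw [lintegral_eq_zero_iff hms] at hN'
  refine hN'.mono fun p hp => ?_
  by_contra hlt
  have hpT : (p, N) ∈ T := not_lt.1 hlt
  simp [indicator_of_mem hpT] at hp

end IsPoissonLaw

/-! ### Integrals against the counting measure of a point set -/

section pointMeasure

variable [MeasurableSingletonClass E] {Φ : Set E}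

lemma setLIntegral_pointMeasure (hΦ : Φ.Countable) (f : E → ℝ≥0∞) {S : Set E}
    (hS : MeasurableSet S) :
    ∫⁻ p in S, f p ∂pointMeasure Φ = ∑' p : {p // p ∈ Φ ∧ p ∈ S}, f p := by
  rw [pointMeasure, Measure.restrict_restrict hS, inter_comm,
    lintegral_countable f (hΦ.mono inter_subset_left)]
  simp
  rfl

lemma pointMeasure_eq_zero_iff (hΦ : Φ.Countable) {S : Set E} (hS : MeasurableSet S) :
    pointMeasure Φ S = 0 ↔ ∀ p ∈ Φ, p ∉ S := by
  rw [pointMeasure_apply Φ hS hΦ]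
  simp only [ENat.toENNReal_eq_zero, encard_eq_zero, Set.eq_empty_iff_forall_notMem, mem_inter_iff,
    not_and]

lemma pointMeasure_lt_two (hΦ : Φ.Countable) {S : Set E} (hS : MeasurableSet S)
    (h : pointMeasure Φ S < 2) {p q : E} (hp : p ∈ Φ) (hpS : p ∈ S) (hq : q ∈ Φ) (hqS : q ∈ S) :
    p = q := by
  rw [pointMeasure_apply Φ hS hΦ] at h
  by_contra hne
  have : ({p, q} : Set E).encard ≤ (Φ ∩ S).encard := encard_le_encard (by
    rintro x (rfl | rfl)
    exacts [⟨hp, hpS⟩, ⟨hq, hqS⟩])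
  rw [encard_pair hne] at this
  have h2 : ((2 : ℕ∞) : ℝ≥0∞) ≤ ((Φ ∩ S).encard : ℝ≥0∞) := ENat.toENNReal_le.2 this
  exact absurd (h2.trans_lt h) (by simp)

lemma pointMeasure_of_subsingleton (hΦ : Φ.Countable) {S : Set E} (hS : MeasurableSet S)
    (h : (Φ ∩ S).Subsingleton) : pointMeasure Φ S = 0 ∨ pointMeasure Φ S = 1 := by
  rw [pointMeasure_apply Φ hS hΦ]
  rcases h.eq_empty_or_singleton with h | ⟨p, h⟩ <;> simp [h]

lemma ae_pointMeasure_iff (hΦ : Φ.Countable) {p : E → Prop} :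
    (∀ᵐ x ∂pointMeasure Φ, p x) ↔ ∀ x ∈ Φ, p x := by
  rw [pointMeasure, ae_restrict_iff' hΦ.measurableSet]
  rw [ae_iff, Measure.count_eq_zero_iff]
  simp [Set.eq_empty_iff_forall_notMem]

end pointMeasure

/-- A Poisson process has no ties with respect to a function whose level sets are null. -/
lemma IsPoissonProcess.ae_injOn [MeasurableSingletonClass E] {Ω : Type*} [MeasurableSpace Ω]
    {P : Measure Ω} {Φ : Ω → Set E} {μ : Measure E} [SigmaFinite μ] (h : IsPoissonProcess P Φ μ)
    {ℓ : E → ℝ} (hℓ : Measurable ℓ) (hμ : ∀ z, μ {q | ℓ q = z} = 0) :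
    ∀ᵐ ω ∂P, InjOn ℓ (Φ ω) := by
  have hm := h.measurable_pointMeasure.aemeasurable (μ := P)
  have h1 := ae_of_ae_map hm (h.isPoissonLaw.ae_locKernel_level_lt_two hℓ hμ)
  have h2 := ae_of_ae_map hm h.isPoissonLaw.ae_mem_locFinite
  filter_upwards [h1, h2] with ω hω hω2 p hp q hq hpq
  rw [locKernel_of_mem hω2, ae_pointMeasure_iff (h.countable ω)] at hω
  exact pointMeasure_lt_two (h.countable ω) (hℓ (measurableSet_singleton _)) (hω q hq) hp hpq hq rfl

end MmWave

namespace MmWave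

/-! ### Beams -/

/-- The angle of a complex number, in `[0, 2π)`. -/
def angle (x : ℂ) : ℝ := if 0 ≤ x.arg then x.arg else x.arg + 2 * Real.pi

lemma angle_nonneg (x : ℂ) : 0 ≤ angle x := by
  unfold angle
  split_ifs with h
  · exact h
  · linarith [Complex.neg_pi_lt_arg x, Real.pi_pos]

lemma angle_lt (x : ℂ) : angle x < 2 * Real.pi := by
  unfold angle
  split_ifs with h
  · linarith [Complex.arg_le_pi x, Real.pi_pos]
  · linarith

lemma measurable_angle : Measurable angle :=
  Measurable.ite (measurableSet_le measurable_const Complex.measurable_arg) Complex.measurable_arg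
    (Complex.measurable_arg.add_const _)

lemma norm_mul_exp_angle (x : ℂ) : (‖x‖ : ℂ) * Complex.exp (angle x * Complex.I) = x := by
  have h : Complex.exp (angle x * Complex.I) = Complex.exp (x.arg * Complex.I) := by
    unfold angle
    split_ifs
    · rfl
    · push_cast
      rw [add_mul, Complex.exp_periodic]
  rw [h, Complex.norm_mul_exp_arg_mul_I]

lemma angle_mul_exp {r θ : ℝ} (hr : 0 < r) (h0 : 0 ≤ θ) (h1 : θ < 2 * Real.pi) :
    angle (r * Complex.exp (θ * Complex.I)) = θ := by
  have hpi := Real.pi_pos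
  by_cases h : θ ≤ Real.pi
  · have : Complex.arg (r * Complex.exp (θ * Complex.I)) = θ := by
      rw [Complex.exp_mul_I]
      exact Complex.arg_mul_cos_add_sin_mul_I hr ⟨by linarith, h⟩
    rw [angle, this, if_pos h0]
  · have h2 : Complex.exp (θ * Complex.I) = Complex.exp ((θ - 2 * Real.pi : ℝ) * Complex.I) := by
      push_cast
      rw [sub_mul, Complex.exp_periodic.sub_eq]
    have : Complex.arg (r * Complex.exp (θ * Complex.I)) = θ - 2 * Real.pi := by
      rw [h2, Complex.exp_mul_I]
      exact Complex.arg_mul_cos_add_sin_mul_I hr ⟨by linarith, by linarith⟩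
    rw [angle, this, if_neg (by linarith)]
    ring

lemma mem_beam_iff_sub (x y : ℂ) (k j : ℕ) : y ∈ beam x k j ↔ y - x ∈ beam 0 k j := by
  simp [beam, sector]

/-- Membership in a beam of the origin, in terms of the angle. The origin itself is in no beam. -/
lemma mem_beam_zero {k : ℕ} {j : ℕ} (hj : j < k) {x : ℂ} :
    x ∈ beam 0 k j ↔
      x ≠ 0 ∧ 2 * Real.pi * j / k ≤ angle x ∧ angle x < 2 * Real.pi * (j + 1) / k := by
  have hpi := Real.pi_pos
  have hk : (0 : ℝ) < k := by exact_mod_cast (Nat.zero_le j).trans_lt hj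
  have hjk : (j : ℝ) + 1 ≤ k := by exact_mod_cast hj
  constructor
  · rintro ⟨r, hr, θ, ⟨h0, h1⟩, hx⟩
    rw [sub_zero] at hx
    have h2 : 0 ≤ θ := le_trans (by positivity) h0
    have h3 : θ < 2 * Real.pi := by
      refine h1.trans_le ?_
      rw [div_le_iff₀ hk]
      exact mul_le_mul_of_nonneg_left hjk (by positivity)
    rw [hx, angle_mul_exp hr h2 h3]
    refine ⟨?_, h0, h1⟩
    simp [hr.ne', Complex.exp_ne_zero]
  · rintro ⟨hx, h0, h1⟩
    exact ⟨‖x‖, norm_pos_iff.2 hx, angle x, ⟨h0, h1⟩, by rw [norm_mul_exp_angle, sub_zero]⟩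

lemma measurableSet_beam_zero {k j : ℕ} (hj : j < k) : MeasurableSet (beam 0 k j) := by
  have : beam 0 k j = {x | x ≠ 0} ∩ ({x | 2 * Real.pi * j / k ≤ angle x} ∩
      {x | angle x < 2 * Real.pi * (j + 1) / k}) := by
    ext x; exact mem_beam_zero hj
  rw [this]
  exact (measurableSet_singleton (0 : ℂ)).compl.inter
    ((measurableSet_le measurable_const measurable_angle).inter
      (measurableSet_lt measurable_angle measurable_const))

lemma measurableSet_beam_prod {k j : ℕ} (hj : j < k) :
    MeasurableSet {x : ℂ × ℂ | x.2 ∈ beam x.1 k j} := by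
  have : {x : ℂ × ℂ | x.2 ∈ beam x.1 k j} = {x | x.2 - x.1 ∈ beam 0 k j} := by
    ext x; exact mem_beam_iff_sub _ _ _ _
  rw [this]
  exact (measurable_snd.sub measurable_fst) (measurableSet_beam_zero hj)

/-- The `k` beams of a station partition the plane without the station. -/
lemma existsUnique_mem_beam {k : ℕ} (hk : 0 < k) {x : ℂ} (hx : x ≠ 0) :
    ∃! j : Fin k, x ∈ beam 0 k j := by
  have hpi := Real.pi_pos
  have hk' : (0 : ℝ) < k := by exact_mod_cast hk
  have ha := angle_nonneg x
  have e : ∀ j : ℕ, (2 * Real.pi * j / k ≤ angle x ∧ angle x < 2 * Real.pi * (j + 1) / k) ↔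
      ⌊angle x * k / (2 * Real.pi)⌋₊ = j := by
    intro j
    rw [Nat.floor_eq_iff (by positivity), div_le_iff₀ hk', lt_div_iff₀ hk', le_div_iff₀ (by positivity),
      div_lt_iff₀ (by positivity), mul_comm (j : ℝ), mul_comm ((j : ℝ) + 1)]
  have hlt : ⌊angle x * k / (2 * Real.pi)⌋₊ < k := by
    rw [Nat.floor_lt (by positivity), div_lt_iff₀ (by positivity), mul_comm]
    exact mul_lt_mul_of_pos_left (angle_lt x) hk'
  refine ⟨⟨_, hlt⟩, (mem_beam_zero hlt).2 ⟨hx, (e _).2 rfl⟩, fun j hj => ?_⟩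
  exact Fin.ext ((e j).1 ((mem_beam_zero j.2).1 hj).2).symm

lemma disjoint_beam {k : ℕ} {i j : Fin k} (h : i ≠ j) :
    Disjoint (beam 0 k i) (beam 0 k j) := by
  rw [Set.disjoint_left]
  intro x hi hj
  have hk : 0 < k := (Nat.zero_le _).trans_lt i.2
  exact h ((existsUnique_mem_beam hk ((mem_beam_zero i.2).1 hi).1).unique hi hj)

lemma mem_beam_rotate (k j : ℕ) (x : ℂ) :
    Complex.exp ((2 * Real.pi * j / k : ℝ) * Complex.I) * x ∈ beam 0 k j ↔ x ∈ beam 0 k 0 := by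
  have key : ∀ (r θ : ℝ), Complex.exp ((2 * Real.pi * j / k : ℝ) * Complex.I) * x =
      r * Complex.exp ((θ + 2 * Real.pi * j / k : ℝ) * Complex.I) ↔
      x = r * Complex.exp (θ * Complex.I) := by
    intro r θ
    rw [Complex.ofReal_add, add_mul, Complex.exp_add, ← mul_assoc,
      mul_comm _ (Complex.exp ((2 * Real.pi * j / k : ℝ) * Complex.I))]
    exact mul_right_inj' (Complex.exp_ne_zero _)
  have e1 : 2 * Real.pi * (j + 1 : ℝ) / k = 2 * Real.pi * j / k + 2 * Real.pi / k := by ring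
  constructor
  · rintro ⟨r, hr, θ, ⟨h0, h1⟩, h⟩
    rw [e1] at h1
    refine ⟨r, hr, θ - 2 * Real.pi * j / k, ⟨?_, ?_⟩, ?_⟩
    · simpa using h0
    · simpa [sub_lt_iff_lt_add'] using h1
    · rw [sub_zero] at h ⊢
      rw [← key, h, sub_add_cancel]
  · rintro ⟨r, hr, θ, ⟨h0, h1⟩, h⟩
    refine ⟨r, hr, θ + 2 * Real.pi * j / k, ⟨?_, ?_⟩, ?_⟩
    · simpa using h0
    · rw [e1, add_comm]
      simpa using h1
    · rw [sub_zero] at h ⊢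
      rwa [key]

lemma lintegral_beam_norm_eq {k j : ℕ} (hj : j < k) (f : ℝ → ℝ≥0∞) :
    ∫⁻ x in beam 0 k j, f ‖x‖ = ∫⁻ x in beam 0 k 0, f ‖x‖ := by
  have h0 : 0 < k := (Nat.zero_le _).trans_lt hj
  let c : Circle := Circle.exp (2 * Real.pi * j / k)
  have hc : ∀ x : ℂ, rotation c x = Complex.exp ((2 * Real.pi * j / k : ℝ) * Complex.I) * x := by
    intro x
    rw [rotation_apply, Circle.coe_exp]
  have hmp := (rotation c).measurePreserving
  have hme : MeasurableEmbedding (rotation c) :=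
    (rotation c).toHomeomorph.measurableEmbedding
  rw [← hmp.setLIntegral_comp_preimage_emb hme (fun x => f ‖x‖) (beam 0 k j)]
  have hpre : (rotation c) ⁻¹' beam 0 k j = beam 0 k 0 := by
    ext x
    rw [mem_preimage, hc, mem_beam_rotate]
  rw [hpre]
  simp only [LinearIsometryEquiv.norm_map]

lemma lintegral_norm {f : ℝ → ℝ≥0∞} (hf : Measurable f) :
    ∫⁻ x : ℂ, f ‖x‖ = ENNReal.ofReal (2 * Real.pi) * ∫⁻ r in Ioi (0 : ℝ), ENNReal.ofReal r * f r := by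
  rw [← Complex.lintegral_comp_polarCoord_symm]
  have h1 : ∀ p ∈ polarCoord.target, ENNReal.ofReal p.1 • f ‖Complex.polarCoord.symm p‖ =
      ENNReal.ofReal p.1 * f p.1 := by
    intro p hp
    rw [polarCoord_target] at hp
    rw [Complex.norm_polarCoord_symm, abs_of_pos hp.1, smul_eq_mul]
  have hm : Measurable fun r : ℝ => ENNReal.ofReal r * f r := ENNReal.measurable_ofReal.mul hf
  rw [setLIntegral_congr_fun polarCoord.open_target.measurableSet h1, polarCoord_target,
    Measure.volume_eq_prod, ← Measure.prod_restrict,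
    lintegral_prod (fun p : ℝ × ℝ => ENNReal.ofReal p.1 * f p.1) (hm.comp measurable_fst).aemeasurable]
  simp only [lintegral_const, Measure.restrict_apply MeasurableSet.univ, univ_inter, Real.volume_Ioo]
  rw [lintegral_mul_const _ hm, mul_comm]
  congr 2
  ring

/-- Rotation invariance: a beam sees the fraction `1 / k` of the plane. -/
lemma lintegral_beam_norm {k j : ℕ} (hj : j < k) {f : ℝ → ℝ≥0∞} (hf : Measurable f) :
    ∫⁻ x in beam 0 k j, f ‖x‖ =
      ENNReal.ofReal (2 * Real.pi / k) * ∫⁻ r in Ioi (0 : ℝ), ENNReal.ofReal r * f r := by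
  have h0 : 0 < k := (Nat.zero_le _).trans_lt hj
  have hU : (⋃ i : Fin k, beam 0 k i) =ᵐ[volume] (univ : Set ℂ) := by
    rw [ae_eq_univ]
    refine measure_mono_null (t := {0}) (fun x hx => ?_) (measure_singleton 0)
    by_contra hne
    exact hx (mem_iUnion.2 (existsUnique_mem_beam h0 hne).exists)
  have h1 : ∫⁻ x : ℂ, f ‖x‖ = k * ∫⁻ x in beam 0 k j, f ‖x‖ := by
    rw [← setLIntegral_univ, ← setLIntegral_congr hU, lintegral_iUnion
      (fun i : Fin k => measurableSet_beam_zero i.2) (fun i j hij => disjoint_beam hij), tsum_fintype,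
      Finset.sum_congr rfl (fun i _ => lintegral_beam_norm_eq i.2 f), lintegral_beam_norm_eq hj]
    simp
  have hk : (k : ℝ≥0∞) ≠ 0 := by exact_mod_cast h0.ne'
  rw [lintegral_norm hf] at h1
  rw [ENNReal.ofReal_div_of_pos (by exact_mod_cast h0), ENNReal.ofReal_natCast, div_eq_mul_inv,
    mul_right_comm, h1, mul_comm (k : ℝ≥0∞), mul_assoc, ENNReal.mul_inv_cancel hk (by simp), mul_one]

/-! ### Fading and blockage -/

lemma expMeasure_not_pos : expMeasure 1 {F : ℝ | ¬ 0 < F} = 0 := by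
  have : {F : ℝ | ¬ 0 < F} = Iic 0 := by ext; simp
  rw [this]
  have h := isProbabilityMeasure_expMeasure (r := 1) one_pos
  rw [← ofReal_cdf, cdf_expMeasure_eq one_pos]
  simp

lemma ae_expMeasure_pos : ∀ᵐ F ∂expMeasure 1, 0 < F := expMeasure_not_pos

lemma expMeasure_eq : expMeasure 1 = volume.withDensity (exponentialPDF 1) := rfl

/-- The tail of the exponential distribution. -/
lemma expMeasure_tail (c : ℝ≥0∞) : expMeasure 1 {F : ℝ | c ≤ ENNReal.ofReal F} = eNeg c := by
  have hp := isProbabilityMeasure_expMeasure (r := 1) one_pos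
  by_cases hc : c = ∞
  · simp [hc, eNeg_top]
  by_cases h0 : c = 0
  · simp [h0, eNeg_zero]
  have hpos : 0 < c.toReal := ENNReal.toReal_pos h0 hc
  have h1 : {F : ℝ | c ≤ ENNReal.ofReal F} = (Iio c.toReal)ᶜ := by
    ext F
    rw [mem_compl_iff, mem_Iio, not_lt, mem_ofPred_eq]
    conv_lhs => rw [← ENNReal.ofReal_toReal hc]
    rw [ENNReal.ofReal_le_ofReal_iff']
    exact or_iff_left hpos.not_ge
  have h2 : expMeasure 1 (Iio c.toReal) = expMeasure 1 (Iic c.toReal) := by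
    rw [expMeasure_eq]
    exact measure_congr Iio_ae_eq_Iic
  rw [h1, prob_compl_eq_one_sub measurableSet_Iio, h2, ← ofReal_cdf, cdf_expMeasure_eq one_pos,
    if_pos hpos.le, eNeg, expNeg_of_ne_top hc, ← ENNReal.ofReal_one, ← ENNReal.ofReal_sub]
  · congr 1; ring_nf
  · have := Real.exp_le_one_iff.2 (show -(1 * c.toReal) ≤ 0 by linarith)
    linarith

/-- The Laplace transform of the exponential distribution. -/
lemma lintegral_expMeasure_eNeg {a : ℝ} (ha : 0 ≤ a) :
    ∫⁻ F, eNeg (ENNReal.ofReal (F * a)) ∂expMeasure 1 = ENNReal.ofReal (1 / (1 + a)) := by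
  have ha' : 0 < 1 + a := by linarith
  have hm : Measurable fun F : ℝ => eNeg (ENNReal.ofReal (F * a)) :=
    measurable_eNeg.comp (measurable_id.mul_const a).ennreal_ofReal
  have hpdf : ∀ r, Measurable (exponentialPDF r) := fun r =>
    (measurable_exponentialPDFReal r).ennreal_ofReal
  rw [expMeasure_eq, lintegral_withDensity_eq_lintegral_mul _ (hpdf 1) hm]
  have h1 : ∀ F, (exponentialPDF 1 * fun F => eNeg (ENNReal.ofReal (F * a))) F =
      ENNReal.ofReal (1 / (1 + a)) * exponentialPDF (1 + a) F := by
    intro F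
    rw [Pi.mul_apply, exponentialPDF_eq, exponentialPDF_eq]
    by_cases hF : 0 ≤ F
    · rw [if_pos hF, if_pos hF, eNeg, expNeg_ofReal (by positivity),
        ← ENNReal.ofReal_mul (by positivity), ← ENNReal.ofReal_mul (by positivity)]
      congr 1
      rw [one_mul, ← Real.exp_add, ← mul_assoc, one_div_mul_cancel ha'.ne', one_mul]
      ring_nf
    · simp [hF]
  simp_rw [h1]
  rw [lintegral_const_mul _ (hpdf _), lintegral_exponentialPDF_eq_one ha', mul_one]

lemma lintegral_unitUniform_ite {t : ℝ} (h0 : 0 ≤ t) (h1 : t ≤ 1) (a b : ℝ≥0∞) :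
    ∫⁻ u, (open Classical in if u ≤ t then a else b) ∂unitUniform =
      ENNReal.ofReal t * a + ENNReal.ofReal (1 - t) * b := by
  classical
  have hs : MeasurableSet {u : ℝ | u ≤ t} := measurableSet_Iic
  rw [← lintegral_add_compl _ hs]
  have e1 : unitUniform {u : ℝ | u ≤ t} = ENNReal.ofReal t := by
    rw [unitUniform, Measure.restrict_apply hs]
    have : {u : ℝ | u ≤ t} ∩ Icc 0 1 = Icc 0 t := by
      ext u
      simp only [mem_inter_iff, mem_ofPred_eq, mem_Icc]
      exact ⟨fun h => ⟨h.2.1, h.1⟩, fun h => ⟨h.2, h.1, h.2.trans h1⟩⟩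
    rw [this, Real.volume_Icc, sub_zero]
  have e2 : unitUniform {u : ℝ | u ≤ t}ᶜ = ENNReal.ofReal (1 - t) := by
    rw [unitUniform, Measure.restrict_apply hs.compl]
    have : {u : ℝ | u ≤ t}ᶜ ∩ Icc 0 1 = Ioc t 1 := by
      ext u
      simp only [mem_inter_iff, mem_compl_iff, mem_ofPred_eq, mem_Icc, mem_Ioc, not_le]
      exact ⟨fun h => ⟨h.1, h.2.2⟩, fun h => ⟨h.1, h0.trans h.1.le, h.2⟩⟩
    rw [this, Real.volume_Ioc]
  congr 1
  · rw [← e1, mul_comm, ← setLIntegral_const]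
    exact setLIntegral_congr_fun hs fun u hu => if_pos hu
  · rw [← e2, mul_comm, ← setLIntegral_const]
    exact setLIntegral_congr_fun hs.compl fun u hu => if_neg hu

end MmWave

namespace MmWave

instance : IsProbabilityMeasure (expMeasure 1) := isProbabilityMeasure_expMeasure one_pos

instance : IsProbabilityMeasure unitUniform := ⟨by simp [unitUniform]⟩

/-! ### Path loss -/

namespace Network

variable (s : Network)

lemma measurable_lossL : Measurable s.lossL := (measurable_id.pow_const _).const_mul _

lemma measurable_lossN : Measurable s.lossN := (measurable_id.pow_const _).const_mul _

lemma measurable_loss : Measurable fun x : ℝ × ℝ => s.loss x.1 x.2 :=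
  Measurable.ite (measurableSet_le measurable_snd (s.h_meas.comp measurable_fst))
    (s.measurable_lossL.comp measurable_fst) (s.measurable_lossN.comp measurable_fst)

lemma lossL_pos {r : ℝ} (hr : 0 < r) : 0 < s.lossL r := mul_pos s.beta_pos (Real.rpow_pos_of_pos hr _)

lemma lossN_pos {r : ℝ} (hr : 0 < r) : 0 < s.lossN r := mul_pos s.beta_pos (Real.rpow_pos_of_pos hr _)

lemma loss_pos {r : ℝ} (hr : 0 < r) (u : ℝ) : 0 < s.loss r u := by
  unfold loss; split_ifs; exacts [s.lossL_pos hr, s.lossN_pos hr]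

/-- The integral of `G` over the path losses of the points of a process whose distances have the
intensity `r dr` and whose links are LOS with probability `h r`. All integrals over stations or users
that occur reduce to this functional. -/
def mix (G : ℝ → ℝ≥0∞) : ℝ≥0∞ :=
  ∫⁻ r in Ioi (0 : ℝ), (ENNReal.ofReal (s.h r * r) * G (s.lossL r) +
    ENNReal.ofReal ((1 - s.h r) * r) * G (s.lossN r))

lemma lintegral_loss (r : ℝ) (G : ℝ → ℝ≥0∞) :
    ∫⁻ u, G (s.loss r u) ∂unitUniform =
      ENNReal.ofReal (s.h r) * G (s.lossL r) + ENNReal.ofReal (1 - s.h r) * G (s.lossN r) := by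
  rw [← lintegral_unitUniform_ite (s.h_nonneg r) (s.h_le_one r)]
  refine lintegral_congr fun u => ?_
  unfold loss
  split_ifs <;> rfl

lemma mix_eq_lintegral_loss (G : ℝ → ℝ≥0∞) :
    s.mix G = ∫⁻ r in Ioi (0 : ℝ), ENNReal.ofReal r * ∫⁻ u, G (s.loss r u) ∂unitUniform := by
  refine setLIntegral_congr_fun measurableSet_Ioi fun r _ => ?_
  rw [lintegral_loss, mul_add, ← mul_assoc, ← mul_assoc, ENNReal.ofReal_mul (s.h_nonneg r),
    ENNReal.ofReal_mul (sub_nonneg.2 (s.h_le_one r)), mul_comm (ENNReal.ofReal r),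
    mul_comm (ENNReal.ofReal r)]

lemma measurable_lintegral_loss {G : ℝ → ℝ≥0∞} (hG : Measurable G) :
    Measurable fun r => ∫⁻ u, G (s.loss r u) ∂unitUniform :=
  Measurable.lintegral_prod_right' (hG.comp s.measurable_loss)

lemma lintegral_loss_beam {k j : ℕ} (hj : j < k) {G : ℝ → ℝ≥0∞} (hG : Measurable G) :
    ∫⁻ x in beam 0 k j, ∫⁻ u, G (s.loss ‖x‖ u) ∂unitUniform =
      ENNReal.ofReal (2 * Real.pi / k) * s.mix G := by
  rw [lintegral_beam_norm hj (s.measurable_lintegral_loss hG), mix_eq_lintegral_loss]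

lemma lintegral_loss_plane {G : ℝ → ℝ≥0∞} (hG : Measurable G) :
    ∫⁻ x : ℂ, ∫⁻ u, G (s.loss ‖x‖ u) ∂unitUniform = ENNReal.ofReal (2 * Real.pi) * s.mix G := by
  rw [lintegral_norm (s.measurable_lintegral_loss hG), mix_eq_lintegral_loss]

/-- The intensity of the path losses on `(0, ∞)`, up to the factor `2πλ`. -/
def lossRate (z : ℝ) : ℝ :=
  (1 / s.alphaL) * (1 / s.beta) ^ (2 / s.alphaL) * z ^ (2 / s.alphaL - 1) * s.h (s.invL z) +
    (1 / s.alphaN) * (1 / s.beta) ^ (2 / s.alphaN) * z ^ (2 / s.alphaN - 1) * (1 - s.h (s.invN z))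

lemma inv_power {a b : ℝ} (ha : 0 < a) (hb : 0 < b) {z : ℝ} (hz : 0 < z) :
    b * ((z / b) ^ (1 / a)) ^ a = z := by
  rw [← Real.rpow_mul (by positivity), one_div_mul_cancel ha.ne', Real.rpow_one]
  field_simp

lemma power_inv {a b : ℝ} (ha : 0 < a) (hb : 0 < b) {r : ℝ} (hr : 0 < r) :
    (b * r ^ a / b) ^ (1 / a) = r := by
  rw [mul_div_cancel_left₀ _ hb.ne', ← Real.rpow_mul hr.le, mul_one_div_cancel ha.ne', Real.rpow_one]

/-- The change of variables `z = b r ^ a` for a link that exists with probability `w r`. -/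
lemma lintegral_power_loss {a b : ℝ} (ha : 0 < a) (hb : 0 < b) (w : ℝ → ℝ)
    (G : ℝ → ℝ≥0∞) :
    ∫⁻ r in Ioi (0 : ℝ), ENNReal.ofReal (w r * r) * G (b * r ^ a) =
      ∫⁻ z in Ioi (0 : ℝ), ENNReal.ofReal
        ((1 / a) * (1 / b) ^ (2 / a) * z ^ (2 / a - 1) * w ((z / b) ^ (1 / a))) * G z := by
  have hder : ∀ z ∈ Ioi (0 : ℝ), HasDerivWithinAt (fun z : ℝ => (z / b) ^ (1 / a))
      (1 / b * (1 / a) * (z / b) ^ (1 / a - 1)) (Ioi 0) z := by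
    intro z hz
    have hz' : z / b ≠ 0 := (div_pos hz hb).ne'
    exact (((hasDerivAt_id z).div_const b).rpow_const (Or.inl hz')).hasDerivWithinAt
  have hinj : InjOn (fun z : ℝ => (z / b) ^ (1 / a)) (Ioi 0) := by
    intro x hx y hy hxy
    rw [← inv_power ha hb hx, ← inv_power ha hb hy]
    simp only at hxy
    rw [hxy]
  have himg : (fun z : ℝ => (z / b) ^ (1 / a)) '' Ioi 0 = Ioi 0 := by
    ext r
    constructor
    · rintro ⟨z, hz, rfl⟩
      exact Real.rpow_pos_of_pos (div_pos hz hb) _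
    · intro hr
      exact ⟨b * r ^ a, mul_pos hb (Real.rpow_pos_of_pos hr _), power_inv ha hb hr⟩
  conv_lhs => rw [← himg]
  rw [lintegral_image_eq_lintegral_abs_deriv_mul measurableSet_Ioi hder hinj]
  refine setLIntegral_congr_fun measurableSet_Ioi fun z hz => ?_
  have hz0 : 0 < z := hz
  have hzb : 0 < z / b := div_pos hz hb
  rw [inv_power ha hb hz, ← mul_assoc, ← ENNReal.ofReal_mul (abs_nonneg _), abs_of_pos (by positivity)]
  congr 2
  have h1 : (z / b) ^ (1 / a - 1) * (z / b) ^ (1 / a) = z ^ (2 / a - 1) * ((1 / b) ^ (2 / a) * b) := by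
    rw [← Real.rpow_add hzb, show 1 / a - 1 + 1 / a = 2 / a - 1 by ring, div_eq_mul_one_div,
      Real.mul_rpow hz0.le (by positivity), Real.rpow_sub_one (x := 1 / b) (by positivity)]
    field_simp
  calc 1 / b * (1 / a) * (z / b) ^ (1 / a - 1) * (w ((z / b) ^ (1 / a)) * (z / b) ^ (1 / a))
      = 1 / b * (1 / a) * w ((z / b) ^ (1 / a)) * ((z / b) ^ (1 / a - 1) * (z / b) ^ (1 / a)) := by ring
    _ = _ := by rw [h1]; field_simp

lemma measurable_invL : Measurable s.invL := (measurable_id.div_const _).pow_const _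

lemma measurable_invN : Measurable s.invN := (measurable_id.div_const _).pow_const _

lemma measurable_lossRate : Measurable s.lossRate :=
  (((measurable_id.pow_const _).const_mul _).mul (s.h_meas.comp s.measurable_invL)).add
    (((measurable_id.pow_const _).const_mul _).mul
      (measurable_const.sub (s.h_meas.comp s.measurable_invN)))

lemma lossRate_nonneg {z : ℝ} (hz : 0 < z) : 0 ≤ s.lossRate z := by
  have := s.alphaL_pos; have := s.alphaN_pos; have := s.beta_pos
  have h1 := s.h_nonneg (s.invL z)
  have h2 := sub_nonneg.2 (s.h_le_one (s.invN z))
  unfold lossRate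
  positivity

lemma mix_eq_add {G : ℝ → ℝ≥0∞} (hG : Measurable G) :
    s.mix G = (∫⁻ r in Ioi (0 : ℝ), ENNReal.ofReal (s.h r * r) * G (s.lossL r)) +
      ∫⁻ r in Ioi (0 : ℝ), ENNReal.ofReal ((1 - s.h r) * r) * G (s.lossN r) := by
  have hm : Measurable fun r => ENNReal.ofReal (s.h r * r) * G (s.lossL r) :=
    (s.h_meas.mul measurable_id).ennreal_ofReal.mul (hG.comp s.measurable_lossL)
  rw [mix, lintegral_add_left hm]

/-- Change of variables from distance to path loss. -/
lemma mix_eq {G : ℝ → ℝ≥0∞} (hG : Measurable G) :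
    s.mix G = ∫⁻ z in Ioi (0 : ℝ), ENNReal.ofReal (s.lossRate z) * G z := by
  have := s.alphaL_pos; have := s.alphaN_pos; have := s.beta_pos
  rw [mix_eq_add s hG]
  have e1 := lintegral_power_loss s.alphaL_pos s.beta_pos s.h G
  have e2 := lintegral_power_loss s.alphaN_pos s.beta_pos (fun r => 1 - s.h r) G
  simp only [lossL, lossN]
  rw [e1, e2, ← lintegral_add_left]
  · refine setLIntegral_congr_fun measurableSet_Ioi fun z hz => ?_
    have hz0 : 0 < z := hz
    have h1 := s.h_nonneg (s.invL z)
    have h2 := sub_nonneg.2 (s.h_le_one (s.invN z))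
    rw [← add_mul, ← ENNReal.ofReal_add]
    · rfl
    · exact mul_nonneg (by positivity) h1
    · exact mul_nonneg (by positivity) h2
  · exact ((((measurable_id.pow_const _).const_mul _).mul
      (s.h_meas.comp s.measurable_invL)).ennreal_ofReal).mul hG

lemma lt_invL_iff {r z : ℝ} (hr : 0 < r) (hz : 0 < z) : s.lossL r < z ↔ r < s.invL z := by
  have h1 : s.lossL (s.invL z) = z := inv_power s.alphaL_pos s.beta_pos hz
  have h2 : 0 < s.invL z := Real.rpow_pos_of_pos (div_pos hz s.beta_pos) _
  conv_lhs => rw [← h1]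
  rw [lossL, lossL, mul_lt_mul_iff_right₀ s.beta_pos, Real.rpow_lt_rpow_iff hr.le h2.le s.alphaL_pos]

lemma lt_invN_iff {r z : ℝ} (hr : 0 < r) (hz : 0 < z) : s.lossN r < z ↔ r < s.invN z := by
  have h1 : s.lossN (s.invN z) = z := inv_power s.alphaN_pos s.beta_pos hz
  have h2 : 0 < s.invN z := Real.rpow_pos_of_pos (div_pos hz s.beta_pos) _
  conv_lhs => rw [← h1]
  rw [lossN, lossN, mul_lt_mul_iff_right₀ s.beta_pos, Real.rpow_lt_rpow_iff hr.le h2.le s.alphaN_pos]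

lemma invL_lt_iff {r z : ℝ} (hr : 0 < r) (hz : 0 < z) : z < s.lossL r ↔ s.invL z < r := by
  have h1 : s.lossL (s.invL z) = z := inv_power s.alphaL_pos s.beta_pos hz
  have h2 : 0 < s.invL z := Real.rpow_pos_of_pos (div_pos hz s.beta_pos) _
  conv_lhs => rw [← h1]
  rw [lossL, lossL, mul_lt_mul_iff_right₀ s.beta_pos, Real.rpow_lt_rpow_iff h2.le hr.le s.alphaL_pos]

lemma invN_lt_iff {r z : ℝ} (hr : 0 < r) (hz : 0 < z) : z < s.lossN r ↔ s.invN z < r := by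
  have h1 : s.lossN (s.invN z) = z := inv_power s.alphaN_pos s.beta_pos hz
  have h2 : 0 < s.invN z := Real.rpow_pos_of_pos (div_pos hz s.beta_pos) _
  conv_lhs => rw [← h1]
  rw [lossN, lossN, mul_lt_mul_iff_right₀ s.beta_pos, Real.rpow_lt_rpow_iff h2.le hr.le s.alphaN_pos]

lemma invL_pos {z : ℝ} (hz : 0 < z) : 0 < s.invL z := Real.rpow_pos_of_pos (div_pos hz s.beta_pos) _

lemma invN_pos {z : ℝ} (hz : 0 < z) : 0 < s.invN z := Real.rpow_pos_of_pos (div_pos hz s.beta_pos) _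

lemma lintegral_Ioi_lt (w : ℝ → ℝ) (hw : Measurable w) (hw0 : ∀ r, 0 ≤ w r) (hw1 : ∀ r, w r ≤ 1)
    {a : ℝ} (ha : 0 < a) {p : ℝ → Prop} (hp : ∀ r, 0 < r → (p r ↔ r < a)) [DecidablePred p] :
    ∫⁻ r in Ioi (0 : ℝ), ENNReal.ofReal (w r * r) * (if p r then 1 else 0) =
      ENNReal.ofReal (∫ r in (0 : ℝ)..a, w r * r) := by
  have h1 : ∀ r ∈ Ioi (0 : ℝ), ENNReal.ofReal (w r * r) * (if p r then 1 else 0) =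
      (Iio a).indicator (fun r => ENNReal.ofReal (w r * r)) r := by
    intro r hr
    by_cases h : r < a
    · rw [if_pos ((hp r hr).2 h), mul_one, indicator_of_mem (mem_Iio.2 h)]
    · rw [if_neg (fun h' => h ((hp r hr).1 h')), mul_zero, indicator_of_notMem (by simpa using h)]
  rw [setLIntegral_congr_fun measurableSet_Ioi h1, lintegral_indicator measurableSet_Iio,
    Measure.restrict_restrict measurableSet_Iio, Iio_inter_Ioi,
    intervalIntegral.integral_of_le ha.le, integral_Ioc_eq_integral_Ioo, ofReal_integral_eq_lintegral_ofReal]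
  · refine Integrable.mono' (g := fun _ => a) (integrable_const a)
      (hw.mul measurable_id).aestronglyMeasurable ?_
    refine (ae_restrict_iff' measurableSet_Ioo).2 (Filter.Eventually.of_forall fun r hr => ?_)
    rw [Real.norm_of_nonneg (mul_nonneg (hw0 r) hr.1.le)]
    nlinarith [hw0 r, hw1 r, hr.1, hr.2]
  · refine (ae_restrict_iff' measurableSet_Ioo).2 (Filter.Eventually.of_forall fun r hr => ?_)
    exact mul_nonneg (hw0 r) hr.1.le

lemma mix_add {G H : ℝ → ℝ≥0∞} (hG : Measurable G) (hH : Measurable H) :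
    s.mix (fun l => G l + H l) = s.mix G + s.mix H := by
  have hGH : Measurable fun l => G l + H l := hG.add hH
  rw [mix_eq s hGH, mix_eq s hG, mix_eq s hH, ← lintegral_add_left]
  · simp_rw [mul_add]
  · exact s.measurable_lossRate.ennreal_ofReal.mul hG

lemma mix_const_mul {G : ℝ → ℝ≥0∞} (hG : Measurable G) (c : ℝ≥0∞) :
    s.mix (fun l => c * G l) = c * s.mix G := by
  have hm : Measurable fun l => ENNReal.ofReal (s.lossRate l) * G l :=
    s.measurable_lossRate.ennreal_ofReal.mul hG
  rw [mix_eq s (hG.const_mul c), mix_eq s hG, ← lintegral_const_mul _ hm]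
  simp_rw [mul_left_comm c]

open Classical in
/-- The mean number of path losses below `z`. -/
lemma mix_lt {z : ℝ} (hz : 0 < z) :
    s.mix (fun l => if l < z then 1 else 0) =
      ENNReal.ofReal (∫ r in (0 : ℝ)..s.invL z, s.h r * r) +
        ENNReal.ofReal (∫ r in (0 : ℝ)..s.invN z, (1 - s.h r) * r) := by
  have hm : Measurable fun l : ℝ => if l < z then (1 : ℝ≥0∞) else 0 :=
    Measurable.ite measurableSet_Iio measurable_const measurable_const
  rw [mix_eq_add s hm]
  congr 1
  · exact lintegral_Ioi_lt s.h s.h_meas s.h_nonneg s.h_le_one (s.invL_pos hz)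
      fun r hr => s.lt_invL_iff hr hz
  · exact lintegral_Ioi_lt (fun r => 1 - s.h r) (measurable_const.sub s.h_meas)
      (fun r => sub_nonneg.2 (s.h_le_one r)) (fun r => by linarith [s.h_nonneg r]) (s.invN_pos hz)
      fun r hr => s.lt_invN_iff hr hz

lemma lintegral_ofReal_mul {w : ℝ} (hw : 0 ≤ w) {r c l : ℝ} (hr : 0 < r) :
    ENNReal.ofReal (w * r) * ENNReal.ofReal (c / (c + l)) = ENNReal.ofReal (c * w * r / (c + l)) := by
  rw [← ENNReal.ofReal_mul (by positivity)]
  congr 1; ring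

/-- The exponent in the function `U`. -/
lemma mix_ratio {c : ℝ} :
    s.mix (fun l => ENNReal.ofReal (c / (c + l))) =
      (∫⁻ r in Ioi (0 : ℝ), ENNReal.ofReal (c * s.h r * r / (c + s.lossL r))) +
        ∫⁻ r in Ioi (0 : ℝ), ENNReal.ofReal (c * (1 - s.h r) * r / (c + s.lossN r)) := by
  have hm : Measurable fun l : ℝ => ENNReal.ofReal (c / (c + l)) :=
    (measurable_const.div (measurable_const.add measurable_id)).ennreal_ofReal
  rw [mix_eq_add s hm]
  congr 1
  · exact setLIntegral_congr_fun measurableSet_Ioi fun r hr => lintegral_ofReal_mul (s.h_nonneg r) hr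
  · exact setLIntegral_congr_fun measurableSet_Ioi fun r hr =>
      lintegral_ofReal_mul (sub_nonneg.2 (s.h_le_one r)) hr

lemma lintegral_Ioi_gt (G H : ℝ → ℝ≥0∞) (w : ℝ → ℝ) {a : ℝ} (ha : 0 < a) {p : ℝ → Prop}
    [DecidablePred p] (hp : ∀ r, 0 < r → (p r ↔ a < r))
    (hG : ∀ r, 0 < r → ENNReal.ofReal (w r) * G r = H r) :
    ∫⁻ r in Ioi (0 : ℝ), ENNReal.ofReal (w r) * (if p r then G r else 0) = ∫⁻ r in Ioi a, H r := by
  have h1 : ∀ r ∈ Ioi (0 : ℝ), ENNReal.ofReal (w r) * (if p r then G r else 0) =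
      (Ioi a).indicator H r := by
    intro r hr
    by_cases h : a < r
    · rw [if_pos ((hp r hr).2 h), hG r hr, indicator_of_mem (mem_Ioi.2 h)]
    · rw [if_neg (fun h' => h ((hp r hr).1 h')), mul_zero, indicator_of_notMem (by simpa using h)]
  rw [setLIntegral_congr_fun measurableSet_Ioi h1, lintegral_indicator measurableSet_Ioi,
    Measure.restrict_restrict measurableSet_Ioi, Ioi_inter_Ioi, sup_of_le_left ha.le]

open Classical in
/-- The exponent in the function `V`. -/
lemma mix_gt_ratio {c z : ℝ} (hz : 0 < z) :
    s.mix (fun l => if z < l then ENNReal.ofReal (c / (c + l)) else 0) =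
      (∫⁻ r in Ioi (s.invL z), ENNReal.ofReal (c * s.h r * r / (c + s.lossL r))) +
        ∫⁻ r in Ioi (s.invN z), ENNReal.ofReal (c * (1 - s.h r) * r / (c + s.lossN r)) := by
  have hm : Measurable fun l : ℝ => if z < l then ENNReal.ofReal (c / (c + l)) else 0 :=
    Measurable.ite measurableSet_Ioi
      (measurable_const.div (measurable_const.add measurable_id)).ennreal_ofReal measurable_const
  rw [mix_eq_add s hm]
  congr 1
  · exact lintegral_Ioi_gt _ _ (fun r => s.h r * r) (s.invL_pos hz) (fun r hr => s.invL_lt_iff hr hz)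
      fun r hr => lintegral_ofReal_mul (s.h_nonneg r) hr
  · exact lintegral_Ioi_gt _ _ (fun r => (1 - s.h r) * r) (s.invN_pos hz)
      (fun r hr => s.invN_lt_iff hr hz)
      fun r hr => lintegral_ofReal_mul (sub_nonneg.2 (s.h_le_one r)) hr

end Network

/-! ### The marked process of base stations -/

variable (s : Network)

/-- The intensity measure of the marked base stations. -/
def bsMeasure : Measure BS :=
  ENNReal.ofReal s.lamB • (volume : Measure ℂ).prod (unitUniform.prod (expMeasure 1))

lemma sigmaFinite_smul {α : Type*} [MeasurableSpace α] {c : ℝ≥0∞} (μ : Measure α) [SigmaFinite μ]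
    (hc : c ≠ ∞) : SigmaFinite (c • μ) := by
  lift c to ℝ≥0 using hc
  exact inferInstanceAs (SigmaFinite (c • μ))

instance : SigmaFinite (bsMeasure s) := by
  unfold bsMeasure
  exact sigmaFinite_smul _ ENNReal.ofReal_ne_top

lemma measurable_bsLoss : Measurable (Cycle.bsLoss s) :=
  s.measurable_loss.comp (measurable_fst.norm.prodMk (measurable_fst.comp measurable_snd))

/-- The `j`-th of `k` sectors, as a set of marked base stations. -/
def bsSector (k j : ℕ) : Set BS := {p | p.1 ∈ beam 0 k j}

lemma measurableSet_bsSector {k j : ℕ} (hj : j < k) : MeasurableSet (bsSector k j) :=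
  measurable_fst (measurableSet_beam_zero hj)

/-- Only path loss and fading of a base station matter, so a sector is the fraction `1 / k` of the
plane. -/
lemma lintegral_bsMeasure {f : ℝ → ℝ → ℝ≥0∞} (hf : Measurable (Function.uncurry f)) {k j : ℕ}
    (hj : j < k) :
    ∫⁻ p in bsSector k j, f (Cycle.bsLoss s p) p.2.2 ∂bsMeasure s =
      ENNReal.ofReal (2 * Real.pi * s.lamB / k) * s.mix (fun l => ∫⁻ F, f l F ∂expMeasure 1) := by
  have hm : Measurable fun p : BS => f (Cycle.bsLoss s p) p.2.2 :=
    hf.comp ((measurable_bsLoss s).prodMk (measurable_snd.comp measurable_snd))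
  have hS : bsSector k j = beam 0 k j ×ˢ univ := by ext; simp [bsSector]
  have hG : Measurable fun l => ∫⁻ F, f l F ∂expMeasure 1 := Measurable.lintegral_prod_right' hf
  rw [bsMeasure, Measure.restrict_smul, lintegral_smul_measure, hS, ← Measure.prod_restrict,
    Measure.restrict_univ, lintegral_prod _ hm.aemeasurable]
  have h1 : ∀ x : ℂ, ∫⁻ y, f (Cycle.bsLoss s (x, y)) (x, y).2.2 ∂unitUniform.prod (expMeasure 1) =
      ∫⁻ u, ∫⁻ F, f (s.loss ‖x‖ u) F ∂expMeasure 1 ∂unitUniform := by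
    intro x
    exact lintegral_prod (fun y : ℝ × ℝ => f (s.loss ‖x‖ y.1) y.2)
      (hm.comp measurable_prodMk_left).aemeasurable
  simp_rw [h1]
  have h2 := s.lintegral_loss_beam hj hG
  rw [h2, smul_eq_mul, ← mul_assoc, ← ENNReal.ofReal_mul s.lamB_pos.le]
  congr 2; ring

/-- No path loss is charged, hence almost surely no two base stations have the same path loss. -/
lemma bsMeasure_level (z : ℝ) : bsMeasure s {q | Cycle.bsLoss s q = z} = 0 := by
  have hms : MeasurableSet {q : BS | Cycle.bsLoss s q = z} :=
    measurable_bsLoss s (measurableSet_singleton z)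
  have hG : Measurable ((({z} : Set ℝ)).indicator (1 : ℝ → ℝ≥0∞)) :=
    measurable_one.indicator (measurableSet_singleton z)
  rw [← lintegral_indicator_one hms, bsMeasure, lintegral_smul_measure]
  have hm : Measurable ({q : BS | Cycle.bsLoss s q = z}.indicator (1 : BS → ℝ≥0∞)) :=
    measurable_one.indicator hms
  rw [lintegral_prod _ hm.aemeasurable]
  have h1 : ∀ x : ℂ, ∫⁻ y, {q : BS | Cycle.bsLoss s q = z}.indicator (1 : BS → ℝ≥0∞) (x, y)
      ∂unitUniform.prod (expMeasure 1) =
      ∫⁻ u, (({z} : Set ℝ)).indicator (1 : ℝ → ℝ≥0∞) (s.loss ‖x‖ u) ∂unitUniform := by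
    intro x
    rw [lintegral_prod (fun y => {q : BS | Cycle.bsLoss s q = z}.indicator (1 : BS → ℝ≥0∞) (x, y))
      (hm.comp measurable_prodMk_left).aemeasurable]
    refine lintegral_congr fun u => ?_
    have : ∀ F : ℝ, {q : BS | Cycle.bsLoss s q = z}.indicator (1 : BS → ℝ≥0∞) (x, u, F) =
        (({z} : Set ℝ)).indicator (1 : ℝ → ℝ≥0∞) (s.loss ‖x‖ u) := fun F => rfl
    simp_rw [this]
    simp
  simp_rw [h1]
  rw [s.lintegral_loss_plane hG, s.mix_eq hG]
  have : ∀ z', ENNReal.ofReal (s.lossRate z') * (({z} : Set ℝ)).indicator (1 : ℝ → ℝ≥0∞) z' =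
      (({z} : Set ℝ)).indicator (fun z' => ENNReal.ofReal (s.lossRate z')) z' := by
    intro z'
    by_cases h : z' ∈ ({z} : Set ℝ) <;> simp [h]
  simp_rw [this]
  rw [lintegral_indicator (measurableSet_singleton z), Measure.restrict_restrict (measurableSet_singleton z),
    setLIntegral_measure_zero]
  · simp
  · exact measure_mono_null inter_subset_left (measure_singleton z)

end MmWave

namespace MmWave

/-! ### Detection in one sector -/

section kernel

variable {E : Type*} [MeasurableSpace E]

lemma measurable_lintegral_locKernel (μ : Measure E) [SigmaFinite μ] {X : Type*} [MeasurableSpace X]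
    {g : X → Measure E} (hg : Measurable g) {f : X × E → ℝ≥0∞} (hf : Measurable f) :
    Measurable fun x => ∫⁻ q, f (x, q) ∂locKernel μ (g x) :=
  Measurable.lintegral_kernel_prod_right' (κ := (locKernel μ).comap g hg) hf

lemma measurable_locKernel_apply (μ : Measure E) [SigmaFinite μ] {X : Type*} [MeasurableSpace X]
    {g : X → Measure E} (hg : Measurable g) {T : Set (X × E)} (hT : MeasurableSet T) :
    Measurable fun x => locKernel μ (g x) {q | (x, q) ∈ T} :=
  Kernel.measurable_kernel_prodMk_left (κ := (locKernel μ).comap g hg) hT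

end kernel

variable (s : Network)

lemma Network.Kcs_pos : 0 < s.Kcs := lt_max_of_lt_left s.Mcs_pos

lemma Network.mainGain_pos {n : ℕ} (hn : 0 < n) : 0 < s.mainGain (2 * Real.pi / n) := by
  have hpi := Real.pi_pos
  have hC := s.C0_pos
  have hn' : (0 : ℝ) < n := by exact_mod_cast hn
  unfold Network.mainGain
  split_ifs with h
  · exact one_pos
  · have h1 : 2 * Real.pi / n < 2 * Real.pi := by
      refine lt_of_le_of_ne (div_le_self (by positivity) (by exact_mod_cast hn)) h
    have h2 : 0 < 2 * Real.pi - 2 * Real.pi / n := by linarith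
    positivity

/-- The normalized noise power in cell search. -/
def csNoise : ℝ := s.noise / (s.Pb * s.Mcs * s.mainGain (2 * Real.pi / s.Ncs))

lemma csNoise_nonneg : 0 ≤ csNoise s := by
  have h1 := s.mainGain_pos s.Ncs_pos
  have h2 := s.Pb_pos
  have h3 := s.noise_nonneg
  unfold csNoise
  positivity

/-- The interference of the base stations of `N` of path loss larger than `z`. -/
def csInterference (z : ℝ) (N : Measure BS) : ℝ≥0∞ :=
  ∫⁻ q in {q | z < Cycle.bsLoss s q}, ENNReal.ofReal (q.2.2 / Cycle.bsLoss s q) ∂N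

/-- The event that a base station of path loss `x.1.1` and fading `x.1.2` has the smallest path loss
and is detected, if the base stations of its sector are given by `x.2`. The kernel `locKernel` stands
for `x.2` in order to have a measurable set. -/
def detSet : Set ((ℝ × ℝ) × Measure BS) :=
  {x | locKernel (bsMeasure s) x.2 {q | Cycle.bsLoss s q < x.1.1} = 0 ∧
    ENNReal.ofReal s.Gcs ≤ ENNReal.ofReal (x.1.2 / x.1.1) /
      (csInterference s x.1.1 (locKernel (bsMeasure s) x.2) + ENNReal.ofReal (csNoise s))}

lemma measurable_bsRatio : Measurable fun q : BS => ENNReal.ofReal (q.2.2 / Cycle.bsLoss s q) :=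
  ((measurable_snd.comp measurable_snd).div (measurable_bsLoss s)).ennreal_ofReal

lemma measurableSet_detSet : MeasurableSet (detSet s) := by
  have hb : Measurable fun x : ((ℝ × ℝ) × Measure BS) × BS => Cycle.bsLoss s x.2 :=
    (measurable_bsLoss s).comp measurable_snd
  have hz : Measurable fun x : ((ℝ × ℝ) × Measure BS) × BS => x.1.1.1 :=
    measurable_fst.comp (measurable_fst.comp measurable_fst)
  have h1 : Measurable fun x : (ℝ × ℝ) × Measure BS =>
      locKernel (bsMeasure s) x.2 {q | Cycle.bsLoss s q < x.1.1} :=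
    measurable_locKernel_apply (bsMeasure s) measurable_snd
      (T := {x : ((ℝ × ℝ) × Measure BS) × BS | Cycle.bsLoss s x.2 < x.1.1.1}) (measurableSet_lt hb hz)
  have h2 : Measurable fun x : (ℝ × ℝ) × Measure BS =>
      csInterference s x.1.1 (locKernel (bsMeasure s) x.2) := by
    have h3 := measurable_lintegral_locKernel (bsMeasure s) (X := (ℝ × ℝ) × Measure BS)
      (g := Prod.snd) measurable_snd
      (f := {x : ((ℝ × ℝ) × Measure BS) × BS | x.1.1.1 < Cycle.bsLoss s x.2}.indicator
        fun x => ENNReal.ofReal (x.2.2.2 / Cycle.bsLoss s x.2))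
      (((measurable_bsRatio s).comp measurable_snd).indicator (measurableSet_lt hz hb))
    have e : (fun x : (ℝ × ℝ) × Measure BS =>
        csInterference s x.1.1 (locKernel (bsMeasure s) x.2)) =
        fun x => ∫⁻ q, ({x : ((ℝ × ℝ) × Measure BS) × BS | x.1.1.1 < Cycle.bsLoss s x.2}.indicator
          (fun x => ENNReal.ofReal (x.2.2.2 / Cycle.bsLoss s x.2))) (x, q)
            ∂locKernel (bsMeasure s) x.2 := by
      funext x
      rw [csInterference, ← lintegral_indicator (measurableSet_lt measurable_const
        (measurable_bsLoss s))]
      rfl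
    rw [e]
    exact h3
  have h4 : Measurable fun x : (ℝ × ℝ) × Measure BS => ENNReal.ofReal (x.1.2 / x.1.1) /
      (csInterference s x.1.1 (locKernel (bsMeasure s) x.2) + ENNReal.ofReal (csNoise s)) :=
    ((measurable_snd.comp measurable_fst).div
      (measurable_fst.comp measurable_fst)).ennreal_ofReal.div (h2.add_const _)
  have h5 : MeasurableSet {x : (ℝ × ℝ) × Measure BS | ENNReal.ofReal s.Gcs ≤
      ENNReal.ofReal (x.1.2 / x.1.1) /
      (csInterference s x.1.1 (locKernel (bsMeasure s) x.2) + ENNReal.ofReal (csNoise s))} :=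
    measurableSet_le measurable_const h4
  exact (h1 (measurableSet_singleton 0)).inter h5

lemma csInterference_eq {z : ℝ} {S : Set BS} (hS : MeasurableSet S) (N : Measure BS) :
    csInterference s z (N.restrict S) =
      ∫⁻ q, (S ∩ {q | z < Cycle.bsLoss s q}).indicator
        (fun q => ENNReal.ofReal (q.2.2 / Cycle.bsLoss s q)) q ∂N := by
  have hm : MeasurableSet {q | z < Cycle.bsLoss s q} :=
    measurableSet_lt measurable_const (measurable_bsLoss s)
  rw [csInterference, Measure.restrict_restrict hm, lintegral_indicator (hS.inter hm), inter_comm]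

/-- The threshold condition solved for the fading. For positive fading it also holds without
interference and noise, where both sides are true. -/
lemma ae_fading_iff {z : ℝ} (hz : 0 < z) (D : ℝ≥0∞) :
    ∀ᵐ F ∂expMeasure 1, ENNReal.ofReal s.Gcs ≤ ENNReal.ofReal (F / z) / D ↔
      ENNReal.ofReal (s.Gcs * z) * D ≤ ENNReal.ofReal F := by
  filter_upwards [ae_expMeasure_pos] with F hF
  have h1 : ENNReal.ofReal (F / z) ≠ 0 := by simpa using div_pos hF hz
  have hz0 : ENNReal.ofReal z ≠ 0 := by simpa using hz
  rw [ENNReal.le_div_iff_mul_le (Or.inr h1) (Or.inr ENNReal.ofReal_ne_top),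
    ENNReal.ofReal_div_of_pos hz,
    ENNReal.le_div_iff_mul_le (Or.inl hz0) (Or.inl ENNReal.ofReal_ne_top),
    ENNReal.ofReal_mul s.Gcs_pos.le, mul_right_comm]

/-- Integrating over the fading of the base station turns the probability of detection into a
Laplace transform; the event that there is no base station closer in path loss enters as the factor
`exp (-∞ · N)`. -/
lemma expMeasure_detSet {z : ℝ} (hz : 0 < z) {S : Set BS} (hS : MeasurableSet S) {N : Measure BS}
    (hN : N ∈ locFinite (bsMeasure s)) :
    expMeasure 1 {F | ((z, F), N.restrict S) ∈ detSet s} =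
      eNeg (∫⁻ q, (∞ * (S ∩ {q | Cycle.bsLoss s q < z}).indicator 1 q +
          ENNReal.ofReal (s.Gcs * z) * (S ∩ {q | z < Cycle.bsLoss s q}).indicator
            (fun q => ENNReal.ofReal (q.2.2 / Cycle.bsLoss s q)) q) ∂N) *
        eNeg (ENNReal.ofReal (s.Gcs * z * csNoise s)) := by
  have hlt : MeasurableSet {q | Cycle.bsLoss s q < z} :=
    measurableSet_lt (measurable_bsLoss s) measurable_const
  have hgt : MeasurableSet {q | z < Cycle.bsLoss s q} :=
    measurableSet_lt measurable_const (measurable_bsLoss s)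
  have hG : 0 ≤ s.Gcs * z := mul_nonneg s.Gcs_pos.le hz.le
  have hmg : Measurable ((S ∩ {q | z < Cycle.bsLoss s q}).indicator
      fun q : BS => ENNReal.ofReal (q.2.2 / Cycle.bsLoss s q)) :=
    (measurable_bsRatio s).indicator (hS.inter hgt)
  have hml : Measurable ((S ∩ {q | Cycle.bsLoss s q < z}).indicator (1 : BS → ℝ≥0∞)) :=
    measurable_one.indicator (hS.inter hlt)
  rw [lintegral_add_left (hml.const_mul _), lintegral_const_mul _ hml, lintegral_const_mul _ hmg,
    lintegral_indicator_one (hS.inter hlt), ← csInterference_eq s hS N]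
  simp only [detSet, mem_ofPred_eq, locKernel_restrict hN]
  rw [Measure.restrict_apply hlt, inter_comm _ S]
  by_cases h0 : N (S ∩ {q | Cycle.bsLoss s q < z}) = 0
  · simp only [h0, true_and, mul_zero, zero_add]
    rw [measure_congr (t := {F : ℝ | ENNReal.ofReal (s.Gcs * z) * (csInterference s z (N.restrict S) +
      ENNReal.ofReal (csNoise s)) ≤ ENNReal.ofReal F}), expMeasure_tail, mul_add, eNeg_add,
      ← ENNReal.ofReal_mul hG]
    filter_upwards [ae_fading_iff s hz (csInterference s z (N.restrict S) +
      ENNReal.ofReal (csNoise s))] with F hF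
    exact propext hF
  · simp [h0, ENNReal.top_mul, eNeg_top]

/-- The contribution of an interferer of path loss `l` to the exponent of the Laplace functional, after
integration over its fading. -/
lemma lintegral_one_sub_eNeg {l : ℝ} (hl : 0 < l) {c : ℝ} (hc : 0 ≤ c) :
    ∫⁻ F, (1 - eNeg (ENNReal.ofReal c * ENNReal.ofReal (F / l))) ∂expMeasure 1 =
      ENNReal.ofReal (c / (c + l)) := by
  have h1 : ∀ F : ℝ, ENNReal.ofReal c * ENNReal.ofReal (F / l) = ENNReal.ofReal (F * (c / l)) := by
    intro F
    rw [← ENNReal.ofReal_mul hc]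
    congr 1; ring
  simp_rw [h1]
  have hm : Measurable fun F : ℝ => eNeg (ENNReal.ofReal (F * (c / l))) :=
    measurable_eNeg.comp (measurable_id.mul_const _).ennreal_ofReal
  have hcl : 0 ≤ c / l := by positivity
  rw [lintegral_sub hm, lintegral_expMeasure_eNeg hcl, lintegral_one, measure_univ,
    ← ENNReal.ofReal_one, ← ENNReal.ofReal_sub _ (by positivity)]
  · congr 1; field_simp; ring
  · rw [lintegral_expMeasure_eNeg hcl]; exact ENNReal.ofReal_ne_top
  · exact Filter.Eventually.of_forall fun F => eNeg_le_one _

variable {Q : Measure (Measure BS)}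

/-- The probability, also over its fading, that a base station of path loss `z` has the smallest path
loss of its sector and is detected. -/
lemma lintegral_detSet (hQ : IsPoissonLaw Q (bsMeasure s)) (j : Fin s.Kcs) {z : ℝ} (hz : 0 < z) :
    ∫⁻ F, Q {N | ((z, F), N.restrict (bsSector s.Kcs j)) ∈ detSet s} ∂expMeasure 1 =
      ENNReal.ofReal (s.condDetect z *
        (Real.exp (-s.sectorRate * ∫ r in (0 : ℝ)..s.invL z, s.h r * r) *
          Real.exp (-s.sectorRate * ∫ r in (0 : ℝ)..s.invN z, (1 - s.h r) * r))) := by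
  classical
  have := hQ.isProbabilityMeasure
  have hS := measurableSet_bsSector j.2
  set S := bsSector s.Kcs j with hSdef
  have hlt : MeasurableSet {q | Cycle.bsLoss s q < z} :=
    measurableSet_lt (measurable_bsLoss s) measurable_const
  have hgt : MeasurableSet {q | z < Cycle.bsLoss s q} :=
    measurableSet_lt measurable_const (measurable_bsLoss s)
  have hT : MeasurableSet {x : ℝ × Measure BS | ((z, x.1), x.2.restrict S) ∈ detSet s} :=
    ((measurable_const.prodMk measurable_fst).prodMk
      ((measurable_restrict hS).comp measurable_snd)) (measurableSet_detSet s)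
  have e1 : ∫⁻ F, Q {N | ((z, F), N.restrict S) ∈ detSet s} ∂expMeasure 1 =
      ∫⁻ N, expMeasure 1 {F | ((z, F), N.restrict S) ∈ detSet s} ∂Q := by
    have h1 := Measure.prod_apply (μ := expMeasure 1) (ν := Q) hT
    have h2 := Measure.prod_apply_symm (μ := expMeasure 1) (ν := Q) hT
    exact h1.symm.trans h2
  rw [e1, lintegral_congr_ae (hQ.ae_mem_locFinite.mono fun N hN => expMeasure_detSet s hz hS hN),
    lintegral_mul_const' _ _ (by simp [eNeg])]
  have hf : Measurable fun q : BS => ∞ * (S ∩ {q | Cycle.bsLoss s q < z}).indicator 1 q +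
      ENNReal.ofReal (s.Gcs * z) * (S ∩ {q | z < Cycle.bsLoss s q}).indicator
        (fun q => ENNReal.ofReal (q.2.2 / Cycle.bsLoss s q)) q :=
    ((measurable_one.indicator (hS.inter hlt)).const_mul _).add
      (((measurable_bsRatio s).indicator (hS.inter hgt)).const_mul _)
  rw [hQ.lintegral_eNeg hf]
  -- the integrand of the Laplace functional: a base station of path loss below `z` counts fully, one
  -- above `z` through its interference
  let φ : ℝ → ℝ → ℝ≥0∞ := fun l F => (if l < z then 1 else 0) +
    if z < l then 1 - eNeg (ENNReal.ofReal (s.Gcs * z) * ENNReal.ofReal (F / l)) else 0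
  have hφ : Measurable (Function.uncurry φ) := by
    refine Measurable.add (Measurable.ite (measurableSet_lt measurable_fst measurable_const)
      measurable_const measurable_const) (Measurable.ite (measurableSet_lt measurable_const
        measurable_fst) ?_ measurable_const)
    exact measurable_const.sub (measurable_eNeg.comp
      ((measurable_snd.div measurable_fst).ennreal_ofReal.const_mul _))
  have e2 : ∫⁻ q, (1 - eNeg (∞ * (S ∩ {q | Cycle.bsLoss s q < z}).indicator 1 q +
      ENNReal.ofReal (s.Gcs * z) * (S ∩ {q | z < Cycle.bsLoss s q}).indicator
        (fun q => ENNReal.ofReal (q.2.2 / Cycle.bsLoss s q)) q)) ∂bsMeasure s =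
      ∫⁻ q in S, φ (Cycle.bsLoss s q) q.2.2 ∂bsMeasure s := by
    rw [← lintegral_indicator hS]
    refine lintegral_congr fun q => ?_
    by_cases hq : q ∈ S
    · rw [indicator_of_mem hq]
      rcases lt_trichotomy (Cycle.bsLoss s q) z with h | h | h
      · simp [φ, hq, h, h.not_gt, eNeg_top]
      · simp [φ, h, eNeg_zero]
      · simp [φ, hq, h, h.not_gt]
    · simp [hq, eNeg_zero]
  rw [e2, lintegral_bsMeasure s hφ j.2]
  have hGz : 0 ≤ s.Gcs * z := mul_nonneg s.Gcs_pos.le hz.le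
  have e3 : ∀ l : ℝ, ∫⁻ F, φ l F ∂expMeasure 1 = (if l < z then 1 else 0) +
      if z < l then ENNReal.ofReal (s.Gcs * z / (s.Gcs * z + l)) else 0 := by
    intro l
    simp only [φ]
    rw [lintegral_add_left measurable_const]
    congr 1
    · simp
    · split_ifs with h
      · exact lintegral_one_sub_eNeg (hz.trans h) hGz
      · simp
  simp_rw [e3]
  have hA : Measurable fun l : ℝ => if l < z then (1 : ℝ≥0∞) else 0 :=
    Measurable.ite measurableSet_Iio measurable_const measurable_const
  have hB : Measurable fun l : ℝ =>
      if z < l then ENNReal.ofReal (s.Gcs * z / (s.Gcs * z + l)) else 0 :=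
    Measurable.ite measurableSet_Ioi
      (measurable_const.div (measurable_const.add measurable_id)).ennreal_ofReal measurable_const
  rw [s.mix_add hA hB, s.mix_lt hz, s.mix_gt_ratio hz, mul_add, eNeg_add, mul_add, eNeg_add]
  have hrate : 0 ≤ s.sectorRate := by
    have := s.lamB_pos; have := Real.pi_pos
    unfold Network.sectorRate; positivity
  have hint : ∀ (w : ℝ → ℝ), (∀ r, 0 ≤ w r) → ∀ a, 0 < a → 0 ≤ ∫ r in (0 : ℝ)..a, w r * r :=
    fun w hw a ha => intervalIntegral.integral_nonneg ha.le fun r hr => mul_nonneg (hw r) hr.1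
  have e4 : ∀ a : ℝ, 0 ≤ a → eNeg (ENNReal.ofReal (2 * Real.pi * s.lamB / s.Kcs) * ENNReal.ofReal a) =
      ENNReal.ofReal (Real.exp (-s.sectorRate * a)) := by
    intro a ha
    rw [show 2 * Real.pi * s.lamB / s.Kcs = s.sectorRate from rfl, ← ENNReal.ofReal_mul hrate, eNeg,
      expNeg_ofReal (mul_nonneg hrate ha), neg_mul]
  rw [e4 _ (hint _ s.h_nonneg _ (s.invL_pos hz)),
    e4 _ (hint _ (fun r => sub_nonneg.2 (s.h_le_one r)) _ (s.invN_pos hz))]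
  have e5 : 2 * Real.pi * s.lamB / s.Kcs = 2 * Real.pi * (s.lamB / s.Kcs) := by ring
  have hV : eNeg (ENNReal.ofReal (2 * Real.pi * s.lamB / s.Kcs) *
      ((∫⁻ r in Ioi (s.invL z), ENNReal.ofReal (s.Gcs * z * s.h r * r / (s.Gcs * z + s.lossL r))) +
        ∫⁻ r in Ioi (s.invN z), ENNReal.ofReal (s.Gcs * z * (1 - s.h r) * r / (s.Gcs * z + s.lossN r)))) =
      ENNReal.ofReal (s.V z s.Gcs (s.lamB / s.Kcs)) := by
    rw [e5]; rfl
  rw [hV, eNeg, expNeg_ofReal (mul_nonneg hGz (csNoise_nonneg s)), ← ENNReal.ofReal_mul (by positivity),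
    ← ENNReal.ofReal_mul (by positivity), ← ENNReal.ofReal_mul]
  · congr 1
    rw [Network.condDetect, show s.Gcs * z * s.noise / (s.Pb * s.Mcs * s.mainGain (2 * Real.pi / s.Ncs)) =
      s.Gcs * z * csNoise s by rw [csNoise]; ring]
    ring
  · exact mul_nonneg (by positivity) (expNeg_nonneg _)

/-- The mean number of detected base stations of a sector, as an integral over their path loss. -/
lemma lintegral_detection (hQ : IsPoissonLaw Q (bsMeasure s)) (j : Fin s.Kcs) {G : ℝ → ℝ≥0∞}
    (hG : Measurable G) :
    ∫⁻ p in bsSector s.Kcs j, G (Cycle.bsLoss s p) *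
        Q {N | ((Cycle.bsLoss s p, p.2.2), N.restrict (bsSector s.Kcs j)) ∈ detSet s} ∂bsMeasure s =
      ∫⁻ z in Ioi (0 : ℝ), G z * ENNReal.ofReal (s.condDetect z * s.minLossDensity z) := by
  have := hQ.isProbabilityMeasure
  have hS := measurableSet_bsSector j.2
  set S := bsSector s.Kcs j with hSdef
  have hT : MeasurableSet {x : (ℝ × ℝ) × Measure BS | (x.1, x.2.restrict S) ∈ detSet s} :=
    (measurable_fst.prodMk ((measurable_restrict hS).comp measurable_snd)) (measurableSet_detSet s)
  have hH : Measurable fun x : ℝ × ℝ => Q {N | (x, N.restrict S) ∈ detSet s} :=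
    measurable_measure_prodMk_left hT
  let f : ℝ → ℝ → ℝ≥0∞ := fun l F => G l * Q {N | ((l, F), N.restrict S) ∈ detSet s}
  have hf : Measurable (Function.uncurry f) := (hG.comp measurable_fst).mul hH
  have hint : Measurable fun l => ∫⁻ F, f l F ∂expMeasure 1 := Measurable.lintegral_prod_right' hf
  refine (lintegral_bsMeasure s hf j.2).trans ?_
  have hm2 : Measurable fun z => ENNReal.ofReal (s.lossRate z) * ∫⁻ F, f z F ∂expMeasure 1 :=
    s.measurable_lossRate.ennreal_ofReal.mul hint
  rw [s.mix_eq hint, ← lintegral_const_mul _ hm2]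
  refine setLIntegral_congr_fun measurableSet_Ioi fun z hz => ?_
  have hz0 : 0 < z := hz
  have h1 : ∫⁻ F, f z F ∂expMeasure 1 = G z * ENNReal.ofReal (s.condDetect z *
        (Real.exp (-s.sectorRate * ∫ r in (0 : ℝ)..s.invL z, s.h r * r) *
          Real.exp (-s.sectorRate * ∫ r in (0 : ℝ)..s.invN z, (1 - s.h r) * r))) := by
    simp only [f]
    have hm : Measurable fun F => Q {N | ((z, F), N.restrict S) ∈ detSet s} :=
      hH.comp measurable_prodMk_left
    rw [lintegral_const_mul _ hm, lintegral_detSet s hQ j hz0]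
  have hrate : 0 ≤ s.sectorRate := by
    have := s.lamB_pos; have := Real.pi_pos
    unfold Network.sectorRate; positivity
  have hcd : 0 ≤ s.condDetect z := mul_nonneg (Real.exp_pos _).le (expNeg_nonneg _)
  have hlr := s.lossRate_nonneg hz0
  rw [h1, show 2 * Real.pi * s.lamB / s.Kcs = s.sectorRate from rfl, mul_left_comm (ENNReal.ofReal _)
    (G z), mul_left_comm (ENNReal.ofReal _) (G z), ← mul_assoc (ENNReal.ofReal _),
    ← ENNReal.ofReal_mul hrate,
    ← ENNReal.ofReal_mul (mul_nonneg hrate hlr)]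
  congr 2
  rw [Network.minLossDensity, Network.lossRate]
  ring

end MmWave

namespace MmWave

/-! ### Cell search -/

variable (s : Network)

lemma restrict_add_dirac_of_mem {E : Type*} [MeasurableSpace E] {S : Set E} (hS : MeasurableSet S)
    {p : E} (hp : p ∈ S) (N : Measure E) :
    (N + Measure.dirac p).restrict S = N.restrict S + Measure.dirac p := by
  rw [Measure.restrict_add]
  congr 1
  ext A hA
  rw [Measure.restrict_apply hA, Measure.dirac_apply' _ hA, Measure.dirac_apply' _ (hA.inter hS)]
  by_cases h : p ∈ A <;> simp [h, hp]

lemma restrict_add_dirac_of_notMem {E : Type*} [MeasurableSpace E] {S : Set E}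
    (hS : MeasurableSet S) {p : E} (hp : p ∉ S) (N : Measure E) :
    (N + Measure.dirac p).restrict S = N.restrict S := by
  rw [Measure.restrict_add]
  convert add_zero _
  ext A hA
  rw [Measure.restrict_apply hA, Measure.dirac_apply' _ (hA.inter hS)]
  simp [hp]

/-- A base station does not influence its own detection. -/
lemma detSet_add_dirac {N : Measure BS} (hN : N ∈ locFinite (bsMeasure s)) (p : BS) (F : ℝ) :
    ((Cycle.bsLoss s p, F), N + Measure.dirac p) ∈ detSet s ↔
      ((Cycle.bsLoss s p, F), N) ∈ detSet s := by
  have hlt : MeasurableSet {q | Cycle.bsLoss s q < Cycle.bsLoss s p} :=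
    measurableSet_lt (measurable_bsLoss s) measurable_const
  have hgt : MeasurableSet {q | Cycle.bsLoss s p < Cycle.bsLoss s q} :=
    measurableSet_lt measurable_const (measurable_bsLoss s)
  simp only [detSet, mem_ofPred_eq, csInterference, locKernel_of_mem hN,
    locKernel_of_mem (add_dirac_mem_locFinite hN p)]
  rw [restrict_add_dirac_of_notMem hgt (by simp), Measure.add_apply, Measure.dirac_apply' _ hlt,
    indicator_of_notMem (by simp), add_zero]

/-- The number of base stations of `N` with path loss in `Z` that have the smallest path loss and are
detected. -/
def detCount (Z : Set ℝ) (N : Measure BS) : ℝ≥0∞ :=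
  locKernel (bsMeasure s) N
    {p | ((Cycle.bsLoss s p, p.2.2), N) ∈ detSet s ∧ Cycle.bsLoss s p ∈ Z}

lemma measurable_bsMark : Measurable fun x : Measure BS × BS =>
    ((Cycle.bsLoss s x.2, x.2.2.2), x.1) :=
  (((measurable_bsLoss s).comp measurable_snd).prodMk
    (measurable_snd.comp (measurable_snd.comp measurable_snd))).prodMk measurable_fst

lemma measurableSet_detected (N : Measure BS) :
    MeasurableSet {p : BS | ((Cycle.bsLoss s p, p.2.2), N) ∈ detSet s} :=
  ((measurable_bsMark s).comp measurable_prodMk_left) (measurableSet_detSet s)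

lemma measurable_detCount {Z : Set ℝ} (hZ : MeasurableSet Z) : Measurable (detCount s Z) := by
  have hT : MeasurableSet {x : Measure BS × BS |
      ((Cycle.bsLoss s x.2, x.2.2.2), x.1) ∈ detSet s ∧ Cycle.bsLoss s x.2 ∈ Z} :=
    ((measurable_bsMark s) (measurableSet_detSet s)).inter
      (((measurable_bsLoss s).comp measurable_snd) hZ)
  exact measurable_locKernel_apply (bsMeasure s) (g := id) measurable_id hT

lemma measurable_detCount_Iio :
    Measurable fun x : ℝ × Measure BS => detCount s (Iio x.1) x.2 := by
  have h : Measurable fun x : (ℝ × Measure BS) × BS => (x.1.2, x.2) :=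
    (measurable_snd.comp measurable_fst).prodMk measurable_snd
  have hT : MeasurableSet {x : (ℝ × Measure BS) × BS |
      ((Cycle.bsLoss s x.2, x.2.2.2), x.1.2) ∈ detSet s ∧ Cycle.bsLoss s x.2 < x.1.1} :=
    (((measurable_bsMark s).comp h) (measurableSet_detSet s)).inter
      (measurableSet_lt ((measurable_bsLoss s).comp measurable_snd)
        (measurable_fst.comp measurable_fst))
  exact measurable_locKernel_apply (bsMeasure s) (g := Prod.snd) measurable_snd hT

lemma detCount_restrict {N : Measure BS} (hN : N ∈ locFinite (bsMeasure s))
    (S : Set BS) {Z : Set ℝ} (hZ : MeasurableSet Z) :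
    detCount s Z (N.restrict S) =
      N ({p | ((Cycle.bsLoss s p, p.2.2), N.restrict S) ∈ detSet s ∧ Cycle.bsLoss s p ∈ Z} ∩ S) := by
  rw [detCount, locKernel_restrict hN, Measure.restrict_apply]
  exact (measurableSet_detected s _).inter ((measurable_bsLoss s) hZ)

section mecke

variable {Q : Measure (Measure BS)}

/-- Mecke's formula for the detected base stations of a sector; the functional `R` must not depend on
the base stations of that sector. -/
lemma mecke_detected (hQ : IsPoissonLaw Q (bsMeasure s)) (j : Fin s.Kcs)
    {R : ℝ × Measure BS → ℝ≥0∞} (hR : Measurable R)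
    (hR' : ∀ p ∈ bsSector s.Kcs j, ∀ N, R (Cycle.bsLoss s p, N + Measure.dirac p) =
      R (Cycle.bsLoss s p, N)) :
    ∫⁻ N, ∫⁻ p in {p | ((Cycle.bsLoss s p, p.2.2), N.restrict (bsSector s.Kcs j)) ∈ detSet s} ∩
        bsSector s.Kcs j, R (Cycle.bsLoss s p, N) ∂locKernel (bsMeasure s) N ∂Q =
      ∫⁻ p in bsSector s.Kcs j,
        ∫⁻ N in {N | ((Cycle.bsLoss s p, p.2.2), N.restrict (bsSector s.Kcs j)) ∈ detSet s},
          R (Cycle.bsLoss s p, N) ∂Q ∂bsMeasure s := by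
  have hS := measurableSet_bsSector j.2
  set S := bsSector s.Kcs j with hSdef
  let T : Set (BS × Measure BS) :=
    {x | ((Cycle.bsLoss s x.1, x.1.2.2), x.2.restrict S) ∈ detSet s}
  have hT : MeasurableSet T :=
    ((measurable_bsMark s).comp (((measurable_restrict hS).comp measurable_snd).prodMk
      measurable_fst)) (measurableSet_detSet s)
  have hS' : MeasurableSet {x : BS × Measure BS | x.1 ∈ S} := measurable_fst hS
  let Ψ : BS × Measure BS → ℝ≥0∞ :=
    (T ∩ {x | x.1 ∈ S}).indicator fun x => R (Cycle.bsLoss s x.1, x.2)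
  have hΨ : Measurable Ψ :=
    (hR.comp (((measurable_bsLoss s).comp measurable_fst).prodMk measurable_snd)).indicator
      (hT.inter hS')
  have key := hQ.mecke hΨ
  have e1 : ∀ N : Measure BS, ∫⁻ p, Ψ (p, N) ∂locKernel (bsMeasure s) N =
      ∫⁻ p in {p | ((Cycle.bsLoss s p, p.2.2), N.restrict S) ∈ detSet s} ∩ S,
        R (Cycle.bsLoss s p, N) ∂locKernel (bsMeasure s) N := by
    intro N
    rw [← lintegral_indicator ((measurableSet_detected s _).inter hS)]
    rfl
  simp_rw [e1] at key
  rw [key, ← lintegral_indicator hS]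
  refine lintegral_congr fun p => ?_
  by_cases hp : p ∈ S
  · have hT2 : MeasurableSet {N : Measure BS |
        ((Cycle.bsLoss s p, p.2.2), N.restrict S) ∈ detSet s} := measurable_prodMk_left hT
    rw [indicator_of_mem hp, ← lintegral_indicator hT2]
    refine lintegral_congr_ae ?_
    filter_upwards [hQ.ae_mem_locFinite] with N hN
    have h1 : (p, N + Measure.dirac p) ∈ T ∩ {x | x.1 ∈ S} ↔
        N ∈ {N : Measure BS | ((Cycle.bsLoss s p, p.2.2), N.restrict S) ∈ detSet s} := by
      refine (and_iff_left hp).trans ?_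
      change ((Cycle.bsLoss s p, p.2.2), (N + Measure.dirac p).restrict S) ∈ detSet s ↔ _
      rw [restrict_add_dirac_of_mem hS hp]
      exact detSet_add_dirac s (mem_locFinite_mono Measure.restrict_le_self hN) p _
    by_cases h : N ∈ {N : Measure BS | ((Cycle.bsLoss s p, p.2.2), N.restrict S) ∈ detSet s}
    · rw [indicator_of_mem h, ← hR' p hp N]
      exact indicator_of_mem (h1.2 h) _
    · rw [indicator_of_notMem h]
      exact indicator_of_notMem (fun h' => h (h1.1 h')) _
  · rw [indicator_of_notMem hp]
    refine (lintegral_congr fun N => ?_).trans lintegral_zero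
    exact indicator_of_notMem (fun h => hp h.2) _

/-- The mean number of base stations of a sector that are detected with a path loss in `Z`. -/
lemma lintegral_detCount (hQ : IsPoissonLaw Q (bsMeasure s)) (j : Fin s.Kcs) {Z : Set ℝ}
    (hZ : MeasurableSet Z) :
    ∫⁻ N, detCount s Z (N.restrict (bsSector s.Kcs j)) ∂Q =
      ∫⁻ z in Z ∩ Ioi 0, ENNReal.ofReal (s.condDetect z * s.minLossDensity z) := by
  have hS := measurableSet_bsSector j.2
  have hR : Measurable fun x : ℝ × Measure BS => Z.indicator (1 : ℝ → ℝ≥0∞) x.1 :=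
    (measurable_one.indicator hZ).comp measurable_fst
  have h1 := mecke_detected s hQ j hR fun _ _ _ => rfl
  have h2 := lintegral_detection s hQ j (G := Z.indicator 1) (measurable_one.indicator hZ)
  simp only [lintegral_const, Measure.restrict_apply_univ] at h1
  rw [h2] at h1
  have h3 : ∫⁻ z in Ioi (0 : ℝ), Z.indicator 1 z *
      ENNReal.ofReal (s.condDetect z * s.minLossDensity z) =
      ∫⁻ z in Z ∩ Ioi 0, ENNReal.ofReal (s.condDetect z * s.minLossDensity z) := by
    rw [← Measure.restrict_restrict hZ, ← lintegral_indicator hZ]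
    refine lintegral_congr fun z => ?_
    by_cases hz : z ∈ Z <;> simp [hz]
  rw [← h3, ← h1]
  refine lintegral_congr_ae ?_
  filter_upwards [hQ.ae_mem_locFinite] with N hN
  have hDm := measurableSet_detected s (N.restrict (bsSector s.Kcs j))
  have hZm : MeasurableSet {p : BS | Cycle.bsLoss s p ∈ Z} := (measurable_bsLoss s) hZ
  rw [detCount_restrict s hN _ hZ, locKernel_of_mem hN]
  have h4 : (fun p : BS => Z.indicator (1 : ℝ → ℝ≥0∞) (Cycle.bsLoss s p)) =
      {p : BS | Cycle.bsLoss s p ∈ Z}.indicator 1 := rfl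
  rw [h4, lintegral_indicator_one hZm, Measure.restrict_apply hZm]
  congr 1
  ext p
  simp only [mem_inter_iff, mem_ofPred_eq]
  tauto

/-- Detection in sector `j` is independent of the absence of detection in the other sectors. -/
lemma lintegral_detected_prod (hQ : IsPoissonLaw Q (bsMeasure s)) (j : Fin s.Kcs) (z F : ℝ)
    {Z : Set ℝ} (hZ : MeasurableSet Z) :
    ∫⁻ N in {N | ((z, F), N.restrict (bsSector s.Kcs j)) ∈ detSet s},
        ∏ i ∈ Finset.univ.erase j,
          ({N | detCount s Z (N.restrict (bsSector s.Kcs i)) = 0}.indicator 1 N : ℝ≥0∞) ∂Q =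
      Q {N | ((z, F), N.restrict (bsSector s.Kcs j)) ∈ detSet s} *
        ∏ i ∈ Finset.univ.erase j,
          Q {N | detCount s Z (N.restrict (bsSector s.Kcs i)) = 0} := by
  classical
  have := hQ.isProbabilityMeasure
  have hS : ∀ i : Fin s.Kcs, MeasurableSet (bsSector s.Kcs i) := fun i => measurableSet_bsSector i.2
  have hd : Pairwise fun i k : Fin s.Kcs => Disjoint (bsSector s.Kcs i) (bsSector s.Kcs k) := by
    intro i k hik
    rw [Set.disjoint_left]
    intro p hp hp'
    exact Set.disjoint_left.1 (disjoint_beam hik) hp hp'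
  have hA : MeasurableSet {N : Measure BS | ((z, F), N) ∈ detSet s} :=
    measurable_prodMk_left (measurableSet_detSet s)
  have hB : MeasurableSet {N : Measure BS | detCount s Z N = 0} :=
    measurable_detCount s hZ (measurableSet_singleton 0)
  let B : Fin s.Kcs → Set (Measure BS) := fun i =>
    if i = j then {N | ((z, F), N) ∈ detSet s} else {N | detCount s Z N = 0}
  have hBm : ∀ i, MeasurableSet (B i) := by
    intro i
    by_cases h : i = j
    · simp only [B, h, if_true]; exact hA
    · simp only [B, h, if_false]; exact hB
  have hind := (hQ.iIndepFun_restrict hS hd).comp (fun i => (B i).indicator (1 : Measure BS → ℝ≥0∞))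
    fun i => measurable_one.indicator (hBm i)
  have hmeas : ∀ i, Measurable ((B i).indicator (1 : Measure BS → ℝ≥0∞) ∘
      fun N : Measure BS => N.restrict (bsSector s.Kcs i)) :=
    fun i => (measurable_one.indicator (hBm i)).comp (measurable_restrict (hS i))
  have hprod := lintegral_prod_eq_prod_lintegral_of_indepFun Finset.univ _ hind hmeas
  have hval : ∀ i, ∫⁻ N, ((B i).indicator (1 : Measure BS → ℝ≥0∞) ∘
      fun N : Measure BS => N.restrict (bsSector s.Kcs i)) N ∂Q =
      Q {N | N.restrict (bsSector s.Kcs i) ∈ B i} := by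
    intro i
    exact lintegral_indicator_one ((measurable_restrict (hS i)) (hBm i))
  simp_rw [hval] at hprod
  rw [← Finset.mul_prod_erase _ _ (Finset.mem_univ j)] at hprod
  have hBj : B j = {N | ((z, F), N) ∈ detSet s} := if_pos rfl
  have hBi : ∀ i ∈ Finset.univ.erase j, B i = {N | detCount s Z N = 0} :=
    fun i hi => if_neg (Finset.ne_of_mem_erase hi)
  rw [Finset.prod_congr rfl (g := fun i : Fin s.Kcs =>
    Q {N | detCount s Z (N.restrict (bsSector s.Kcs i)) = 0})
    fun i hi => by rw [hBi i hi]; rfl, hBj] at hprod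
  refine Eq.trans ?_ hprod
  have hA' : MeasurableSet {N : Measure BS | ((z, F), N.restrict (bsSector s.Kcs j)) ∈ detSet s} :=
    measurable_restrict (hS j) hA
  rw [← lintegral_indicator hA']
  refine lintegral_congr fun N => ?_
  rw [← Finset.mul_prod_erase _ _ (Finset.mem_univ j)]
  rw [Finset.prod_congr rfl (g := fun i : Fin s.Kcs =>
    ({N | detCount s Z (N.restrict (bsSector s.Kcs i)) = 0}.indicator 1 N : ℝ≥0∞))
    fun i hi => by rw [hBi i hi]; rfl, hBj]
  by_cases h : ((z, F), N.restrict (bsSector s.Kcs j)) ∈ detSet s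
  · refine (indicator_of_mem (s := {N : Measure BS |
      ((z, F), N.restrict (bsSector s.Kcs j)) ∈ detSet s}) h _).trans ?_
    simp [h]
  · refine (indicator_of_notMem (s := {N : Measure BS |
      ((z, F), N.restrict (bsSector s.Kcs j)) ∈ detSet s}) h _).trans ?_
    simp [h]

end mecke

section points

variable {Ω : Type*} [MeasurableSpace Ω] {P : Measure Ω} {Φ : Ω → Set BS}

lemma detCount_pointMeasure_eq_zero_iff {Φ : Set BS} (hΦ : Φ.Countable)
    (hN : pointMeasure Φ ∈ locFinite (bsMeasure s)) {S : Set BS} (hS : MeasurableSet S) {Z : Set ℝ}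
    (hZ : MeasurableSet Z) :
    detCount s Z ((pointMeasure Φ).restrict S) = 0 ↔ ∀ p ∈ Φ, p ∈ S →
      ((Cycle.bsLoss s p, p.2.2), (pointMeasure Φ).restrict S) ∈ detSet s → Cycle.bsLoss s p ∉ Z := by
  rw [detCount_restrict s hN _ hZ, pointMeasure_eq_zero_iff hΦ]
  · constructor
    · intro h p hp hpS hd hz
      exact h p hp ⟨⟨hd, hz⟩, hpS⟩
    · rintro h p hp ⟨⟨hd, hz⟩, hpS⟩
      exact h p hp hpS hd hz
  · exact ((measurableSet_detected s _).inter ((measurable_bsLoss s) hZ)).inter hS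

/-- A detected base station has the smallest path loss of its sector. -/
lemma bsLoss_le_of_detSet {Φ : Set BS} (hΦ : Φ.Countable)
    (hN : pointMeasure Φ ∈ locFinite (bsMeasure s)) {S : Set BS} (hS : MeasurableSet S) {p q : BS}
    (hd : ((Cycle.bsLoss s p, p.2.2), (pointMeasure Φ).restrict S) ∈ detSet s) (hq : q ∈ Φ)
    (hqS : q ∈ S) : Cycle.bsLoss s p ≤ Cycle.bsLoss s q := by
  have hlt : MeasurableSet {q | Cycle.bsLoss s q < Cycle.bsLoss s p} :=
    measurableSet_lt (measurable_bsLoss s) measurable_const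
  have h := hd.1
  simp only [locKernel_restrict hN] at h
  rw [Measure.restrict_apply hlt, pointMeasure_eq_zero_iff hΦ (hlt.inter hS)] at h
  exact not_lt.1 fun h' => h q hq ⟨h', hqS⟩

/-- At most one base station of a sector has the smallest path loss and is detected. -/
lemma detCount_zero_or_one {Φ : Set BS} (hΦ : Φ.Countable)
    (hN : pointMeasure Φ ∈ locFinite (bsMeasure s)) (hinj : InjOn (Cycle.bsLoss s) Φ)
    {S : Set BS} (hS : MeasurableSet S) {Z : Set ℝ} (hZ : MeasurableSet Z) :
    detCount s Z ((pointMeasure Φ).restrict S) = 0 ∨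
      detCount s Z ((pointMeasure Φ).restrict S) = 1 := by
  rw [detCount_restrict s hN _ hZ]
  refine pointMeasure_of_subsingleton hΦ
    (((measurableSet_detected s _).inter ((measurable_bsLoss s) hZ)).inter hS) ?_
  rintro p ⟨hp, ⟨hdp, -⟩, hpS⟩ q ⟨hq, ⟨hdq, -⟩, hqS⟩
  exact hinj hp hq (le_antisymm (bsLoss_le_of_detSet s hΦ hN hS hdp hq hqS)
    (bsLoss_le_of_detSet s hΦ hN hS hdq hp hpS))

variable [IsProbabilityMeasure P]

/-- The probability that no base station of a sector is detected with a path loss in `Z`: as there is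
at most one detected base station, it is one minus the mean number of them. -/
lemma measure_detCount_eq_zero (hΦ : IsPoissonProcess P Φ (bsMeasure s)) (j : Fin s.Kcs) {Z : Set ℝ}
    (hZ : MeasurableSet Z) :
    P.map (fun ω => pointMeasure (Φ ω))
        {N | detCount s Z (N.restrict (bsSector s.Kcs j)) = 0} =
      1 - ∫⁻ z in Z ∩ Ioi 0, ENNReal.ofReal (s.condDetect z * s.minLossDensity z) := by
  have hQ := hΦ.isPoissonLaw
  have hprob := hQ.isProbabilityMeasure
  set Q := P.map (fun ω => pointMeasure (Φ ω)) with hQdef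
  have hS := measurableSet_bsSector j.2
  have hm : Measurable fun N : Measure BS => detCount s Z (N.restrict (bsSector s.Kcs j)) :=
    (measurable_detCount s hZ).comp (measurable_restrict hS)
  have hA : MeasurableSet {N : Measure BS | detCount s Z (N.restrict (bsSector s.Kcs j)) = 0} :=
    hm (measurableSet_singleton 0)
  have h01 : ∀ᵐ N ∂Q, detCount s Z (N.restrict (bsSector s.Kcs j)) = 0 ∨
      detCount s Z (N.restrict (bsSector s.Kcs j)) = 1 := by
    have hset : MeasurableSet {N : Measure BS | detCount s Z (N.restrict (bsSector s.Kcs j)) = 0 ∨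
        detCount s Z (N.restrict (bsSector s.Kcs j)) = 1} :=
      hA.union (hm (measurableSet_singleton 1))
    have hpm := hΦ.measurable_pointMeasure
    rw [hQdef, ae_map_iff hpm.aemeasurable hset]
    filter_upwards [ae_of_ae_map hpm.aemeasurable hQ.ae_mem_locFinite,
      hΦ.ae_injOn (measurable_bsLoss s) (bsMeasure_level s)] with ω h1 h2
    exact detCount_zero_or_one s (hΦ.countable ω) h1 h2 hS hZ
  rw [← lintegral_detCount s hQ j hZ]
  have h1 : ∫⁻ N, detCount s Z (N.restrict (bsSector s.Kcs j)) ∂Q =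
      Q {N | detCount s Z (N.restrict (bsSector s.Kcs j)) = 0}ᶜ := by
    rw [← lintegral_indicator_one hA.compl]
    refine lintegral_congr_ae ?_
    filter_upwards [h01] with N hN
    rcases hN with h | h <;> simp [indicator, h]
  rw [h1, prob_compl_eq_one_sub hA, ENNReal.sub_sub_cancel ENNReal.one_ne_top prob_le_one]

end points

end MmWave

namespace MmWave

/-! ### The density of the path loss to the tagged base station -/

namespace Network

variable (s : Network)

lemma sectorRate_nonneg : 0 ≤ s.sectorRate := by
  have := s.lamB_pos
  have := Real.pi_pos
  unfold sectorRate
  positivity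

lemma measurable_mix {G : ℝ → ℝ → ℝ≥0∞} (hG : Measurable (Function.uncurry G)) :
    Measurable fun z => s.mix (G z) := by
  have h : ∀ z, s.mix (G z) = ∫⁻ l in Ioi (0 : ℝ), ENNReal.ofReal (s.lossRate l) * G z l :=
    fun z => s.mix_eq (hG.comp measurable_prodMk_left)
  simp_rw [h]
  have hm : Measurable fun x : ℝ × ℝ => ENNReal.ofReal (s.lossRate x.2) * G x.1 x.2 :=
    (s.measurable_lossRate.comp measurable_snd).ennreal_ofReal.mul hG
  exact Measurable.lintegral_prod_right' hm

lemma V_nonneg (z t l : ℝ) : 0 ≤ s.V z t l := expNeg_nonneg _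

lemma U_nonneg (z t l : ℝ) : 0 ≤ s.U z t l := expNeg_nonneg _

lemma V_eq {z : ℝ} (hz : 0 < z) (t l : ℝ) :
    s.V z t l = expNeg (ENNReal.ofReal (2 * Real.pi * l) *
      s.mix fun w => (open Classical in if z < w then ENNReal.ofReal (t * z / (t * z + w)) else 0)) := by
  rw [s.mix_gt_ratio hz]
  rfl

lemma U_eq (z t l : ℝ) :
    s.U z t l = expNeg (ENNReal.ofReal (2 * Real.pi * l) *
      s.mix fun w => ENNReal.ofReal (t * z / (t * z + w))) := by
  rw [s.mix_ratio]
  rfl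

lemma measurable_U (t l : ℝ) : Measurable fun z => s.U z t l := by
  simp_rw [s.U_eq]
  refine continuous_expNeg.measurable.comp (Measurable.const_mul (s.measurable_mix ?_) _)
  exact ((measurable_fst.const_mul t).div ((measurable_fst.const_mul t).add
    measurable_snd)).ennreal_ofReal

lemma measurable_Pra : Measurable s.Pra :=
  (((((measurable_id.const_mul _).mul_const _).div_const _).neg.exp).mul (s.measurable_U _ _)).mul
    (s.measurable_U _ _)

/-- `V` is an integral of a jointly measurable function only at positive path losses, hence the
restriction to `(0, ∞)`. -/
lemma aemeasurable_V (t l : ℝ) : AEMeasurable (fun z => s.V z t l) (volume.restrict (Ioi 0)) := by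
  classical
  refine ⟨fun z => expNeg (ENNReal.ofReal (2 * Real.pi * l) *
      s.mix fun w => (if z < w then ENNReal.ofReal (t * z / (t * z + w)) else 0)), ?_, ?_⟩
  · refine continuous_expNeg.measurable.comp (Measurable.const_mul (s.measurable_mix ?_) _)
    exact Measurable.ite (measurableSet_lt measurable_fst measurable_snd)
      ((measurable_fst.const_mul t).div ((measurable_fst.const_mul t).add
        measurable_snd)).ennreal_ofReal measurable_const
  · refine (ae_restrict_iff' measurableSet_Ioi).2 (Filter.Eventually.of_forall fun z hz => ?_)
    exact s.V_eq hz t l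

lemma measurable_primitive {w : ℝ → ℝ} (hw : Measurable w) (h0 : ∀ r, 0 ≤ w r) (h1 : ∀ r, w r ≤ 1) :
    Measurable fun a => ∫ r in (0 : ℝ)..a, w r * r := by
  refine (intervalIntegral.continuous_primitive (fun a b => ?_) 0).measurable
  refine (intervalIntegral.intervalIntegrable_id (μ := volume)).mono_fun
    (hw.mul measurable_id).aestronglyMeasurable (Filter.Eventually.of_forall fun r => ?_)
  simp only [norm_mul, Real.norm_of_nonneg (h0 r)]
  exact mul_le_of_le_one_left (norm_nonneg _) (h1 r)

lemma measurable_minLossDensity : Measurable s.minLossDensity := by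
  have hL := (measurable_primitive s.h_meas s.h_nonneg s.h_le_one).comp s.measurable_invL
  have hN := (measurable_primitive (w := fun r => 1 - s.h r) (measurable_const.sub s.h_meas)
    (fun r => sub_nonneg.2 (s.h_le_one r)) (fun r => by linarith [s.h_nonneg r])).comp s.measurable_invN
  have h1 := s.h_meas.comp s.measurable_invL
  have h2 := (measurable_const (a := (1 : ℝ))).sub (s.h_meas.comp s.measurable_invN)
  exact (((((measurable_id.pow_const _).const_mul _).mul h1).add
    (((measurable_id.pow_const _).const_mul _).mul h2)).mul (hL.const_mul _).exp).mul
      (hN.const_mul _).exp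

lemma minLossDensity_nonneg {z : ℝ} (hz : 0 < z) : 0 ≤ s.minLossDensity z := by
  have h1 := s.h_nonneg (s.invL z)
  have h2 := sub_nonneg.2 (s.h_le_one (s.invN z))
  have h3 := s.sectorRate_nonneg
  have h4 := s.alphaL_pos
  have h5 := s.alphaN_pos
  have h6 := s.beta_pos
  unfold minLossDensity
  positivity

lemma condDetect_nonneg (z : ℝ) : 0 ≤ s.condDetect z :=
  mul_nonneg (Real.exp_pos _).le (s.V_nonneg _ _ _)

lemma aemeasurable_condDetect : AEMeasurable s.condDetect (volume.restrict (Ioi 0)) := by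
  refine AEMeasurable.mul ?_ (s.aemeasurable_V _ _)
  exact (((((measurable_id.const_mul _).mul_const _).div_const _).neg).exp).aemeasurable

/-- The density of the event that a sector is detected with smallest path loss `z`. The lemmas below
assume that its total mass is at most `1`; this is shown from the existence of the process in
`lintegral_detectRate_le_one`. -/
def detectRate (z : ℝ) : ℝ := s.condDetect z * s.minLossDensity z

lemma detectRate_nonneg {z : ℝ} (hz : 0 < z) : 0 ≤ s.detectRate z :=
  mul_nonneg (s.condDetect_nonneg z) (s.minLossDensity_nonneg hz)

lemma aemeasurable_detectRate : AEMeasurable s.detectRate (volume.restrict (Ioi 0)) :=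
  s.aemeasurable_condDetect.mul s.measurable_minLossDensity.aemeasurable

/-- The probability that a sector is not detected with a smallest path loss below `z`. -/
def missBelow (z : ℝ) : ℝ≥0∞ := 1 - ∫⁻ w in Iio z ∩ Ioi 0, ENNReal.ofReal (s.detectRate w)

lemma missBelow_antitone : Antitone s.missBelow := fun _ _ h =>
  tsub_le_tsub_left (lintegral_mono_set (inter_subset_inter_left _ (Iio_subset_Iio h))) _

lemma integrableOn_detectRate (h : ∫⁻ w in Ioi (0 : ℝ), ENNReal.ofReal (s.detectRate w) ≤ 1) :
    IntegrableOn s.detectRate (Ioi 0) := by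
  refine ⟨s.aemeasurable_detectRate.aestronglyMeasurable, ?_⟩
  rw [hasFiniteIntegral_iff_ofReal]
  · exact h.trans_lt ENNReal.one_lt_top
  · exact (ae_restrict_iff' measurableSet_Ioi).2
      (Filter.Eventually.of_forall fun z hz => s.detectRate_nonneg hz)

lemma ofReal_detectAbove (h : ∫⁻ w in Ioi (0 : ℝ), ENNReal.ofReal (s.detectRate w) ≤ 1) {z : ℝ}
    (hz : 0 ≤ z) :
    ENNReal.ofReal (s.detectAbove z) = ∫⁻ w in Ioi z, ENNReal.ofReal (s.detectRate w) := by
  refine ofReal_integral_eq_lintegral_ofReal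
    ((s.integrableOn_detectRate h).mono_set (Ioi_subset_Ioi hz)) ?_
  exact (ae_restrict_iff' measurableSet_Ioi).2
      (Filter.Eventually.of_forall fun w hw => s.detectRate_nonneg (hz.trans_lt hw))

lemma detectAbove_nonneg {z : ℝ} (hz : 0 ≤ z) : 0 ≤ s.detectAbove z :=
  setIntegral_nonneg measurableSet_Ioi fun _ hw => s.detectRate_nonneg (hz.trans_lt hw)

lemma detect_le_one (h : ∫⁻ w in Ioi (0 : ℝ), ENNReal.ofReal (s.detectRate w) ≤ 1) :
    s.detect ≤ 1 := by
  rw [← s.ofReal_detectAbove h le_rfl] at h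
  exact ENNReal.ofReal_le_one.1 h

lemma missBelow_eq (h : ∫⁻ w in Ioi (0 : ℝ), ENNReal.ofReal (s.detectRate w) ≤ 1) {z : ℝ}
    (hz : 0 < z) : s.missBelow z = ENNReal.ofReal (s.detectAbove z + 1 - s.detect) := by
  have h0 := s.detectAbove_nonneg hz.le
  have hd := s.detect_le_one h
  have hsplit : ENNReal.ofReal s.detect =
      (∫⁻ w in Iio z ∩ Ioi 0, ENNReal.ofReal (s.detectRate w)) + ENNReal.ofReal (s.detectAbove z) := by
    rw [detect, s.ofReal_detectAbove h le_rfl, s.ofReal_detectAbove h hz.le,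
      ← setLIntegral_congr (Ioi_ae_eq_Ici (a := z)).symm, ← lintegral_union measurableSet_Ici]
    · congr 2
      ext w
      simp only [mem_Ioi, mem_union, mem_inter_iff, mem_Iio, mem_Ici]
      constructor
      · intro hw
        rcases lt_or_ge w z with h | h
        exacts [Or.inl ⟨h, hw⟩, Or.inr h]
      · rintro (⟨-, hw⟩ | hw)
        exacts [hw, hz.trans_le hw]
    · rw [Set.disjoint_left]
      rintro w ⟨hw, -⟩ hw'
      exact absurd (mem_Iio.1 hw) (not_lt.2 (mem_Ici.1 hw'))
  have e : (∫⁻ w in Iio z ∩ Ioi 0, ENNReal.ofReal (s.detectRate w)) =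
      ENNReal.ofReal (s.detect - s.detectAbove z) := by
    rw [ENNReal.ofReal_sub _ h0, hsplit, ENNReal.add_sub_cancel_right ENNReal.ofReal_ne_top]
  have hle : s.detectAbove z ≤ s.detect := by
    have : ENNReal.ofReal (s.detectAbove z) ≤ ENNReal.ofReal s.detect := by
      rw [hsplit]; exact le_add_self
    exact (ENNReal.ofReal_le_ofReal_iff (s.detectAbove_nonneg le_rfl)).1 this
  rw [missBelow, e, ← ENNReal.ofReal_one, ← ENNReal.ofReal_sub _ (sub_nonneg.2 hle)]
  congr 1; ring

lemma servingLossDensity_nonneg (h : ∫⁻ w in Ioi (0 : ℝ), ENNReal.ofReal (s.detectRate w) ≤ 1)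
    {z : ℝ} (hz : 0 < z) : 0 ≤ s.servingLossDensity z := by
  have h0 := s.detectAbove_nonneg hz.le
  have hd := s.detect_le_one h
  have h1 := s.condDetect_nonneg z
  have h2 := s.minLossDensity_nonneg hz
  have h3 : 0 ≤ s.detectAbove z + 1 - s.detect := by linarith
  unfold servingLossDensity
  positivity

lemma ofReal_servingLossDensity (h : ∫⁻ w in Ioi (0 : ℝ), ENNReal.ofReal (s.detectRate w) ≤ 1)
    {z : ℝ} (hz : 0 < z) : ENNReal.ofReal (s.servingLossDensity z) =
      s.Kcs * (s.missBelow z ^ (s.Kcs - 1) * ENNReal.ofReal (s.detectRate z)) := by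
  have h0 := s.detectAbove_nonneg hz.le
  have hd := s.detect_le_one h
  have h3 : 0 ≤ s.detectAbove z + 1 - s.detect := by linarith
  rw [s.missBelow_eq h hz, ← ENNReal.ofReal_pow h3, ← ENNReal.ofReal_mul (by positivity),
    ← ENNReal.ofReal_natCast, ← ENNReal.ofReal_mul (by positivity)]
  congr 1
  rw [servingLossDensity, detectRate]
  ring

lemma aemeasurable_servingLossDensity
    (h : ∫⁻ w in Ioi (0 : ℝ), ENNReal.ofReal (s.detectRate w) ≤ 1) :
    AEMeasurable s.servingLossDensity (volume.restrict (Ioi 0)) := by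
  have hm : AEMeasurable (fun z => (s.Kcs * (s.missBelow z ^ (s.Kcs - 1) *
      ENNReal.ofReal (s.detectRate z)) : ℝ≥0∞).toReal) (volume.restrict (Ioi 0)) :=
    (((s.missBelow_antitone.measurable.pow_const _).aemeasurable.mul
      s.aemeasurable_detectRate.ennreal_ofReal).const_mul _).ennreal_toReal
  refine hm.congr ((ae_restrict_iff' measurableSet_Ioi).2
    (Filter.Eventually.of_forall fun z hz => ?_))
  simp only
  rw [← s.ofReal_servingLossDensity h hz, ENNReal.toReal_ofReal (s.servingLossDensity_nonneg h hz)]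

lemma cellSearchProb_nonneg (h : ∫⁻ w in Ioi (0 : ℝ), ENNReal.ofReal (s.detectRate w) ≤ 1) :
    0 ≤ s.cellSearchProb := by
  have h1 := s.detect_le_one h
  have h2 := s.detectAbove_nonneg le_rfl
  exact sub_nonneg.2 (pow_le_one₀ (sub_nonneg.2 h1) (sub_le_self _ h2))

end Network

/-! ### The tagged base station -/

variable (s : Network)

/-- The pairs `(p, N)` such that `p` is the tagged base station if the base stations are given by
`N`: `p` is detected in its sector, and nothing of smaller path loss is detected in the others. -/
def tagSet : Set (BS × Measure BS) :=
  {x | ∃ j : Fin s.Kcs, (((Cycle.bsLoss s x.1, x.1.2.2), x.2.restrict (bsSector s.Kcs j)) ∈ detSet s ∧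
    x.1 ∈ bsSector s.Kcs j) ∧ ∀ i ∈ Finset.univ.erase j,
      detCount s (Iio (Cycle.bsLoss s x.1)) (x.2.restrict (bsSector s.Kcs i)) = 0}

/-- The pairs of `tagSet` with `p` in sector `j`. -/
def tagSetIn (j : Fin s.Kcs) : Set (BS × Measure BS) :=
  {x | (((Cycle.bsLoss s x.1, x.1.2.2), x.2.restrict (bsSector s.Kcs j)) ∈ detSet s ∧
    x.1 ∈ bsSector s.Kcs j) ∧ ∀ i ∈ Finset.univ.erase j,
      detCount s (Iio (Cycle.bsLoss s x.1)) (x.2.restrict (bsSector s.Kcs i)) = 0}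

lemma tagSet_eq_iUnion : tagSet s = ⋃ j, tagSetIn s j := by
  ext x
  simp [tagSet, tagSetIn]

lemma measurableSet_tagSetIn (j : Fin s.Kcs) : MeasurableSet (tagSetIn s j) := by
  have hS : ∀ i : Fin s.Kcs, MeasurableSet (bsSector s.Kcs i) := fun i => measurableSet_bsSector i.2
  have hT : MeasurableSet {x : BS × Measure BS |
      ((Cycle.bsLoss s x.1, x.1.2.2), x.2.restrict (bsSector s.Kcs j)) ∈ detSet s} :=
    ((measurable_bsMark s).comp (((measurable_restrict (hS j)).comp measurable_snd).prodMk
      measurable_fst)) (measurableSet_detSet s)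
  have h : ∀ i : Fin s.Kcs, MeasurableSet {x : BS × Measure BS |
      detCount s (Iio (Cycle.bsLoss s x.1)) (x.2.restrict (bsSector s.Kcs i)) = 0} := fun i =>
    ((measurable_detCount_Iio s).comp (((measurable_bsLoss s).comp measurable_fst).prodMk
      ((measurable_restrict (hS i)).comp measurable_snd))) (measurableSet_singleton 0)
  have e : tagSetIn s j = ({x : BS × Measure BS |
      ((Cycle.bsLoss s x.1, x.1.2.2), x.2.restrict (bsSector s.Kcs j)) ∈ detSet s} ∩
      {x | x.1 ∈ bsSector s.Kcs j}) ∩ ⋂ i ∈ Finset.univ.erase j, {x : BS × Measure BS |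
        detCount s (Iio (Cycle.bsLoss s x.1)) (x.2.restrict (bsSector s.Kcs i)) = 0} := by
    ext x
    simp only [tagSetIn, mem_inter_iff, mem_iInter, mem_ofPred_eq]
  rw [e]
  exact (hT.inter (measurable_fst (hS j))).inter
    (MeasurableSet.biInter (Finset.countable_toSet _) fun i _ => h i)

lemma measurableSet_tagSet : MeasurableSet (tagSet s) := by
  rw [tagSet_eq_iUnion]
  exact MeasurableSet.iUnion fun j => measurableSet_tagSetIn s j

lemma disjoint_tagSetIn {i j : Fin s.Kcs} (h : i ≠ j) : Disjoint (tagSetIn s i) (tagSetIn s j) := by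
  rw [Set.disjoint_left]
  intro x hx hx'
  exact Set.disjoint_left.1 (disjoint_beam h) hx.1.2 hx'.1.2

section points

variable {Ω : Type*} [MeasurableSpace Ω] {P : Measure Ω} [IsProbabilityMeasure P] {Φ : Ω → Set BS}

/-- As at most one base station of a sector is detected, the mean number of them is at most `1`. In
particular the integrals in `detectAbove` converge. -/
lemma lintegral_detectRate_le_one (hΦ : IsPoissonProcess P Φ (bsMeasure s)) :
    ∫⁻ w in Ioi (0 : ℝ), ENNReal.ofReal (s.detectRate w) ≤ 1 := by
  have hQ := hΦ.isPoissonLaw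
  have hprob := hQ.isProbabilityMeasure
  have h := lintegral_detCount s hQ ⟨0, s.Kcs_pos⟩ (Z := univ) MeasurableSet.univ
  rw [univ_inter] at h
  refine h.symm.le.trans ?_
  have hpm := hΦ.measurable_pointMeasure
  have hS := measurableSet_bsSector (k := s.Kcs) (j := 0) s.Kcs_pos
  have hm : Measurable fun N : Measure BS => detCount s univ (N.restrict (bsSector s.Kcs 0)) :=
    (measurable_detCount s MeasurableSet.univ).comp (measurable_restrict hS)
  rw [lintegral_map hm hpm]
  refine (lintegral_mono_ae (g := fun _ => 1) ?_).trans (by simp)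
  filter_upwards [ae_of_ae_map hpm.aemeasurable hQ.ae_mem_locFinite,
      hΦ.ae_injOn (measurable_bsLoss s) (bsMeasure_level s)] with ω h1 h2
  rcases detCount_zero_or_one s (hΦ.countable ω) h1 h2 hS MeasurableSet.univ with h | h <;> simp [h]

/-- The mean of a function of the path loss to the tagged base station: a detected base station is the
tagged one if the other `Kcs - 1` sectors, which are independent, detect nothing of smaller path
loss. -/
lemma lintegral_tagSet (hΦ : IsPoissonProcess P Φ (bsMeasure s)) {g : ℝ → ℝ≥0∞} (hg : Measurable g) :
    ∫⁻ N, ∫⁻ p in {p | (p, N) ∈ tagSet s}, g (Cycle.bsLoss s p) ∂locKernel (bsMeasure s) N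
        ∂P.map (fun ω => pointMeasure (Φ ω)) =
      ∫⁻ z in Ioi (0 : ℝ), g z * ENNReal.ofReal (s.servingLossDensity z) := by
  classical
  have hQ := hΦ.isPoissonLaw
  have hprob := hQ.isProbabilityMeasure
  have hle := lintegral_detectRate_le_one s hΦ
  have hmiss : ∀ (i : Fin s.Kcs) (z : ℝ), P.map (fun ω => pointMeasure (Φ ω))
      {N | detCount s (Iio z) (N.restrict (bsSector s.Kcs i)) = 0} = s.missBelow z :=
    fun i z => measure_detCount_eq_zero s hΦ i measurableSet_Iio
  set Q := P.map (fun ω => pointMeasure (Φ ω)) with hQdef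
  have hS : ∀ i : Fin s.Kcs, MeasurableSet (bsSector s.Kcs i) := fun i => measurableSet_bsSector i.2
  have hprodm : ∀ j : Fin s.Kcs, Measurable fun x : ℝ × Measure BS => ∏ i ∈ Finset.univ.erase j,
      ({y : ℝ × Measure BS | detCount s (Iio y.1) (y.2.restrict (bsSector s.Kcs i)) = 0}.indicator
        (1 : ℝ × Measure BS → ℝ≥0∞) x) := by
    intro j
    refine Finset.measurable_fun_prod _ fun i _ => measurable_one.indicator ?_
    exact ((measurable_detCount_Iio s).comp (measurable_fst.prodMk
      ((measurable_restrict (hS i)).comp measurable_snd))) (measurableSet_singleton 0)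
  have hone : ∀ j : Fin s.Kcs, ∫⁻ N, ∫⁻ p in {p | (p, N) ∈ tagSetIn s j}, g (Cycle.bsLoss s p)
      ∂locKernel (bsMeasure s) N ∂Q =
      ∫⁻ z in Ioi (0 : ℝ), g z * s.missBelow z ^ (s.Kcs - 1) * ENNReal.ofReal (s.detectRate z) := by
    intro j
    let R : ℝ × Measure BS → ℝ≥0∞ := fun x => g x.1 * ∏ i ∈ Finset.univ.erase j,
      ({y : ℝ × Measure BS | detCount s (Iio y.1) (y.2.restrict (bsSector s.Kcs i)) = 0}.indicator
        (1 : ℝ × Measure BS → ℝ≥0∞) x)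
    have hR : Measurable R := (hg.comp measurable_fst).mul (hprodm j)
    have hR' : ∀ p ∈ bsSector s.Kcs j, ∀ N, R (Cycle.bsLoss s p, N + Measure.dirac p) =
        R (Cycle.bsLoss s p, N) := by
      intro p hp N
      simp only [R]
      congr 1
      refine Finset.prod_congr rfl fun i hi => ?_
      have hpi : p ∉ bsSector s.Kcs i := fun h =>
        Set.disjoint_left.1 (disjoint_beam (Finset.ne_of_mem_erase hi)) h hp
      simp only [indicator, mem_ofPred_eq, restrict_add_dirac_of_notMem (hS i) hpi, Pi.one_apply]
    have h1 := mecke_detected s hQ j hR hR'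
    have h2 : ∀ N : Measure BS, ∫⁻ p in {p | (p, N) ∈ tagSetIn s j}, g (Cycle.bsLoss s p)
        ∂locKernel (bsMeasure s) N =
        ∫⁻ p in {p | ((Cycle.bsLoss s p, p.2.2), N.restrict (bsSector s.Kcs j)) ∈ detSet s} ∩
          bsSector s.Kcs j, R (Cycle.bsLoss s p, N) ∂locKernel (bsMeasure s) N := by
      intro N
      have hm1 : MeasurableSet {p | (p, N) ∈ tagSetIn s j} :=
        measurable_prodMk_right (measurableSet_tagSetIn s j)
      rw [← lintegral_indicator hm1,
        ← lintegral_indicator ((measurableSet_detected s _).inter (hS j))]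
      refine lintegral_congr fun p => ?_
      by_cases hp : p ∈ {p | ((Cycle.bsLoss s p, p.2.2), N.restrict (bsSector s.Kcs j)) ∈ detSet s} ∩
          bsSector s.Kcs j
      · rw [indicator_of_mem hp]
        by_cases hall : ∀ i ∈ Finset.univ.erase j,
            detCount s (Iio (Cycle.bsLoss s p)) (N.restrict (bsSector s.Kcs i)) = 0
        · have : (∏ i ∈ Finset.univ.erase j, ({y : ℝ × Measure BS | detCount s (Iio y.1)
              (y.2.restrict (bsSector s.Kcs i)) = 0}.indicator (1 : ℝ × Measure BS → ℝ≥0∞)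
                (Cycle.bsLoss s p, N))) = 1 :=
            Finset.prod_eq_one fun i hi => by simp [hall i hi]
          rw [indicator_of_mem (show p ∈ {p | (p, N) ∈ tagSetIn s j} from ⟨hp, hall⟩)]
          simp only [R, this, mul_one]
        · rw [indicator_of_notMem (show p ∉ {p | (p, N) ∈ tagSetIn s j} from fun h => hall h.2)]
          push Not at hall
          obtain ⟨i, hi, hne⟩ := hall
          simp only [R]
          rw [Finset.prod_eq_zero hi (by simp [hne]), mul_zero]
      · rw [indicator_of_notMem hp, indicator_of_notMem
          (show p ∉ {p | (p, N) ∈ tagSetIn s j} from fun h => hp h.1)]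
    simp_rw [h2]
    rw [h1]
    have h3 := lintegral_detection s hQ j (G := fun z => g z * s.missBelow z ^ (s.Kcs - 1))
      (hg.mul (s.missBelow_antitone.measurable.pow_const _))
    refine Eq.trans ?_ h3
    refine lintegral_congr fun p => ?_
    simp only [R]
    have hmp : Measurable fun N : Measure BS => ∏ i ∈ Finset.univ.erase j,
      ({y : ℝ × Measure BS | detCount s (Iio y.1) (y.2.restrict (bsSector s.Kcs i)) = 0}.indicator
        (1 : ℝ × Measure BS → ℝ≥0∞) (Cycle.bsLoss s p, N)) := (hprodm j).comp measurable_prodMk_left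
    rw [lintegral_const_mul _ hmp, mul_assoc]
    congr 1
    refine (lintegral_detected_prod s hQ j (Cycle.bsLoss s p) p.2.2
      (measurableSet_Iio (a := Cycle.bsLoss s p))).trans ?_
    rw [Finset.prod_congr rfl fun i _ => hmiss i (Cycle.bsLoss s p), Finset.prod_const,
      Finset.card_erase_of_mem (Finset.mem_univ j), Finset.card_univ, Fintype.card_fin, mul_comm]
  have hsum : ∀ N : Measure BS, ∫⁻ p in {p | (p, N) ∈ tagSet s}, g (Cycle.bsLoss s p)
      ∂locKernel (bsMeasure s) N = ∑ j, ∫⁻ p in {p | (p, N) ∈ tagSetIn s j}, g (Cycle.bsLoss s p)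
      ∂locKernel (bsMeasure s) N := by
    intro N
    have : {p | (p, N) ∈ tagSet s} = ⋃ j, {p | (p, N) ∈ tagSetIn s j} := by
      rw [tagSet_eq_iUnion]; ext p; simp
    have hm1 : ∀ j, MeasurableSet {p | (p, N) ∈ tagSetIn s j} :=
      fun j => measurable_prodMk_right (measurableSet_tagSetIn s j)
    rw [this, lintegral_iUnion hm1, tsum_fintype]
    intro i j hij
    exact Disjoint.preimage _ (disjoint_tagSetIn s hij)
  have hmeas : ∀ j, Measurable fun N : Measure BS => ∫⁻ p in {p | (p, N) ∈ tagSetIn s j},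
      g (Cycle.bsLoss s p) ∂locKernel (bsMeasure s) N := by
    intro j
    have hm2 : MeasurableSet {x : Measure BS × BS | (x.2, x.1) ∈ tagSetIn s j} :=
      measurable_swap (measurableSet_tagSetIn s j)
    have := measurable_lintegral_locKernel (bsMeasure s) (g := id) measurable_id
      (((hg.comp ((measurable_bsLoss s).comp measurable_snd))).indicator hm2)
    have e : (fun N : Measure BS => ∫⁻ p in {p | (p, N) ∈ tagSetIn s j},
        g (Cycle.bsLoss s p) ∂locKernel (bsMeasure s) N) = fun N =>
        ∫⁻ p, {x : Measure BS × BS | (x.2, x.1) ∈ tagSetIn s j}.indicator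
          (g ∘ Cycle.bsLoss s ∘ Prod.snd) (N, p) ∂locKernel (bsMeasure s) N := by
      funext N
      have hm1 : MeasurableSet {p | (p, N) ∈ tagSetIn s j} :=
        measurable_prodMk_right (measurableSet_tagSetIn s j)
      rw [← lintegral_indicator hm1]
      rfl
    rw [e]
    exact this
  simp_rw [hsum]
  rw [lintegral_finsetSum _ fun j _ => hmeas j, Finset.sum_congr rfl fun j _ => hone j,
    Finset.sum_const, Finset.card_univ, Fintype.card_fin, nsmul_eq_mul, ← lintegral_const_mul']
  · refine setLIntegral_congr_fun measurableSet_Ioi fun z hz => ?_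
    rw [s.ofReal_servingLossDensity hle hz]
    ring
  · simp

end points

end MmWave

namespace MmWave

/-! ### Cell search in a cycle -/

namespace Cycle

variable {Ω : Type*} {s : Network} (C : Cycle Ω s)

/-- The counting measure of the base stations. -/
def bsPoints (ω : Ω) : Measure BS := pointMeasure (C.bs ω)

variable {C} {ω : Ω}

/-- Detection in terms of the counting measure of the base stations; the sum in the interference is an
integral against it. -/
lemma detects_iff (hc : (C.bs ω).Countable) (hN : C.bsPoints ω ∈ locFinite (bsMeasure s))
    {j : Fin s.Kcs} {p : BS} :
    C.Detects ω j p ↔ p ∈ C.bs ω ∧ ((bsLoss s p, p.2.2), (C.bsPoints ω).restrict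
      (bsSector s.Kcs j)) ∈ detSet s ∧ p ∈ bsSector s.Kcs j := by
  have hS := measurableSet_bsSector j.2
  have hlt : MeasurableSet {q | bsLoss s q < bsLoss s p} :=
    measurableSet_lt (measurable_bsLoss s) measurable_const
  have hgt : MeasurableSet {q | bsLoss s p < bsLoss s q} :=
    measurableSet_lt measurable_const (measurable_bsLoss s)
  have h1 : (∑' q : {q // q ∈ C.bsIn ω j ∧ bsLoss s p < bsLoss s q},
      ENNReal.ofReal (q.1.2.2 / bsLoss s q.1)) =
      csInterference s (bsLoss s p) ((C.bsPoints ω).restrict (bsSector s.Kcs j)) := by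
    rw [csInterference, Measure.restrict_restrict hgt, bsPoints,
      setLIntegral_pointMeasure hc _ (hgt.inter hS)]
    refine (Equiv.subtypeEquivRight fun q => ?_).tsum_eq
      (fun q : {q // q ∈ C.bs ω ∧ q ∈ {q | bsLoss s p < bsLoss s q} ∩ bsSector s.Kcs j} =>
        ENNReal.ofReal (q.1.2.2 / bsLoss s q.1))
    simp only [bsIn, bsSector, mem_ofPred_eq, mem_inter_iff]
    tauto
  have h2 : (∀ q ∈ C.bsIn ω j, bsLoss s p ≤ bsLoss s q) ↔
      (C.bsPoints ω).restrict (bsSector s.Kcs j) {q | bsLoss s q < bsLoss s p} = 0 := by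
    rw [Measure.restrict_apply hlt, bsPoints, pointMeasure_eq_zero_iff hc (hlt.inter hS)]
    constructor
    · rintro h q hq ⟨hq1, hq2⟩
      exact not_lt.2 (h q ⟨hq, hq2⟩) hq1
    · rintro h q ⟨hq, hq2⟩
      exact not_lt.1 fun h' => h q hq ⟨h', hq2⟩
  have h3 : p ∈ C.bsIn ω j ↔ p ∈ C.bs ω ∧ p ∈ bsSector s.Kcs j := Iff.rfl
  rw [Detects, sinrSS, h1, h2, h3]
  simp only [detSet, mem_ofPred_eq, locKernel_restrict hN, csNoise]
  tauto

/-- Cell search fails iff no sector is detected. -/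
lemma cellSearch_iff (hc : (C.bs ω).Countable) (hN : C.bsPoints ω ∈ locFinite (bsMeasure s)) :
    ¬ C.CellSearch ω ↔
      ∀ j : Fin s.Kcs, detCount s univ ((C.bsPoints ω).restrict (bsSector s.Kcs j)) = 0 := by
  simp only [CellSearch, detects_iff hc hN, not_exists]
  refine forall_congr' fun j => ?_
  rw [bsPoints, detCount_pointMeasure_eq_zero_iff s hc hN (measurableSet_bsSector j.2)
    MeasurableSet.univ]
  simp only [mem_univ, not_true]
  exact ⟨fun h p hp hpS hd => h p ⟨hp, hd, hpS⟩, fun h p hp => h p hp.1 hp.2.2 hp.2.1⟩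

lemma isTagged_iff (hc : (C.bs ω).Countable) (hN : C.bsPoints ω ∈ locFinite (bsMeasure s)) {p : BS} :
    C.IsTagged ω p ↔ p ∈ C.bs ω ∧ (p, C.bsPoints ω) ∈ tagSet s := by
  have hS : ∀ i : Fin s.Kcs, MeasurableSet (bsSector s.Kcs i) := fun i => measurableSet_bsSector i.2
  simp only [IsTagged, detects_iff hc hN, tagSet, mem_ofPred_eq]
  constructor
  · rintro ⟨⟨j, hp, hd, hpS⟩, hall⟩
    refine ⟨hp, j, ⟨hd, hpS⟩, fun i _ => ?_⟩
    rw [bsPoints, detCount_pointMeasure_eq_zero_iff s hc hN (hS i) measurableSet_Iio]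
    exact fun q hq hqS hqd => not_lt.2 (hall i q ⟨hq, hqd, hqS⟩)
  · rintro ⟨hp, j, ⟨hd, hpS⟩, hall⟩
    refine ⟨⟨j, hp, hd, hpS⟩, fun i q hq => ?_⟩
    by_cases hij : i = j
    · subst hij
      exact bsLoss_le_of_detSet s hc hN (hS i) hd hq.1 hq.2.2
    · have h := hall i (by simp [hij])
      rw [bsPoints, detCount_pointMeasure_eq_zero_iff s hc hN (hS i) measurableSet_Iio] at h
      exact not_lt.1 (h q hq.1 hq.2.2 hq.2.1)

lemma IsTagged.eq (hinj : InjOn (bsLoss s) (C.bs ω)) {p q : BS} (hp : C.IsTagged ω p)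
    (hq : C.IsTagged ω q) : p = q := by
  obtain ⟨⟨i, hi⟩, hp'⟩ := hp
  obtain ⟨⟨j, hj⟩, hq'⟩ := hq
  exact hinj hi.1.1 hj.1.1 (le_antisymm (hp' j q hj) (hq' i p hi))

lemma IsTagged.cellSearch {p : BS} (hp : C.IsTagged ω p) : C.CellSearch ω := by
  obtain ⟨⟨j, hj⟩, -⟩ := hp
  exact ⟨j, p, hj⟩

variable [MeasurableSpace Ω] {P : Measure Ω}

lemma IsModel.bs_process (h : C.IsModel P) : IsPoissonProcess P C.bs (bsMeasure s) := h.bs_law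

lemma IsModel.ae_locFinite (h : C.IsModel P) : ∀ᵐ ω ∂P, C.bsPoints ω ∈ locFinite (bsMeasure s) :=
  ae_of_ae_map h.bs_process.measurable_pointMeasure.aemeasurable
    h.bs_process.isPoissonLaw.ae_mem_locFinite

lemma IsModel.ae_injOn (h : C.IsModel P) : ∀ᵐ ω ∂P, InjOn (bsLoss s) (C.bs ω) :=
  h.bs_process.ae_injOn (measurable_bsLoss s) (bsMeasure_level s)

variable [IsProbabilityMeasure P]

lemma IsModel.lintegral_detectRate_le_one (h : C.IsModel P) :
    ∫⁻ w in Ioi (0 : ℝ), ENNReal.ofReal (s.detectRate w) ≤ 1 :=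
  MmWave.lintegral_detectRate_le_one s h.bs_process

/-- The success probability of cell search. -/
lemma IsModel.measure_cellSearch (h : C.IsModel P) :
    P {ω | C.CellSearch ω} = ENNReal.ofReal s.cellSearchProb := by
  have hΦ := h.bs_process
  have hQ := hΦ.isPoissonLaw
  have hprob := hQ.isProbabilityMeasure
  have hle := h.lintegral_detectRate_le_one
  have hpm := hΦ.measurable_pointMeasure
  have hS : ∀ i : Fin s.Kcs, MeasurableSet (bsSector s.Kcs i) := fun i => measurableSet_bsSector i.2
  have hd : Pairwise fun i k : Fin s.Kcs => Disjoint (bsSector s.Kcs i) (bsSector s.Kcs k) := by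
    intro i k hik
    rw [Set.disjoint_left]
    intro p hp hp'
    exact Set.disjoint_left.1 (disjoint_beam hik) hp hp'
  have hA : MeasurableSet {N : Measure BS | detCount s univ N = 0} :=
    measurable_detCount s MeasurableSet.univ (measurableSet_singleton 0)
  let A : Set (Measure BS) :=
    ⋂ i : Fin s.Kcs, (fun N => N.restrict (bsSector s.Kcs i)) ⁻¹' {N | detCount s univ N = 0}
  have hAm : MeasurableSet A :=
    MeasurableSet.iInter fun i => measurable_restrict (hS i) hA
  have h1 := (hQ.iIndepFun_restrict hS hd).measure_inter_preimage_eq_mul Finset.univ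
    (sets := fun _ => {N | detCount s univ N = 0}) fun _ _ => hA
  have hmiss : ∀ i : Fin s.Kcs, P.map (fun ω => pointMeasure (C.bs ω))
      ((fun N => N.restrict (bsSector s.Kcs i)) ⁻¹' {N | detCount s univ N = 0}) =
      ENNReal.ofReal (1 - s.detect) := by
    intro i
    have h2 := measure_detCount_eq_zero s hΦ i (Z := univ) MeasurableSet.univ
    rw [univ_inter] at h2
    have h3 := s.ofReal_detectAbove hle le_rfl
    rw [Network.detect, ENNReal.ofReal_sub _ (s.detectAbove_nonneg le_rfl), ENNReal.ofReal_one, h3]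
    exact h2
  simp only [Finset.mem_univ, iInter_true, hmiss, Finset.prod_const, Finset.card_univ,
    Fintype.card_fin] at h1
  have hdet := s.detect_le_one hle
  have h4 : P {ω | C.CellSearch ω} = P ((fun ω => pointMeasure (C.bs ω)) ⁻¹' Aᶜ) := by
    refine measure_congr ?_
    filter_upwards [h.ae_locFinite] with ω hω
    have h5 := cellSearch_iff (hΦ.countable ω) hω
    have h6 : ω ∈ (fun ω => pointMeasure (C.bs ω)) ⁻¹' Aᶜ ↔ C.CellSearch ω := by
      rw [← not_iff_not, h5]
      simp only [A, mem_preimage, mem_compl_iff, not_not, mem_iInter]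
      rfl
    exact propext h6.symm
  rw [h4, ← Measure.map_apply hpm hAm.compl, prob_compl_eq_one_sub hAm, h1,
    ← ENNReal.ofReal_pow (sub_nonneg.2 hdet), ← ENNReal.ofReal_one, ← ENNReal.ofReal_sub _
      (pow_nonneg (sub_nonneg.2 hdet) _)]
  rfl

lemma IsModel.raIntensity_eq (h : C.IsModel P) :
    C.raIntensity P = ENNReal.ofReal (s.lamU * s.cellSearchProb) := by
  rw [raIntensity, h.measure_cellSearch, ← ENNReal.ofReal_mul s.lamU_pos.le]

end Cycle

end MmWave

namespace MmWave

/-! ### Random access at a given base station -/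

lemma isProbabilityMeasure_finUniform {n : ℕ} (hn : 0 < n) : IsProbabilityMeasure (finUniform n) := by
  refine ⟨?_⟩
  rw [finUniform, Measure.smul_apply, Measure.count_univ, smul_eq_mul, ENat.card_eq_coe_fintype_card,
    Fintype.card_fin]
  simp only [ENat.toENNReal_coe]
  exact ENNReal.inv_mul_cancel (by exact_mod_cast hn.ne') (ENNReal.natCast_ne_top n)

lemma finUniform_singleton {n : ℕ} (a : Fin n) : finUniform n {a} = (n : ℝ≥0∞)⁻¹ := by
  simp [finUniform]

lemma one_div_natCast_le_one (n : ℕ) : (1 : ℝ) / n ≤ 1 := by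
  rcases Nat.eq_zero_or_pos n with rfl | hn
  · simp
  · rw [div_le_one (by exact_mod_cast hn)]
    exact_mod_cast hn

instance isProbabilityMeasure_bernoulliInv (n : ℕ) : IsProbabilityMeasure (bernoulliInv n) := by
  refine ⟨?_⟩
  simp only [bernoulliInv, Measure.add_apply, Measure.smul_apply, measure_univ, smul_eq_mul, mul_one]
  rw [← ENNReal.ofReal_add (by positivity) (sub_nonneg.2 (one_div_natCast_le_one n))]
  simp

lemma lintegral_bernoulliInv (n : ℕ) (f : Bool → ℝ≥0∞) :
    ∫⁻ b, f b ∂bernoulliInv n =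
      ENNReal.ofReal (1 / n) * f true + ENNReal.ofReal (1 - 1 / n) * f false := by
  rw [bernoulliInv, lintegral_add_measure, lintegral_smul_measure, lintegral_smul_measure,
    lintegral_dirac, lintegral_dirac, smul_eq_mul, smul_eq_mul]

/-- The void probabilities of a Poisson process. -/
lemma IsPoissonLaw.measure_eq_zero {E : Type*} [MeasurableSpace E] {Q : Measure (Measure E)}
    {μ : Measure E} [SigmaFinite μ] (h : IsPoissonLaw Q μ) {A : Set E} (hA : MeasurableSet A) :
    Q {N | N A = 0} = eNeg (μ A) := by
  have hf : Measurable fun p : E => ∞ * A.indicator (1 : E → ℝ≥0∞) p :=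
    (measurable_one.indicator hA).const_mul _
  have h1 := h.lintegral_eNeg hf
  have h2 : ∀ p : E, 1 - eNeg (∞ * A.indicator (1 : E → ℝ≥0∞) p) = A.indicator 1 p := by
    intro p
    by_cases hp : p ∈ A <;> simp [hp, eNeg_top, eNeg_zero]
  simp_rw [h2] at h1
  rw [lintegral_indicator_one hA] at h1
  have hm : MeasurableSet {N : Measure E | N A = 0} :=
    Measure.measurable_coe hA (measurableSet_singleton 0)
  rw [← h1, ← lintegral_indicator_one hm]
  refine lintegral_congr fun N => ?_
  rw [lintegral_const_mul _ (measurable_one.indicator hA), lintegral_indicator_one hA]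
  by_cases hN : N A = 0
  · simp [indicator, hN, eNeg_zero]
  · simp [indicator, hN, ENNReal.top_mul, eNeg_top]

namespace Network

variable (s : Network)

lemma N_pos : 0 < s.N := lt_max_of_lt_left s.Ncs_pos

instance : IsProbabilityMeasure (finUniform s.Npa) := isProbabilityMeasure_finUniform s.Npa_pos

instance : IsProbabilityMeasure (finUniform s.Mra) := isProbabilityMeasure_finUniform s.Mra_pos

lemma sideGain_nonneg {n : ℕ} (hn : 0 < n) : 0 ≤ s.sideGain (2 * Real.pi / n) := by
  have hpi := Real.pi_pos
  have hC := s.C0_pos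
  have hn' : (0 : ℝ) < n := by exact_mod_cast hn
  unfold sideGain
  split_ifs with h
  · exact le_rfl
  · have h1 : 2 * Real.pi / n < 2 * Real.pi :=
      lt_of_le_of_ne (div_le_self (by positivity) (by exact_mod_cast hn)) h
    have h2 : 0 < 2 * Real.pi - 2 * Real.pi / n := by linarith
    positivity

/-- The main lobe gain of the users in random access. -/
def raMain : ℝ := s.mainGain (2 * Real.pi / s.N)

/-- The side lobe gain of the users in random access. -/
def raSide : ℝ := s.sideGain (2 * Real.pi / s.N)

lemma raMain_pos : 0 < s.raMain := s.mainGain_pos s.N_pos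

lemma raSide_nonneg : 0 ≤ s.raSide := s.sideGain_nonneg s.N_pos

end Network

variable (s : Network)

/-- The intensity measure of the potential interferers, if `c` is the intensity of the users in random
access. -/
def userMeasure (c : ℝ) : Measure (RAUser s) :=
  ENNReal.ofReal c • (volume : Measure ℂ).prod ((finUniform s.Npa).prod
      (unitUniform.prod ((bernoulliInv s.N).prod (expMeasure 1))))

/-- The intensity measure of the users that can collide, if `c` is the intensity of the users in random
access. -/
def cellMeasure (c : ℝ) : Measure (CellUser s) :=
  ENNReal.ofReal c • ((volume : Measure ℂ).restrict s.cell).prod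
      ((finUniform s.Npa).prod (finUniform s.Mra))

instance (c : ℝ) : SigmaFinite (userMeasure s c) := by
  unfold userMeasure
  exact sigmaFinite_smul _ ENNReal.ofReal_ne_top

instance (c : ℝ) : SigmaFinite (cellMeasure s c) := by
  unfold cellMeasure
  exact sigmaFinite_smul _ ENNReal.ofReal_ne_top

/-! #### The main lobes of the interferers -/

lemma measurableSet_inMainLobe :
    MeasurableSet {x : ℂ × RAUser s | Cycle.InMainLobe x.1 x.2} := by
  have h1 : Measurable fun x : ℂ × RAUser s => x.2.2.2.2.1 :=
    measurable_fst.comp (measurable_snd.comp (measurable_snd.comp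
      (measurable_snd.comp measurable_snd)))
  have hA : MeasurableSet {x : ℂ × RAUser s | s.Nra = 1 ∧ x.2.2.2.2.1 = true} :=
    (MeasurableSet.const _).inter (h1 (measurableSet_singleton true))
  have hB : MeasurableSet {x : ℂ × RAUser s | s.Nra ≠ 1 ∧
      ∃ n : Fin s.Nra, x.1 ∈ beam 0 s.Nra n ∧ x.1 ∈ beam x.2.1 s.Nra n} := by
    refine (MeasurableSet.const _).inter ?_
    have : {x : ℂ × RAUser s | ∃ n : Fin s.Nra, x.1 ∈ beam 0 s.Nra n ∧ x.1 ∈ beam x.2.1 s.Nra n} =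
        ⋃ n : Fin s.Nra, {x | x.1 ∈ beam 0 s.Nra n} ∩ {x | x.1 ∈ beam x.2.1 s.Nra n} := by
      ext x; simp
    refine (congrArg MeasurableSet this).mpr (MeasurableSet.iUnion fun n => ?_)
    have h2 : Measurable fun x : ℂ × RAUser s => (x.2.1, x.1) :=
      (measurable_fst.comp measurable_snd).prodMk measurable_fst
    exact (measurable_fst (measurableSet_beam_zero n.2)).inter (h2 (measurableSet_beam_prod n.2))
  exact hA.union hB

lemma measurable_userGain : Measurable fun x : ℂ × RAUser s => Cycle.userGain x.1 x.2 :=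
  Measurable.ite (measurableSet_inMainLobe s) measurable_const measurable_const

lemma lintegral_beam_shift (x : ℂ) {k m : ℕ} (hm : m < k) (f : ℂ → ℝ≥0∞) :
    ∫⁻ y in beam x k m, f (y - x) = ∫⁻ w in beam 0 k m, f w := by
  have hb : MeasurableSet (beam 0 k m) := measurableSet_beam_zero hm
  have hb' : MeasurableSet (beam x k m) := by
    have : beam x k m = (fun y => y - x) ⁻¹' beam 0 k m := by
      ext y; exact mem_beam_iff_sub _ _ _ _
    rw [this]
    exact (measurable_id.sub_const x) hb
  rw [← lintegral_indicator hb, ← lintegral_indicator hb',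
    ← lintegral_sub_right_eq_self ((beam 0 k m).indicator f) x]
  refine lintegral_congr fun y => ?_
  by_cases h : y - x ∈ beam 0 k m
  · rw [indicator_of_mem h, indicator_of_mem ((mem_beam_iff_sub x y k m).2 h)]
  · rw [indicator_of_notMem h, indicator_of_notMem fun h' => h ((mem_beam_iff_sub x y k m).1 h')]

/-- The interferers received under one beam, split according to their own beams: a fraction `1 / N`
covers the base station with its main lobe. For fixed user beams this is the law of the mark. For swept
user beams the single receive beam is the whole plane, and the interferers whose main lobe covers the
base station `x` are those in the reflection of the beam of `0` that contains `x`; this beam is the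
fraction `1 / Nra` of the plane. The fading has no influence on the lobes and is put to `0`. -/
lemma lintegral_mainLobe (hproto : s.Nra = 1 ∨ (s.Mra = 1 ∧ s.Ncs = 1)) {x : ℂ} (hx : x ≠ 0)
    (m : Fin s.Mra) (a : Fin s.Npa) {ψ₁ ψ₂ : ℝ → ℝ≥0∞} (h₁ : Measurable ψ₁) (h₂ : Measurable ψ₂) :
    ∫⁻ y in beam x s.Mra m, ∫⁻ u, ∫⁻ b, (open Classical in
        if Cycle.InMainLobe (s := s) x (y, a, u, b, 0) then ψ₁ (s.loss ‖y - x‖ u)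
          else ψ₂ (s.loss ‖y - x‖ u)) ∂bernoulliInv s.N ∂unitUniform =
      ENNReal.ofReal (2 * Real.pi / (s.N * s.Mra)) * s.mix ψ₁ +
        ENNReal.ofReal (2 * Real.pi * (1 - 1 / s.N) / s.Mra) * s.mix ψ₂ := by
  classical
  have hpi := Real.pi_pos
  have hN : (0 : ℝ) < s.N := by exact_mod_cast s.N_pos
  have hM : (0 : ℝ) < s.Mra := by exact_mod_cast s.Mra_pos
  have hN1 : 0 ≤ 1 - 1 / (s.N : ℝ) := sub_nonneg.2 (one_div_natCast_le_one s.N)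
  by_cases hNra : s.Nra = 1
  · have e : ∀ (y : ℂ) (u : ℝ), ∫⁻ b, (if Cycle.InMainLobe (s := s) x (y, a, u, b, 0) then
        ψ₁ (s.loss ‖y - x‖ u) else ψ₂ (s.loss ‖y - x‖ u)) ∂bernoulliInv s.N =
        ENNReal.ofReal (1 / s.N) * ψ₁ (s.loss ‖y - x‖ u) +
          ENNReal.ofReal (1 - 1 / s.N) * ψ₂ (s.loss ‖y - x‖ u) := by
      intro y u
      rw [lintegral_bernoulliInv]
      simp [Cycle.InMainLobe, hNra]
    simp_rw [e]
    have hm1 : Measurable fun l => ENNReal.ofReal (1 / s.N) * ψ₁ l := h₁.const_mul _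
    have hm2 : Measurable fun l => ENNReal.ofReal (1 - 1 / s.N) * ψ₂ l := h₂.const_mul _
    have hm : Measurable fun l =>
        ENNReal.ofReal (1 / s.N) * ψ₁ l + ENNReal.ofReal (1 - 1 / s.N) * ψ₂ l := hm1.add hm2
    have hsh := lintegral_beam_shift x m.2 fun w => ∫⁻ u, (ENNReal.ofReal (1 / s.N) * ψ₁ (s.loss ‖w‖ u) +
          ENNReal.ofReal (1 - 1 / s.N) * ψ₂ (s.loss ‖w‖ u)) ∂unitUniform
    rw [hsh, s.lintegral_loss_beam m.2 hm, s.mix_add hm1 hm2, s.mix_const_mul h₁, s.mix_const_mul h₂,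
      mul_add, ← mul_assoc, ← mul_assoc, ← ENNReal.ofReal_mul (by positivity),
      ← ENNReal.ofReal_mul (by positivity)]
    congr 3 <;> field_simp
  · obtain ⟨hMra, hNcs⟩ := hproto.resolve_left hNra
    have hNN : s.N = s.Nra := by
      rw [Network.N, hNcs]; exact max_eq_right s.Nra_pos
    -- `n₀` is the beam index with which the typical user covers the base station
    obtain ⟨n₀, hn₀, huniq⟩ := existsUnique_mem_beam s.Nra_pos hx
    have hiff : ∀ (y : ℂ) (u : ℝ) (b : Bool), Cycle.InMainLobe (s := s) x (y, a, u, b, 0) ↔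
        x - y ∈ beam 0 s.Nra n₀ := by
      intro y u b
      simp only [Cycle.InMainLobe, hNra, false_and, false_or, ne_eq, not_false_eq_true, true_and]
      constructor
      · rintro ⟨n, hn, hn'⟩
        rw [← huniq n hn]
        exact (mem_beam_iff_sub _ _ _ _).1 hn'
      · exact fun h => ⟨n₀, hn₀, (mem_beam_iff_sub _ _ _ _).2 h⟩
    simp_rw [hiff, lintegral_const, measure_univ, mul_one]
    -- the only receive beam is the plane without `x`
    have hae : ∫⁻ y in beam x s.Mra m, ∫⁻ u, (if x - y ∈ beam 0 s.Nra n₀ then ψ₁ (s.loss ‖y - x‖ u)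
        else ψ₂ (s.loss ‖y - x‖ u)) ∂unitUniform =
        ∫⁻ y, ∫⁻ u, (if x - y ∈ beam 0 s.Nra n₀ then ψ₁ (s.loss ‖x - y‖ u)
        else ψ₂ (s.loss ‖x - y‖ u)) ∂unitUniform := by
      simp_rw [norm_sub_rev x]
      refine (setLIntegral_congr (t := univ) ?_).trans (setLIntegral_univ _)
      refine Filter.eventuallyEq_univ.2 ?_
      have h0 : ∀ᵐ y : ℂ, y ≠ x := by simp [ae_iff]
      filter_upwards [h0] with y hy
      obtain ⟨j, hj, -⟩ := existsUnique_mem_beam (k := s.Mra) s.Mra_pos (sub_ne_zero.2 hy)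
      have : j = m := Fin.ext (by have := j.2; have := m.2; omega)
      rw [this] at hj
      exact (mem_beam_iff_sub _ _ _ _).2 hj
    rw [hae, lintegral_sub_left_eq_self (fun w => ∫⁻ u, (if w ∈ beam 0 s.Nra n₀ then ψ₁ (s.loss ‖w‖ u)
        else ψ₂ (s.loss ‖w‖ u)) ∂unitUniform) x]
    have hcover : (⋃ n : Fin s.Nra, beam 0 s.Nra n) =ᵐ[volume] univ := by
      refine Filter.eventuallyEq_univ.2 ?_
      have h0 : ∀ᵐ y : ℂ, y ≠ 0 := by simp [ae_iff]
      filter_upwards [h0] with y hy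
      obtain ⟨j, hj, -⟩ := existsUnique_mem_beam (k := s.Nra) s.Nra_pos hy
      exact mem_iUnion.2 ⟨j, hj⟩
    rw [← setLIntegral_univ, ← setLIntegral_congr hcover,
      lintegral_iUnion (fun n : Fin s.Nra => measurableSet_beam_zero n.2)
        (fun i j hij => disjoint_beam hij), tsum_fintype,
      ← Finset.add_sum_erase _ _ (Finset.mem_univ n₀)]
    have hmain : ∫⁻ w in beam 0 s.Nra n₀, ∫⁻ u, (if w ∈ beam 0 s.Nra n₀ then ψ₁ (s.loss ‖w‖ u)
        else ψ₂ (s.loss ‖w‖ u)) ∂unitUniform = ENNReal.ofReal (2 * Real.pi / s.Nra) * s.mix ψ₁ := by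
      rw [← s.lintegral_loss_beam n₀.2 h₁]
      refine setLIntegral_congr_fun (measurableSet_beam_zero n₀.2) fun w hw => ?_
      simp only [hw, if_true]
    have hside : ∀ n ∈ Finset.univ.erase n₀, ∫⁻ w in beam 0 s.Nra n, ∫⁻ u,
        (if w ∈ beam 0 s.Nra n₀ then ψ₁ (s.loss ‖w‖ u)
        else ψ₂ (s.loss ‖w‖ u)) ∂unitUniform = ENNReal.ofReal (2 * Real.pi / s.Nra) * s.mix ψ₂ := by
      intro n hn
      rw [← s.lintegral_loss_beam n.2 h₂]
      refine setLIntegral_congr_fun (measurableSet_beam_zero n.2) fun w hw => ?_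
      have : w ∉ beam 0 s.Nra n₀ :=
        Set.disjoint_left.1 (disjoint_beam (Finset.ne_of_mem_erase hn)) hw
      simp only [this, if_false]
    rw [hmain, Finset.sum_congr rfl hside, Finset.sum_const, Finset.card_erase_of_mem (Finset.mem_univ _),
      Finset.card_univ, Fintype.card_fin, nsmul_eq_mul, ← mul_assoc, ← ENNReal.ofReal_natCast,
      ← ENNReal.ofReal_mul (by positivity), hNN, hMra]
    rw [hNN] at hN
    congr 3
    · simp
    · rw [Nat.cast_sub s.Nra_pos]
      push_cast
      field_simp

end MmWave

namespace MmWave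

variable (s : Network)

/-! #### The preamble SINR -/

/-- The power received from the user `u` at a base station at `x`, relative to the transmit power. -/
def userPower (x : ℂ) (u : RAUser s) : ℝ≥0∞ :=
  ENNReal.ofReal (u.2.2.2.2 * s.Mra * Cycle.userGain x u / s.loss ‖u.1 - x‖ u.2.2.1)

/-- The users with preamble `a` that are received under the `m`-th beam of a base station at `x`. -/
def interferers (x : ℂ) (a : Fin s.Npa) (m : Fin s.Mra) : Set (RAUser s) :=
  {u | u.2.1 = a ∧ u.1 ∈ beam x s.Mra m}

/-- The event that the preamble `a` of the typical user reaches the SINR threshold at the base station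
`x.1` under its beam `m`, if the users are given by `x.2.1` and the uplink fading is `x.2.2`. -/
def sinrSet (a : Fin s.Npa) (m : Fin s.Mra) : Set (BS × (Measure (RAUser s) × ℝ)) :=
  {x | ENNReal.ofReal s.Gra ≤
    ENNReal.ofReal (x.2.2 * s.Mra * s.raMain / Cycle.bsLoss s x.1) /
      ((∫⁻ u in interferers s x.1.1 a m, userPower s x.1.1 u
          ∂locKernel (userMeasure s (s.lamU * s.cellSearchProb)) x.2.1) +
        ENNReal.ofReal (s.noise / s.Pu))}

lemma measurable_userPower : Measurable fun x : ℂ × RAUser s => userPower s x.1 x.2 := by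
  have h1 : Measurable fun x : ℂ × RAUser s => s.loss ‖x.2.1 - x.1‖ x.2.2.2.1 :=
    s.measurable_loss.comp ((((measurable_fst.comp measurable_snd).sub measurable_fst).norm).prodMk
      (measurable_fst.comp (measurable_snd.comp (measurable_snd.comp measurable_snd))))
  have h2 : Measurable fun x : ℂ × RAUser s => x.2.2.2.2.2 :=
    measurable_snd.comp (measurable_snd.comp (measurable_snd.comp
      (measurable_snd.comp measurable_snd)))
  exact (((h2.mul_const _).mul (measurable_userGain s)).div h1).ennreal_ofReal

lemma measurable_userPower_right (x : ℂ) : Measurable fun u => userPower s x u :=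
  Measurable.comp (g := fun x : ℂ × RAUser s => userPower s x.1 x.2) (f := Prod.mk x)
    (measurable_userPower s) measurable_prodMk_left

lemma measurableSet_interferers_prod (a : Fin s.Npa) (m : Fin s.Mra) :
    MeasurableSet {x : ℂ × RAUser s | x.2 ∈ interferers s x.1 a m} := by
  have h1 : Measurable fun x : ℂ × RAUser s => (x.1, x.2.1) :=
    measurable_fst.prodMk (measurable_fst.comp measurable_snd)
  have h2 : Measurable fun x : ℂ × RAUser s => x.2.2.1 :=
    measurable_fst.comp (measurable_snd.comp measurable_snd)
  exact (h2 (measurableSet_singleton a)).inter (h1 (measurableSet_beam_prod m.2))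

lemma measurableSet_interferers (x : ℂ) (a : Fin s.Npa) (m : Fin s.Mra) :
    MeasurableSet (interferers s x a m) :=
  measurable_prodMk_left (measurableSet_interferers_prod s a m)

lemma measurableSet_sinrSet (a : Fin s.Npa) (m : Fin s.Mra) : MeasurableSet (sinrSet s a m) := by
  have h1 : Measurable fun x : (BS × (Measure (RAUser s) × ℝ)) × RAUser s => (x.1.1.1, x.2) :=
    (measurable_fst.comp (measurable_fst.comp measurable_fst)).prodMk measurable_snd
  have h2 : Measurable fun x : BS × (Measure (RAUser s) × ℝ) =>
      ∫⁻ u in interferers s x.1.1 a m, userPower s x.1.1 u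
          ∂locKernel (userMeasure s (s.lamU * s.cellSearchProb)) x.2.1 := by
    have h3 := measurable_lintegral_locKernel (userMeasure s (s.lamU * s.cellSearchProb))
      (g := fun x : BS × (Measure (RAUser s) × ℝ) => x.2.1)
      (measurable_fst.comp measurable_snd)
      (((measurable_userPower s).indicator (measurableSet_interferers_prod s a m)).comp h1)
    have e : (fun x : BS × (Measure (RAUser s) × ℝ) =>
        ∫⁻ u in interferers s x.1.1 a m, userPower s x.1.1 u
          ∂locKernel (userMeasure s (s.lamU * s.cellSearchProb)) x.2.1) = fun x =>
        ∫⁻ u, ((({x : ℂ × RAUser s | x.2 ∈ interferers s x.1 a m}.indicator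
          fun x => userPower s x.1 x.2) ∘
            fun x : (BS × (Measure (RAUser s) × ℝ)) × RAUser s => (x.1.1.1, x.2)) (x, u))
          ∂locKernel (userMeasure s (s.lamU * s.cellSearchProb)) x.2.1 := by
      funext x
      rw [← lintegral_indicator (measurableSet_interferers s _ a m)]
      rfl
    rw [e]
    exact h3
  have h4 : Measurable fun x : BS × (Measure (RAUser s) × ℝ) =>
      ENNReal.ofReal (x.2.2 * s.Mra * s.raMain / Cycle.bsLoss s x.1) /
      ((∫⁻ u in interferers s x.1.1 a m, userPower s x.1.1 u
          ∂locKernel (userMeasure s (s.lamU * s.cellSearchProb)) x.2.1) +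
        ENNReal.ofReal (s.noise / s.Pu)) :=
    ((((measurable_snd.comp measurable_snd).mul_const _).mul_const _).div
      ((measurable_bsLoss s).comp measurable_fst)).ennreal_ofReal.div (h2.add_const _)
  exact measurableSet_le measurable_const h4

lemma lintegral_userMeasure_interferers {x : ℂ} (a : Fin s.Npa) (m : Fin s.Mra) {c : ℝ}
    {f : RAUser s → ℝ≥0∞} (hf : Measurable f) :
    ∫⁻ u in interferers s x a m, f u ∂userMeasure s c =
      ENNReal.ofReal c * ((s.Npa : ℝ≥0∞)⁻¹ * ∫⁻ y in beam x s.Mra m, ∫⁻ u, ∫⁻ b, ∫⁻ F,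
        f (y, a, u, b, F) ∂expMeasure 1 ∂bernoulliInv s.N ∂unitUniform) := by
  have e : interferers s x a m = beam x s.Mra m ×ˢ ({a} ×ˢ univ) := by
    ext u
    simp only [interferers, mem_ofPred_eq, mem_prod, mem_singleton_iff, mem_univ, and_true]
    exact and_comm
  rw [e, userMeasure, Measure.restrict_smul, lintegral_smul_measure, ← Measure.prod_restrict,
    ← Measure.prod_restrict, Measure.restrict_univ, lintegral_prod _ hf.aemeasurable, smul_eq_mul]
  congr 1
  rw [← lintegral_const_mul' _ _ (by simp [s.Npa_pos.ne'])]
  refine lintegral_congr fun y => ?_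
  have hf1 : Measurable fun v => f (y, v) := hf.comp measurable_prodMk_left
  rw [lintegral_prod _ hf1.aemeasurable, lintegral_singleton, finUniform_singleton, mul_comm]
  congr 1
  have hf2 : Measurable fun w => f (y, a, w) := hf1.comp measurable_prodMk_left
  rw [lintegral_prod _ hf2.aemeasurable]
  refine lintegral_congr fun u => ?_
  have hf3 : Measurable fun w => f (y, a, u, w) := hf2.comp measurable_prodMk_left
  rw [lintegral_prod _ hf3.aemeasurable]

open Classical in
/-- The Laplace exponent of one interferer, after integration over its fading. -/
lemma lintegral_userPower {x y : ℂ} (hy : y ≠ x) (a : Fin s.Npa) (u : ℝ) (b : Bool) {z : ℝ}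
    (hz : 0 < z) :
    ∫⁻ F, (1 - eNeg (ENNReal.ofReal (s.Gra * z / (s.Mra * s.raMain)) *
        userPower s x (y, a, u, b, F))) ∂expMeasure 1 =
      if Cycle.InMainLobe (s := s) x (y, a, u, b, 0) then
        ENNReal.ofReal (s.Gra * z / (s.Gra * z + s.loss ‖y - x‖ u))
      else ENNReal.ofReal (s.raSide / s.raMain * s.Gra * z /
        (s.raSide / s.raMain * s.Gra * z + s.loss ‖y - x‖ u)) := by
  have hG := s.Gra_pos
  have hmain := s.raMain_pos
  have hside := s.raSide_nonneg
  have hM : (0 : ℝ) < s.Mra := by exact_mod_cast s.Mra_pos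
  have hl : 0 < s.loss ‖y - x‖ u := s.loss_pos (norm_pos_iff.2 (sub_ne_zero.2 hy)) u
  have key : ∀ g : ℝ, 0 ≤ g → (∀ F : ℝ, Cycle.userGain x ((y, a, u, b, F) : RAUser s) = g) →
      ∫⁻ F, (1 - eNeg (ENNReal.ofReal (s.Gra * z / (s.Mra * s.raMain)) *
        userPower s x (y, a, u, b, F))) ∂expMeasure 1 =
        ENNReal.ofReal (g / s.raMain * s.Gra * z / (g / s.raMain * s.Gra * z + s.loss ‖y - x‖ u)) := by
    intro g hg hgain
    rw [← lintegral_one_sub_eNeg hl (c := g / s.raMain * s.Gra * z) (by positivity)]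
    refine lintegral_congr fun F => ?_
    rw [userPower, hgain F, ← ENNReal.ofReal_mul (by positivity),
      ← ENNReal.ofReal_mul (by positivity)]
    congr 3
    change s.Gra * z / (s.Mra * s.raMain) * (F * s.Mra * g / s.loss ‖y - x‖ u) = _
    generalize s.loss ‖y - x‖ u = l at hl
    generalize s.raMain = G at hmain
    field_simp
  by_cases hL : Cycle.InMainLobe (s := s) x (y, a, u, b, 0)
  · rw [if_pos hL, key s.raMain hmain.le (fun F => if_pos hL), div_self hmain.ne', one_mul]
  · rw [if_neg hL, key s.raSide hside (fun F => if_neg hL)]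

/-- The Laplace exponent of the interference under one beam. -/
lemma lintegral_interferers (hproto : s.Nra = 1 ∨ (s.Mra = 1 ∧ s.Ncs = 1)) {x : ℂ} (hx : x ≠ 0)
    (a : Fin s.Npa) (m : Fin s.Mra) {c z : ℝ} (hc : 0 ≤ c) (hz : 0 < z) :
    ∫⁻ u in interferers s x a m, (1 - eNeg (ENNReal.ofReal (s.Gra * z / (s.Mra * s.raMain)) *
        userPower s x u)) ∂userMeasure s c =
      ENNReal.ofReal (2 * Real.pi * (c / (s.N * s.Mra * s.Npa))) *
          s.mix (fun l => ENNReal.ofReal (s.Gra * z / (s.Gra * z + l))) +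
        ENNReal.ofReal (2 * Real.pi * ((1 - 1 / s.N) * (c / (s.Mra * s.Npa)))) *
          s.mix (fun l => ENNReal.ofReal (s.raSide / s.raMain * s.Gra * z /
            (s.raSide / s.raMain * s.Gra * z + l))) := by
  classical
  have hpi := Real.pi_pos
  have hN : (0 : ℝ) < s.N := by exact_mod_cast s.N_pos
  have hM : (0 : ℝ) < s.Mra := by exact_mod_cast s.Mra_pos
  have hA : (0 : ℝ) < s.Npa := by exact_mod_cast s.Npa_pos
  have hN1 : 0 ≤ 1 - 1 / (s.N : ℝ) := sub_nonneg.2 (one_div_natCast_le_one s.N)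
  have hψ : ∀ d : ℝ, Measurable fun l : ℝ => ENNReal.ofReal (d / (d + l)) := fun d =>
    (measurable_const.div (measurable_const.add measurable_id)).ennreal_ofReal
  have hpow := measurable_userPower_right s x
  have hf : Measurable fun u => 1 - eNeg (ENNReal.ofReal (s.Gra * z / (s.Mra * s.raMain)) *
      userPower s x u) := measurable_const.sub (measurable_eNeg.comp (hpow.const_mul _))
  rw [lintegral_userMeasure_interferers s a m hf]
  have h0 : ∀ᵐ y : ℂ, y ≠ x := by simp [ae_iff]
  have hae : ∀ᵐ y ∂(volume : Measure ℂ).restrict (beam x s.Mra m), y ≠ x := ae_restrict_of_ae h0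
  rw [lintegral_congr_ae (hae.mono fun y hy => lintegral_congr fun u => lintegral_congr fun b =>
      lintegral_userPower s hy a u b hz),
    lintegral_mainLobe s hproto hx m a (hψ (s.Gra * z)) (hψ (s.raSide / s.raMain * s.Gra * z)),
    ← mul_assoc, mul_add, ← mul_assoc, ← mul_assoc, ← ENNReal.ofReal_natCast s.Npa,
    ← ENNReal.ofReal_inv_of_pos hA, ← ENNReal.ofReal_mul hc, ← ENNReal.ofReal_mul (by positivity),
    ← ENNReal.ofReal_mul (by positivity)]
  have e1 : c * (s.Npa : ℝ)⁻¹ * (2 * Real.pi / (s.N * s.Mra)) =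
      2 * Real.pi * (c / (s.N * s.Mra * s.Npa)) := by field_simp
  have e2 : c * (s.Npa : ℝ)⁻¹ * (2 * Real.pi * (1 - 1 / s.N) / s.Mra) =
      2 * Real.pi * ((1 - 1 / s.N) * (c / (s.Mra * s.Npa))) := by field_simp
  rw [e1, e2]

/-- The threshold condition for the preamble solved for the uplink fading. -/
lemma ofReal_le_div_iff {G z M g F : ℝ} (hG : 0 < G) (hz : 0 < z) (hM : 0 < M) (hg : 0 < g)
    (hF : 0 < F) (D : ℝ≥0∞) :
    ENNReal.ofReal G ≤ ENNReal.ofReal (F * M * g / z) / D ↔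
      ENNReal.ofReal (G * z / (M * g)) * D ≤ ENNReal.ofReal F := by
  have hk : 0 < M * g / z := by positivity
  have hk0 : ENNReal.ofReal (M * g / z) ≠ 0 := by simpa using hk
  have hFk : ENNReal.ofReal (F * (M * g / z)) ≠ 0 := by simpa using mul_pos hF hk
  have e1 : F * M * g / z = F * (M * g / z) := by ring
  have e2 : ENNReal.ofReal G = ENNReal.ofReal (G * z / (M * g)) * ENNReal.ofReal (M * g / z) := by
    rw [← ENNReal.ofReal_mul (by positivity)]
    congr 1
    field_simp
  rw [e1, ENNReal.le_div_iff_mul_le (Or.inr hFk) (Or.inr ENNReal.ofReal_ne_top), e2,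
    ENNReal.ofReal_mul hF.le, mul_right_comm]
  exact ENNReal.mul_le_mul_iff_left hk0 ENNReal.ofReal_ne_top

/-- The probability that the preamble of the typical user reaches the SINR threshold: over the uplink
fading it is an exponential of the interference, whose mean is a Laplace functional. -/
lemma lintegral_sinrSet (hproto : s.Nra = 1 ∨ (s.Mra = 1 ∧ s.Ncs = 1))
    {Q : Measure (Measure (RAUser s))}
    (hQ : IsPoissonLaw Q (userMeasure s (s.lamU * s.cellSearchProb)))
    (hcs : 0 ≤ s.cellSearchProb) {p : BS} (hp : p.1 ≠ 0) (a : Fin s.Npa) (m : Fin s.Mra) :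
    (Q.prod (expMeasure 1)) {y | (p, y) ∈ sinrSet s a m} =
      ENNReal.ofReal (s.Pra (Cycle.bsLoss s p)) := by
  classical
  have := hQ.isProbabilityMeasure
  have hz : 0 < Cycle.bsLoss s p := s.loss_pos (norm_pos_iff.2 hp) _
  generalize hzdef : Cycle.bsLoss s p = z at hz ⊢
  have hG := s.Gra_pos
  have hmain := s.raMain_pos
  have hPu := s.Pu_pos
  have hnoise := s.noise_nonneg
  have hM : (0 : ℝ) < s.Mra := by exact_mod_cast s.Mra_pos
  have hset : MeasurableSet {y : Measure (RAUser s) × ℝ | (p, y) ∈ sinrSet s a m} :=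
    measurable_prodMk_left (measurableSet_sinrSet s a m)
  let θ : ℝ := s.Gra * z / (s.Mra * s.raMain)
  have hθ : 0 ≤ θ := by positivity
  have hI := measurableSet_interferers s p.1 a m
  have hpow := measurable_userPower_right s p.1
  rw [Measure.prod_apply hset]
  have h1 : ∀ N ∈ locFinite (userMeasure s (s.lamU * s.cellSearchProb)),
      expMeasure 1 (Prod.mk N ⁻¹' {y | (p, y) ∈ sinrSet s a m}) =
        eNeg (∫⁻ u, (interferers s p.1 a m).indicator
          (fun u => ENNReal.ofReal θ * userPower s p.1 u) u ∂N) *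
          eNeg (ENNReal.ofReal (θ * (s.noise / s.Pu))) := by
    intro N hN
    rw [lintegral_indicator hI, lintegral_const_mul _ hpow, ENNReal.ofReal_mul hθ, ← eNeg_add,
      ← mul_add, ← expMeasure_tail]
    refine measure_congr ?_
    filter_upwards [ae_expMeasure_pos] with F hF
    refine propext (Iff.trans ?_ (ofReal_le_div_iff hG hz hM hmain hF
      ((∫⁻ u in interferers s p.1 a m, userPower s p.1 u ∂N) + ENNReal.ofReal (s.noise / s.Pu))))
    change ENNReal.ofReal s.Gra ≤ ENNReal.ofReal (F * s.Mra * s.raMain / Cycle.bsLoss s p) /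
      ((∫⁻ u in interferers s p.1 a m, userPower s p.1 u
          ∂locKernel (userMeasure s (s.lamU * s.cellSearchProb)) N) +
        ENNReal.ofReal (s.noise / s.Pu)) ↔ _
    rw [locKernel_of_mem hN, hzdef]
  rw [lintegral_congr_ae (hQ.ae_mem_locFinite.mono h1), lintegral_mul_const' _ _ (by simp [eNeg])]
  have hf : Measurable ((interferers s p.1 a m).indicator
      fun u => ENNReal.ofReal θ * userPower s p.1 u) := (hpow.const_mul _).indicator hI
  rw [hQ.lintegral_eNeg hf]
  have h2 : ∫⁻ u, (1 - eNeg ((interferers s p.1 a m).indicator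
      (fun u => ENNReal.ofReal θ * userPower s p.1 u) u)) ∂userMeasure s (s.lamU * s.cellSearchProb) =
      ∫⁻ u in interferers s p.1 a m, (1 - eNeg (ENNReal.ofReal θ * userPower s p.1 u))
        ∂userMeasure s (s.lamU * s.cellSearchProb) := by
    rw [← lintegral_indicator hI]
    refine lintegral_congr fun u => ?_
    by_cases hu : u ∈ interferers s p.1 a m <;> simp [hu, eNeg_zero]
  rw [h2, lintegral_interferers s hproto hp a m (mul_nonneg s.lamU_pos.le hcs) hz, eNeg_add]
  simp only [eNeg]
  rw [expNeg_ofReal (by positivity), ← ENNReal.ofReal_mul (expNeg_nonneg _),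
    ← ENNReal.ofReal_mul (mul_nonneg (expNeg_nonneg _) (expNeg_nonneg _))]
  congr 1
  rw [Network.Pra, s.U_eq, s.U_eq]
  have e3 : θ * (s.noise / s.Pu) =
      s.Gra * z * s.noise / (s.Pu * s.Mra * s.mainGain (2 * Real.pi / s.N)) := by
    simp only [θ, Network.raMain]
    rw [div_mul_div_comm]
    congr 1; ring
  rw [e3]
  simp only [Network.raMain, Network.raSide]
  ring

/-! #### Preamble collisions -/

/-- The users of the tagged cell with preamble `a` and receive beam `m`. -/
def colliders (a : Fin s.Npa) (m : Fin s.Mra) : Set (CellUser s) := {v | v.2.1 = a ∧ v.2.2 = m}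

lemma measurableSet_colliders (a : Fin s.Npa) (m : Fin s.Mra) : MeasurableSet (colliders s a m) :=
  ((measurable_fst.comp measurable_snd) (measurableSet_singleton a)).inter
    ((measurable_snd.comp measurable_snd) (measurableSet_singleton m))

/-- No collision is a void event of the process of the users of the tagged cell. -/
lemma measure_noCollision {Q : Measure (Measure (CellUser s))}
    (hQ : IsPoissonLaw Q (cellMeasure s (s.lamU * s.cellSearchProb))) (hcs : 0 ≤ s.cellSearchProb)
    (a : Fin s.Npa) (m : Fin s.Mra) :
    Q {N | N (colliders s a m) = 0} = ENNReal.ofReal s.Pco := by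
  have hlam := s.lamB_pos
  have hlamU := s.lamU_pos
  have hM : (0 : ℝ) < s.Mra := by exact_mod_cast s.Mra_pos
  have hA : (0 : ℝ) < s.Npa := by exact_mod_cast s.Npa_pos
  have e : colliders s a m = univ ×ˢ ({a} ×ˢ {m}) := by
    ext v
    simp only [colliders, mem_ofPred_eq, mem_prod, mem_univ, mem_singleton_iff, true_and]
  rw [hQ.measure_eq_zero (measurableSet_colliders s a m), e, cellMeasure, Measure.smul_apply,
    Measure.prod_prod, Measure.prod_prod, finUniform_singleton, finUniform_singleton,
    Measure.restrict_apply_univ, s.cell_area, smul_eq_mul, ← ENNReal.ofReal_natCast s.Npa,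
    ← ENNReal.ofReal_natCast s.Mra, ← ENNReal.ofReal_inv_of_pos hA, ← ENNReal.ofReal_inv_of_pos hM,
    ← ENNReal.ofReal_mul (by positivity), ← ENNReal.ofReal_mul (by positivity),
    ← ENNReal.ofReal_mul (by positivity), eNeg, expNeg_ofReal (by positivity), Network.Pco]
  congr 3
  field_simp

/-! #### Success of random access -/

/-- The randomness of random access: the preamble of the typical user, the users of the tagged cell,
the potential interferers and the uplink fading. -/
abbrev RASpace : Type := Fin s.Npa × (Measure (CellUser s) × (Measure (RAUser s) × ℝ))

/-- The event that random access at the base station `x.1` succeeds. -/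
def raSet : Set (BS × RASpace s) :=
  {x | ∃ m : Fin s.Mra, (0 : ℂ) ∈ beam x.1.1 s.Mra m ∧ x.2.2.1 (colliders s x.2.1 m) = 0 ∧
    (x.1, x.2.2.2) ∈ sinrSet s x.2.1 m}

lemma measurableSet_raSet : MeasurableSet (raSet s) := by
  have e : raSet s = ⋃ (a : Fin s.Npa) (m : Fin s.Mra), {x | x.2.1 = a} ∩
      ({x | (0 : ℂ) ∈ beam x.1.1 s.Mra m} ∩ ({x | x.2.2.1 (colliders s a m) = 0} ∩
        {x | (x.1, x.2.2.2) ∈ sinrSet s a m})) := by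
    ext x
    simp [raSet]
  rw [e]
  refine MeasurableSet.iUnion fun a => MeasurableSet.iUnion fun m => ?_
  have h1 : Measurable fun x : BS × RASpace s => x.2.1 := measurable_fst.comp measurable_snd
  have h2 : Measurable fun x : BS × RASpace s => (x.1.1, (0 : ℂ)) :=
    (measurable_fst.comp measurable_fst).prodMk measurable_const
  have h3 : Measurable fun x : BS × RASpace s => x.2.2.1 (colliders s a m) :=
    (Measure.measurable_coe (measurableSet_colliders s a m)).comp
      (measurable_fst.comp (measurable_snd.comp measurable_snd))
  have h4 : Measurable fun x : BS × RASpace s => (x.1, x.2.2.2) :=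
    measurable_fst.prodMk (measurable_snd.comp (measurable_snd.comp measurable_snd))
  exact (h1 (measurableSet_singleton a)).inter ((h2 (measurableSet_beam_prod m.2)).inter
    ((h3 (measurableSet_singleton 0)).inter (h4 (measurableSet_sinrSet s a m))))

/-- The probability that random access succeeds at a base station depends only on the path loss, since
given the preamble and the beam that covers the typical user, collisions and SINR are independent. -/
lemma measure_raSet (hproto : s.Nra = 1 ∨ (s.Mra = 1 ∧ s.Ncs = 1))
    {QU : Measure (Measure (RAUser s))} {QC : Measure (Measure (CellUser s))}
    (hQU : IsPoissonLaw QU (userMeasure s (s.lamU * s.cellSearchProb)))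
    (hQC : IsPoissonLaw QC (cellMeasure s (s.lamU * s.cellSearchProb)))
    (hcs : 0 ≤ s.cellSearchProb) {p : BS} (hp : p.1 ≠ 0) :
    ((finUniform s.Npa).prod (QC.prod (QU.prod (expMeasure 1)))) {y | (p, y) ∈ raSet s} =
      ENNReal.ofReal (s.Pco * s.Pra (Cycle.bsLoss s p)) := by
  have := hQU.isProbabilityMeasure
  have := hQC.isProbabilityMeasure
  have hset : MeasurableSet {y : RASpace s | (p, y) ∈ raSet s} :=
    measurable_prodMk_left (measurableSet_raSet s)
  obtain ⟨m, hm, huniq⟩ := existsUnique_mem_beam (k := s.Mra) s.Mra_pos (x := 0 - p.1)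
    (by simpa using hp)
  rw [Measure.prod_apply hset]
  have h1 : ∀ a : Fin s.Npa, (QC.prod (QU.prod (expMeasure 1))) (Prod.mk a ⁻¹' {y | (p, y) ∈ raSet s}) =
      ENNReal.ofReal (s.Pco * s.Pra (Cycle.bsLoss s p)) := by
    intro a
    have e : Prod.mk a ⁻¹' {y : RASpace s | (p, y) ∈ raSet s} =
        {N | N (colliders s a m) = 0} ×ˢ {y | (p, y) ∈ sinrSet s a m} := by
      ext y
      simp only [mem_preimage, raSet, mem_ofPred_eq, mem_prod]
      constructor
      · rintro ⟨m', h0, h⟩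
        rw [huniq m' ((mem_beam_iff_sub _ _ _ _).1 h0)] at h
        exact h
      · exact fun h => ⟨m, (mem_beam_iff_sub _ _ _ _).2 hm, h⟩
    rw [e, Measure.prod_prod, measure_noCollision s hQC hcs,
      lintegral_sinrSet s hproto hQU hcs hp,
      ← ENNReal.ofReal_mul (show 0 ≤ s.Pco from (Real.exp_pos _).le)]
  simp_rw [h1]
  simp

end MmWave

namespace MmWave

/-! ### The success probability of a cycle -/

lemma indepFun_of_iIndep {Ω ι X Y : Type*} {mΩ : MeasurableSpace Ω} [MeasurableSpace X]
    [MeasurableSpace Y] {P : Measure Ω} {m : ι → MeasurableSpace Ω} (hle : ∀ i, m i ≤ mΩ)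
    (h : iIndep m P) {S T : Set ι} (hST : Disjoint S T) {f : Ω → X} {g : Ω → Y}
    (hf : Measurable[⨆ i ∈ S, m i] f) (hg : Measurable[⨆ i ∈ T, m i] g) : IndepFun f g P := by
  rw [IndepFun_iff_Indep]
  exact indep_of_indep_of_le_left (indep_of_indep_of_le_right
    (indep_iSup_of_disjoint hle h hST) hg.comap_le) hf.comap_le

namespace Cycle

variable {Ω : Type*} {s : Network} (C : Cycle Ω s)

/-- The counting measure of the potential interferers. -/
def userPoints (ω : Ω) : Measure (RAUser s) := pointMeasure (C.users ω)

/-- The counting measure of the users that can collide. -/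
def cellPoints (ω : Ω) : Measure (CellUser s) := pointMeasure (C.cellUsers ω)

/-- The random objects of random access. -/
def raPoint (ω : Ω) : RASpace s := (C.preamble ω, (C.cellPoints ω, (C.userPoints ω, C.fade ω)))

/-- The number of tagged base stations at which random access succeeds. It is almost surely `0` or
`1`, and unlike the event of success it is an integral against the base station process. -/
def successCount (s : Network) (x : Measure BS × RASpace s) : ℝ≥0∞ :=
  locKernel (bsMeasure s) x.1 {p | (p, x.1) ∈ tagSet s ∧ (p, x.2) ∈ raSet s}

lemma measurable_successCount : Measurable (successCount s) := by
  have h1 : Measurable fun x : (Measure BS × RASpace s) × BS => (x.2, x.1.1) :=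
    measurable_snd.prodMk (measurable_fst.comp measurable_fst)
  have h2 : Measurable fun x : (Measure BS × RASpace s) × BS => (x.2, x.1.2) :=
    measurable_snd.prodMk (measurable_snd.comp measurable_fst)
  exact measurable_locKernel_apply (bsMeasure s) measurable_fst
    (T := {x : (Measure BS × RASpace s) × BS | (x.2, x.1.1) ∈ tagSet s ∧ (x.2, x.1.2) ∈ raSet s})
    ((h1 (measurableSet_tagSet s)).inter (h2 (measurableSet_raSet s)))

variable {C}

lemma measurable_fade : Measurable[C.parts 3] C.fade := comap_measurable _

lemma measurable_preamble : Measurable[C.parts 4] C.preamble := comap_measurable _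

lemma measurable_iSup_parts {X : Type*} [MeasurableSpace X] {S : Set (Fin 5)} {i : Fin 5} (hi : i ∈ S)
    {f : Ω → X} (hf : Measurable[C.parts i] f) : Measurable[⨆ i ∈ S, C.parts i] f :=
  hf.mono (le_iSup₂_of_le i hi le_rfl) le_rfl

section model

variable [MeasurableSpace Ω] {P : Measure Ω}

lemma IsModel.parts_le (h : C.IsModel P) (i : Fin 5) : C.parts i ≤ ‹MeasurableSpace Ω› := by
  fin_cases i
  · exact pointSigma_le h.bs_law
  · exact pointSigma_le h.users_law
  · exact pointSigma_le h.cellUsers_law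
  · exact h.fade_meas.comap_le
  · exact h.preamble_meas.comap_le

lemma IsModel.measurable_bsPoints (h : C.IsModel P) : Measurable[C.parts 0] C.bsPoints :=
  MmWave.measurable_pointMeasure h.bs_law.countable

lemma IsModel.measurable_userPoints (h : C.IsModel P) : Measurable[C.parts 1] C.userPoints :=
  MmWave.measurable_pointMeasure h.users_law.countable

lemma IsModel.measurable_cellPoints (h : C.IsModel P) : Measurable[C.parts 2] C.cellPoints :=
  MmWave.measurable_pointMeasure h.cellUsers_law.countable

lemma IsModel.mem_raSet_iff (h : C.IsModel P) {ω : Ω}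
    (hU : C.userPoints ω ∈ locFinite (userMeasure s (s.lamU * s.cellSearchProb))) (p : BS) :
    (p, C.raPoint ω) ∈ raSet s ↔ ∃ m : Fin s.Mra, (0 : ℂ) ∈ beam p.1 s.Mra m ∧
      C.NoCollision ω m ∧ ENNReal.ofReal s.Gra ≤ C.sinrPA ω p m := by
  refine exists_congr fun m => and_congr_right fun _ => and_congr ?_ ?_
  · change pointMeasure (C.cellUsers ω) (colliders s (C.preamble ω) m) = 0 ↔ _
    rw [pointMeasure_eq_zero_iff (h.cellUsers_law.countable ω) (measurableSet_colliders s _ m)]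
    rfl
  · change ENNReal.ofReal s.Gra ≤ ENNReal.ofReal (C.fade ω * s.Mra * s.raMain / bsLoss s p) /
      ((∫⁻ u in interferers s p.1 (C.preamble ω) m, userPower s p.1 u
          ∂locKernel (userMeasure s (s.lamU * s.cellSearchProb)) (C.userPoints ω)) +
        ENNReal.ofReal (s.noise / s.Pu)) ↔ _
    rw [locKernel_of_mem hU, userPoints, setLIntegral_pointMeasure (h.users_law.countable ω) _
      (measurableSet_interferers s _ _ m)]
    rfl

lemma IsModel.sigma_le (h : C.IsModel P) : C.sigma ≤ ‹MeasurableSpace Ω› := iSup_le h.parts_le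

lemma IsModel.measurable_raPoint (h : C.IsModel P) {S : Set (Fin 5)} (hS : {1, 2, 3, 4} ⊆ S) :
    Measurable[⨆ i ∈ S, C.parts i] C.raPoint :=
  (measurable_iSup_parts (hS (by simp)) measurable_preamble).prodMk
    ((measurable_iSup_parts (hS (by simp)) h.measurable_cellPoints).prodMk
      ((measurable_iSup_parts (hS (by simp)) h.measurable_userPoints).prodMk
        (measurable_iSup_parts (hS (by simp)) measurable_fade)))

variable [IsProbabilityMeasure P]

/-- The law of the random objects of a cycle. -/
lemma IsModel.map_prod (h : C.IsModel P) :
    P.map (fun ω => (C.bsPoints ω, C.raPoint ω)) =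
      (P.map C.bsPoints).prod ((finUniform s.Npa).prod
        ((P.map C.cellPoints).prod ((P.map C.userPoints).prod (expMeasure 1)))) := by
  have hle := h.parts_le
  have m0 := h.measurable_bsPoints.mono (hle 0) le_rfl
  have m1 := h.measurable_userPoints.mono (hle 1) le_rfl
  have m2 := h.measurable_cellPoints.mono (hle 2) le_rfl
  have m3 := h.fade_meas
  have m4 := h.preamble_meas
  have i1 : IndepFun C.userPoints C.fade P :=
    indepFun_of_iIndep hle h.indep (S := {1}) (T := {3}) (by simp)
      (measurable_iSup_parts (by simp) h.measurable_userPoints)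
      (measurable_iSup_parts (by simp) measurable_fade)
  have i2 : IndepFun C.cellPoints (fun ω => (C.userPoints ω, C.fade ω)) P :=
    indepFun_of_iIndep hle h.indep (S := {2}) (T := {1, 3}) (by simp)
      (measurable_iSup_parts (by simp) h.measurable_cellPoints)
      ((measurable_iSup_parts (by simp) h.measurable_userPoints).prodMk
        (measurable_iSup_parts (by simp) measurable_fade))
  have i3 : IndepFun C.preamble (fun ω => (C.cellPoints ω, (C.userPoints ω, C.fade ω))) P :=
    indepFun_of_iIndep hle h.indep (S := {4}) (T := {1, 2, 3}) (by simp)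
      (measurable_iSup_parts (by simp) measurable_preamble)
      ((measurable_iSup_parts (by simp) h.measurable_cellPoints).prodMk
        ((measurable_iSup_parts (by simp) h.measurable_userPoints).prodMk
          (measurable_iSup_parts (by simp) measurable_fade)))
  have i4 : IndepFun C.bsPoints C.raPoint P :=
    indepFun_of_iIndep hle h.indep (S := {0}) (T := {1, 2, 3, 4}) (by simp)
      (measurable_iSup_parts (by simp) h.measurable_bsPoints) (h.measurable_raPoint le_rfl)
  have m13 : Measurable fun ω => (C.userPoints ω, C.fade ω) := m1.prodMk m3
  have m213 : Measurable fun ω => (C.cellPoints ω, (C.userPoints ω, C.fade ω)) := m2.prodMk m13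
  have m4213 : Measurable C.raPoint := m4.prodMk m213
  rw [(indepFun_iff_map_prod_eq_prod_map_map m0.aemeasurable m4213.aemeasurable).1 i4]
  unfold raPoint
  rw [(indepFun_iff_map_prod_eq_prod_map_map m4.aemeasurable m213.aemeasurable).1 i3,
    (indepFun_iff_map_prod_eq_prod_map_map m2.aemeasurable m13.aemeasurable).1 i2,
    (indepFun_iff_map_prod_eq_prod_map_map m1.aemeasurable m3.aemeasurable).1 i1,
    h.fade_law, h.preamble_law]

/-- The intensity of the model involves the probability of cell search, which is `cellSearchProb`. -/
lemma IsModel.users_process (h : C.IsModel P) :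
    IsPoissonProcess P C.users (userMeasure s (s.lamU * s.cellSearchProb)) := by
  have h1 := h.users_law
  rw [h.raIntensity_eq] at h1
  exact h1

lemma IsModel.cellUsers_process (h : C.IsModel P) :
    IsPoissonProcess P C.cellUsers (cellMeasure s (s.lamU * s.cellSearchProb)) := by
  have h1 := h.cellUsers_law
  rw [h.raIntensity_eq] at h1
  exact h1

/-- Almost surely, initial access succeeds iff `successCount` is one, and it is zero otherwise. -/
lemma IsModel.ae_successCount (h : C.IsModel P) :
    ∀ᵐ ω ∂P, (C.Success ω ∧ successCount s (C.bsPoints ω, C.raPoint ω) = 1) ∨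
      (¬ C.Success ω ∧ successCount s (C.bsPoints ω, C.raPoint ω) = 0) := by
  have hU := ae_of_ae_map h.users_process.measurable_pointMeasure.aemeasurable
    h.users_process.isPoissonLaw.ae_mem_locFinite
  filter_upwards [h.ae_locFinite, h.ae_injOn, hU] with ω h1 h2 h3
  have hc := h.bs_law.countable ω
  have hset : MeasurableSet {p | (p, C.bsPoints ω) ∈ tagSet s ∧ (p, C.raPoint ω) ∈ raSet s} :=
    (measurable_prodMk_right (measurableSet_tagSet s)).inter
      (measurable_prodMk_right (measurableSet_raSet s))
  have hsucc : C.Success ω ↔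
      ∃ p ∈ C.bs ω, (p, C.bsPoints ω) ∈ tagSet s ∧ (p, C.raPoint ω) ∈ raSet s := by
    constructor
    · rintro ⟨-, p, hp, hm⟩
      obtain ⟨hpb, hpt⟩ := (isTagged_iff hc h1).1 hp
      exact ⟨p, hpb, hpt, (h.mem_raSet_iff h3 p).2 hm⟩
    · rintro ⟨p, hpb, hpt, hr⟩
      have hp := (isTagged_iff hc h1).2 ⟨hpb, hpt⟩
      exact ⟨hp.cellSearch, p, hp, (h.mem_raSet_iff h3 p).1 hr⟩
  have hval : successCount s (C.bsPoints ω, C.raPoint ω) =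
      pointMeasure (C.bs ω) {p | (p, C.bsPoints ω) ∈ tagSet s ∧ (p, C.raPoint ω) ∈ raSet s} := by
    simp only [successCount]
    rw [locKernel_of_mem h1]
    rfl
  have h0 : successCount s (C.bsPoints ω, C.raPoint ω) = 0 ↔ ¬ C.Success ω := by
    rw [hval, pointMeasure_eq_zero_iff hc hset, hsucc]
    simp only [mem_ofPred_eq, not_exists, not_and]
  have h01 : successCount s (C.bsPoints ω, C.raPoint ω) = 0 ∨
      successCount s (C.bsPoints ω, C.raPoint ω) = 1 := by
    rw [hval]
    refine pointMeasure_of_subsingleton hc hset ?_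
    rintro p ⟨hp, hpt, -⟩ q ⟨hq, hqt, -⟩
    exact IsTagged.eq h2 ((isTagged_iff hc h1).2 ⟨hp, hpt⟩) ((isTagged_iff hc h1).2 ⟨hq, hqt⟩)
  rcases h01 with h | h
  · exact Or.inr ⟨h0.1 h, h⟩
  · exact Or.inl ⟨not_not.1 fun hn => by simp [h0.2 hn] at h, h⟩

/-- The success probability of initial access: the randomness of random access is integrated out
given the tagged base station. -/
lemma IsModel.measure_success (h : C.IsModel P) (hproto : s.Nra = 1 ∨ (s.Mra = 1 ∧ s.Ncs = 1)) :
    P {ω | C.Success ω} =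
      ∫⁻ z in Ioi (0 : ℝ), ENNReal.ofReal (s.servingLossDensity z * s.Pco * s.Pra z) := by
  have hle := h.lintegral_detectRate_le_one
  have hcs := s.cellSearchProb_nonneg hle
  have hU := h.users_process.isPoissonLaw
  have hK := h.cellUsers_process.isPoissonLaw
  have hB := h.bs_process.isPoissonLaw
  have := hU.isProbabilityMeasure
  have := hK.isProbabilityMeasure
  have hBprob := hB.isProbabilityMeasure
  have m0 := h.measurable_bsPoints.mono (h.parts_le 0) le_rfl
  have m1 : Measurable C.raPoint :=
    (h.measurable_raPoint le_rfl).mono (iSup₂_le fun i _ => h.parts_le i) le_rfl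
  have e1 : P {ω | C.Success ω} = ∫⁻ ω, successCount s (C.bsPoints ω, C.raPoint ω) ∂P := by
    have hm : Measurable fun ω => successCount s (C.bsPoints ω, C.raPoint ω) :=
      measurable_successCount.comp (m0.prodMk m1)
    have hA : MeasurableSet {ω | successCount s (C.bsPoints ω, C.raPoint ω) = 1} :=
      hm (measurableSet_singleton 1)
    have : P {ω | C.Success ω} = P {ω | successCount s (C.bsPoints ω, C.raPoint ω) = 1} := by
      refine measure_congr ?_
      filter_upwards [h.ae_successCount] with ω hω
      refine propext ?_
      change C.Success ω ↔ successCount s (C.bsPoints ω, C.raPoint ω) = 1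
      rcases hω with ⟨a, b⟩ | ⟨a, b⟩ <;> simp [a, b]
    rw [this, ← lintegral_indicator_one hA]
    refine lintegral_congr_ae ?_
    filter_upwards [h.ae_successCount] with ω hω
    rcases hω with ⟨-, b⟩ | ⟨-, b⟩ <;> simp [indicator, b]
  have hpair : Measurable fun ω => (C.bsPoints ω, C.raPoint ω) := m0.prodMk m1
  rw [e1, ← lintegral_map (f := successCount s) measurable_successCount hpair, h.map_prod]
  set ν : Measure (RASpace s) := (finUniform s.Npa).prod
    ((P.map C.cellPoints).prod ((P.map C.userPoints).prod (expMeasure 1))) with hν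
  have hνp : IsProbabilityMeasure ν := by
    have h1 : IsProbabilityMeasure (P.map C.userPoints) := hU.isProbabilityMeasure
    have h2 : IsProbabilityMeasure (P.map C.cellPoints) := hK.isProbabilityMeasure
    infer_instance
  rw [lintegral_prod _ measurable_successCount.aemeasurable]
  let g : ℝ → ℝ≥0∞ := fun z => ENNReal.ofReal (s.Pco * s.Pra z)
  have hg : Measurable g := (s.measurable_Pra.const_mul _).ennreal_ofReal
  have e2 : ∀ N : Measure BS, ∫⁻ y, successCount s (N, y) ∂ν =
      ∫⁻ p in {p | (p, N) ∈ tagSet s}, g (bsLoss s p) ∂locKernel (bsMeasure s) N := by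
    intro N
    have ht : MeasurableSet {p | (p, N) ∈ tagSet s} := measurable_prodMk_right (measurableSet_tagSet s)
    have hr : ∀ y, MeasurableSet {p | (p, y) ∈ raSet s} :=
      fun y => measurable_prodMk_right (measurableSet_raSet s)
    have h1 : ∀ y, successCount s (N, y) =
        ∫⁻ p in {p | (p, N) ∈ tagSet s}, (raSet s).indicator 1 (p, y) ∂locKernel (bsMeasure s) N := by
      intro y
      have h2 : (fun p => (raSet s).indicator (1 : BS × RASpace s → ℝ≥0∞) (p, y)) =
          {p | (p, y) ∈ raSet s}.indicator 1 := rfl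
      rw [h2, lintegral_indicator_one (hr y), Measure.restrict_apply (hr y), inter_comm]
      rfl
    simp_rw [h1]
    have hind : Measurable fun x : RASpace s × BS =>
        (raSet s).indicator (1 : BS × RASpace s → ℝ≥0∞) (x.2, x.1) :=
      (measurable_one.indicator (measurableSet_raSet s)).comp measurable_swap
    rw [lintegral_lintegral_swap hind.aemeasurable]
    refine setLIntegral_congr_fun ht fun p hp => ?_
    obtain ⟨j, ⟨-, hpj⟩, -⟩ := hp
    -- the origin lies in no sector, so that the tagged base station is off the typical user
    have hp0 : p.1 ≠ 0 := ((mem_beam_zero j.2).1 hpj).1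
    have h3 : (fun y => (raSet s).indicator (1 : BS × RASpace s → ℝ≥0∞) (p, y)) =
        {y | (p, y) ∈ raSet s}.indicator 1 := rfl
    have h4 : MeasurableSet {y : RASpace s | (p, y) ∈ raSet s} :=
      measurable_prodMk_left (measurableSet_raSet s)
    change ∫⁻ y, (raSet s).indicator (1 : BS × RASpace s → ℝ≥0∞) (p, y) ∂ν = _
    rw [h3, lintegral_indicator_one h4]
    exact measure_raSet s hproto hU hK hcs hp0
  simp_rw [e2]
  refine (lintegral_tagSet s h.bs_process hg).trans ?_
  refine setLIntegral_congr_fun measurableSet_Ioi fun z hz => ?_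
  have hPco : 0 ≤ s.Pco := (Real.exp_pos _).le
  have hPra0 : 0 ≤ s.Pra z :=
    mul_nonneg (mul_nonneg (Real.exp_pos _).le (s.U_nonneg _ _ _)) (s.U_nonneg _ _ _)
  simp only [g]
  rw [← ENNReal.ofReal_mul (mul_nonneg hPco hPra0)]
  congr 1
  ring

/-- Success of initial access is, up to a null event, an event of the σ-algebra of the cycle. -/
lemma IsModel.exists_measurableSet_success (h : C.IsModel P) :
    ∃ A, MeasurableSet[C.sigma] A ∧ ∀ᵐ ω ∂P, ω ∈ A ↔ C.Success ω := by
  have hle : ∀ i, C.parts i ≤ C.sigma := fun i => le_iSup C.parts i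
  have m0 : Measurable[C.sigma] C.bsPoints := h.measurable_bsPoints.mono (hle 0) le_rfl
  have m1 : Measurable[C.sigma] C.raPoint :=
    (h.measurable_raPoint le_rfl).mono (iSup₂_le fun i _ => hle i) le_rfl
  have hm : Measurable[C.sigma] fun ω => successCount s (C.bsPoints ω, C.raPoint ω) :=
    measurable_successCount.comp (m0.prodMk m1)
  refine ⟨_, hm (measurableSet_singleton 1), ?_⟩
  filter_upwards [h.ae_successCount] with ω hω
  change successCount s (C.bsPoints ω, C.raPoint ω) = 1 ↔ _
  rcases hω with ⟨a, b⟩ | ⟨a, b⟩ <;> simp [a, b]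

end model

end Cycle

end MmWave

namespace MmWave

namespace Cycle

variable {Ω : Type*} {s : Network} {C : Cycle Ω s} [MeasurableSpace Ω] {P : Measure Ω}
  [IsProbabilityMeasure P]

lemma IsModel.success_density_nonneg (h : C.IsModel P) {z : ℝ} (hz : 0 < z) :
    0 ≤ s.servingLossDensity z * s.Pco * s.Pra z :=
  mul_nonneg (mul_nonneg (s.servingLossDensity_nonneg h.lintegral_detectRate_le_one hz)
    (Real.exp_pos _).le)
    (mul_nonneg (mul_nonneg (Real.exp_pos _).le (s.U_nonneg _ _ _)) (s.U_nonneg _ _ _))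

lemma IsModel.integrableOn_success_density (h : C.IsModel P)
    (hproto : s.Nra = 1 ∨ (s.Mra = 1 ∧ s.Ncs = 1)) :
    IntegrableOn (fun z => s.servingLossDensity z * s.Pco * s.Pra z) (Ioi 0) := by
  have hm := ((s.aemeasurable_servingLossDensity h.lintegral_detectRate_le_one).mul_const s.Pco).mul
    s.measurable_Pra.aemeasurable
  refine ⟨hm.aestronglyMeasurable, ?_⟩
  rw [hasFiniteIntegral_iff_ofReal]
  · rw [← h.measure_success hproto]
    exact measure_lt_top P _
  · exact (ae_restrict_iff' measurableSet_Ioi).2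
      (Filter.Eventually.of_forall fun z hz => h.success_density_nonneg hz)

lemma IsModel.measure_success_eq_ofReal (h : C.IsModel P)
    (hproto : s.Nra = 1 ∨ (s.Mra = 1 ∧ s.Ncs = 1)) :
    P {ω | C.Success ω} =
      ENNReal.ofReal (∫ z in Ioi (0 : ℝ), s.servingLossDensity z * s.Pco * s.Pra z) := by
  rw [h.measure_success hproto, ofReal_integral_eq_lintegral_ofReal
    (h.integrableOn_success_density hproto)]
  exact (ae_restrict_iff' measurableSet_Ioi).2
      (Filter.Eventually.of_forall fun z hz => h.success_density_nonneg hz)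

end Cycle

/-! ### The delay -/

section delay

variable {Ω : Type*} {s : Network} {C : ℕ → Cycle Ω s}

open Classical in
/-- The number of cycles before the first success is the number of `n` such that none of the cycles
`0, …, n` is successful. -/
lemma numCycles_sub_one (ω : Ω) :
    ((numCycles C ω : ℝ≥0∞) - 1) = ∑' n : ℕ, if ∀ c ≤ n, ¬ (C c).Success ω then 1 else 0 := by
  by_cases hex : ∃ c, (C c).Success ω
  · set k := Nat.find hex with hk
    have hnum : numCycles C ω = ((k + 1 : ℕ) : ℕ∞) := by
      refine le_antisymm (iInf₂_le k (Nat.find_spec hex)) (le_iInf₂ fun c hc => ?_)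
      exact_mod_cast Nat.succ_le_succ (Nat.find_min' hex hc)
    have hiff : ∀ n, (∀ c ≤ n, ¬ (C c).Success ω) ↔ n ∈ Finset.range k := by
      intro n
      rw [Finset.mem_range, hk, Nat.lt_find_iff]
    simp_rw [hiff]
    rw [tsum_eq_sum (s := Finset.range k) fun n hn => if_neg hn, Finset.sum_ite_mem, Finset.inter_self]
    simp [hnum]
  · push Not at hex
    have hnum : numCycles C ω = ⊤ := by simp [numCycles, hex]
    simp [hnum, hex]

variable [MeasurableSpace Ω] {P : Measure Ω} [IsProbabilityMeasure P]

/-- The mean number of cycles before the first success, that of a geometric distribution. For `η = 0`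
both sides are `∞`. -/
lemma lintegral_numCycles_sub_one (hmodel : ∀ c, (C c).IsModel P)
    (hcycles : iIndep (fun c => (C c).sigma) P) {η : ℝ≥0∞} (hη : ∀ c, P {ω | (C c).Success ω} = η) :
    ∫⁻ ω, ((numCycles C ω : ℝ≥0∞) - 1) ∂P = η⁻¹ - 1 := by
  classical
  choose A hA hAs using fun c => (hmodel c).exists_measurableSet_success
  have hAm : ∀ c, MeasurableSet (A c) := fun c => (hmodel c).sigma_le _ (hA c)
  have hPA : ∀ c, P (A c)ᶜ = 1 - η := by
    intro c
    rw [prob_compl_eq_one_sub (hAm c), ← hη c]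
    congr 1
    exact measure_congr ((hAs c).mono fun ω hω => propext hω)
  have hη1 : η ≤ 1 := by rw [← hη 0]; exact prob_le_one
  have hBm : ∀ n, MeasurableSet (⋂ c ∈ Finset.range (n + 1), (A c)ᶜ) := fun n =>
    MeasurableSet.biInter (Finset.countable_toSet _) fun c _ => (hAm c).compl
  have hPB : ∀ n, P (⋂ c ∈ Finset.range (n + 1), (A c)ᶜ) = (1 - η) ^ (n + 1) := by
    intro n
    rw [hcycles.meas_biInter fun c _ => (hA c).compl]
    simp [hPA]
  have hsum : ∀ᵐ ω ∂P, ((numCycles C ω : ℝ≥0∞) - 1) =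
      ∑' n, (⋂ c ∈ Finset.range (n + 1), (A c)ᶜ).indicator (1 : Ω → ℝ≥0∞) ω := by
    filter_upwards [ae_all_iff.2 hAs] with ω hω
    rw [numCycles_sub_one]
    refine tsum_congr fun n => ?_
    simp only [indicator, mem_iInter, mem_compl_iff, hω, Finset.mem_range, Nat.lt_succ_iff,
      Pi.one_apply]
  rw [lintegral_congr_ae hsum, lintegral_tsum fun n => (measurable_one.indicator (hBm n)).aemeasurable]
  simp_rw [lintegral_indicator_one (hBm _), hPB]
  rw [ENNReal.tsum_geometric_add_one, ENNReal.sub_sub_cancel ENNReal.one_ne_top hη1]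
  rcases eq_or_ne η 0 with rfl | h0
  · simp
  · rw [ENNReal.sub_mul fun _ _ => ENNReal.inv_ne_top.2 h0, one_mul,
      ENNReal.mul_inv_cancel h0 (hη1.trans_lt ENNReal.one_lt_top).ne]

end delay

end MmWave

end

theorem theorem2 {Ω : Type*} [MeasurableSpace Ω] (P : Measure Ω) [IsProbabilityMeasure P]
    (s : MmWave.Network)
    (hproto : s.Nra = 1 ∨ (s.Mra = 1 ∧ s.Ncs = 1))
    (C : ℕ → MmWave.Cycle Ω s)
    (hmodel : ∀ c, (C c).IsModel P)
    (hcycles : iIndep (fun c => (C c).sigma) P) :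
    IntegrableOn (fun z => s.servingLossDensity z * s.Pco * s.Pra z) (Ioi 0) ∧
    (∀ c, P.real {ω | (C c).Success ω} =
      ∫ z in Ioi (0 : ℝ), s.servingLossDensity z * s.Pco * s.Pra z) ∧
    ∫⁻ ω, MmWave.delay C ω ∂P =
      ((ENNReal.ofReal (∫ z in Ioi (0 : ℝ), s.servingLossDensity z * s.Pco * s.Pra z))⁻¹ - 1) *
          ENNReal.ofReal s.T +
        ENNReal.ofReal (s.Mcs * s.Ncs * s.tauCs + s.Mra * s.Nra * s.tauRa) := by
  have hη := fun c => (hmodel c).measure_success_eq_ofReal hproto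
  refine ⟨(hmodel 0).integrableOn_success_density hproto, fun c => ?_, ?_⟩
  · rw [measureReal_def, hη c, ENNReal.toReal_ofReal]
    exact setIntegral_nonneg measurableSet_Ioi fun z hz => (hmodel c).success_density_nonneg hz
  · unfold MmWave.delay
    rw [lintegral_add_right _ measurable_const, lintegral_mul_const' _ _ ENNReal.ofReal_ne_top,
      MmWave.lintegral_numCycles_sub_one hmodel hcycles hη, lintegral_const, measure_univ, mul_one]
    rfl
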